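/- Let $\Omega\subset\mathbb R^2$ be a bounded domain with Lipschitz boundary, $\mathbf V=(H^1_0(\Omega))^2$, $Q=L^2_0(\Omega)$, and $$a(\mathbf u,\mathbf v)=\int_\Omega\nabla\mathbf u:\nabla\mathbf v,\qquad b(\mathbf v,p)=\int_\Omega p\,\nabla\!\cdot\mathbf v,\qquad r(\mathbf u,\mathbf v)=\int_\Omega\mathbf u\cdot\mathbf v .$$ Let $\|\cdot\|_1$ be the $H^1$ norm, $\|\cdot\|_0$ the $L^2$ norm, and $\|\mathbf f\|_{-1}=\sup\{r(\mathbf f,\mathbf v):\mathbf v\in\mathbf V,\ \|\mathbf v\|_1\le1\}$. Let $\lambda\in\mathbb R$. *Exact eigenpair.* Let $(\mathbf u,p)\in\mathbf V\times Q$ satisfy $r(\mathbf u,\mathbf u)=1$, $a(\mathbf u,\mathbf v)-b(\mathbf v,p)=\lambda r(\mathbf u,\mathbf v)$ for all $\mathbf v\in\mathbf V$, and $b(\mathbf u,q)=0$ for all $q\in Q$. *Stabilization.* Given a decomposition $\mathcal T_h$ of $\overline\Omega$ into finitely many closed cells $K$ with Lipschitz boundary and disjoint interiors, finite dimensional spaces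 $D_h(K)\subset L^2(K)$ containing the polynomials of degree $\le s$ for some fixed $s\ge-1$ (no condition if $s=-1$), and parameters $\alpha_K\ge0$, put $S_h(p,q)=\sum_{K}\alpha_K(\kappa_h\nabla p,\kappa_h\nabla q)_{L^2(K)}$ for $p,q\in H^1(\Omega)$, where $\kappa_h=\mathrm{id}-\pi_h$ and $\pi_h$ is, on each $K$ and componentwise, the $L^2(K)$-orthogonal projection onto $D_h(K)$. *Discrete eigenpair.* Let $V_h$ be a finite dimensional space of continuous functions on $\overline\Omega$ that are polynomial on each cell of $\mathcal T_h$, $\mathbf V_h=V_h^2\cap\mathbf V$, $Q_h=V_h\cap Q$, and let $(\mathbf u_h,p_h,\lambda_h)\in\mathbf V_h\times Q_h\times\mathbb R$ satisfy $r(\mathbf u_h,\mathbf u_h)=1$, $a(\mathbf u_h,\mathbf v)-b(\mathbf v,p_h)=\lambda_hr(\mathbf u_h,\mathbf v)$ for all $\mathbf v\in\mathbf V_h$, and $b(\mathbf u_h,q)+S_h(p_h,q)=0$ for all $q\in Q_h$. *Auxiliary source problem.* Let $(\tilde{\mathbf u},\tilde p)\in\mathbf V\times Q$ satisfy $a(\tilde{\mathbf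 u},\mathbf v)-b(\mathbf v,\tilde p)=\lambda_hr(\mathbf u_h,\mathbf v)$ for all $\mathbf v\in\mathbf V$ and $b(\tilde{\mathbf u},q)=0$ for all $q\in Q$. *Discrete source problem.* Let $\tilde{\mathbf V}_h\times\tilde Q_h$ be an enriched space, $\mathbf V_h\times Q_h\subset\tilde{\mathbf V}_h\times\tilde Q_h\subset\mathbf V\times(Q\cap H^1(\Omega))$, let $\tilde S_h$ be the stabilization form used with it (of the above kind, on the same or on another mesh), and let $(\tilde{\mathbf u}_h,\tilde p_h)\in\tilde{\mathbf V}_h\times\tilde Q_h$ satisfy $a(\tilde{\mathbf u}_h,\mathbf v)-b(\mathbf v,\tilde p_h)=\lambda_hr(\mathbf u_h,\mathbf v)$ for all $\mathbf v\in\tilde{\mathbf V}_h$ and $b(\tilde{\mathbf u}_h,q)+\tilde S_h(\tilde p_h,q)=0$ for all $q\in\tilde Q_h$. Put $\tilde\lambda_h=a(\tilde{\mathbf u}_h,\tilde{\mathbf u}_h)/r(\tilde{\mathbf u}_h,\tilde{\mathbf u}_h)$ and $$\varepsilon=\|\mathbf u-\mathbf u_h\|_{-1}+|\lambda-\lambda_h|+\|\tilde{\mathbf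 u}-\tilde{\mathbf u}_h\|_1+\|\tilde p-\tilde p_h\|_0 .$$ Then there is $\delta>0$ depending only on $\Omega$ and $\lambda$, and for every $c_0>0$ there is $C>0$ depending only on $\Omega$, $\lambda$ and $c_0$ (and not on the meshes, the discrete spaces or the stabilizations), such that $$\|\tilde{\mathbf u}_h-\mathbf u\|_1+\|\tilde p_h-p\|_0\le C\varepsilon$$ and, whenever $\varepsilon\le\delta$ or $r(\tilde{\mathbf u}_h,\tilde{\mathbf u}_h)\ge c_0$, $$|\tilde\lambda_h-\lambda|\le C\varepsilon^2+C\,\tilde S_h(\tilde p_h,\tilde p_h).$$ -/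

import Mathlib

open MeasureTheory Filter Topology
open scoped ContDiff NNReal

noncomputable section

namespace StokesLPS

/-- The plane, with its Euclidean norm and Lebesgue measure. -/
abbrev Plane := EuclideanSpace ℝ (Fin 2)

/-- The boundary of `Ω` is, near each of its points and in suitable orthonormal coordinates, the
graph of a Lipschitz function, with `Ω` locally on one side (strictly above the graph). -/
def HasLipschitzBoundary (Ω : Set Plane) : Prop :=
  ∀ x ∈ frontier Ω, ∃ (e : Plane ≃ₗᵢ[ℝ] Plane) (γ : ℝ → ℝ) (L : ℝ≥0), LipschitzWith L γ ∧
    ∀ᶠ y in 𝓝 x, (y ∈ Ω ↔ γ (e y 0) < e y 1)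

/-- A bounded domain (non-empty connected open set) with Lipschitz boundary. -/
structure IsBoundedLipschitzDomain (Ω : Set Plane) : Prop where
  isOpen : IsOpen Ω
  isConnected : IsConnected Ω
  isBounded : Bornology.IsBounded Ω
  lipschitzBoundary : HasLipschitzBoundary Ω

/-! ### Function spaces -/

/-- `L²(Ω)`. -/
abbrev L2 (Ω : Set Plane) := Lp ℝ 2 (volume.restrict Ω)

/-- Pairs `(w, g)` of a function in `L²(Ω)` and a field in `L²(Ω)²`; the Sobolev spaces below
consist of the pairs in which `g` is the weak gradient of `w` (and so is determined by `w`). -/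
abbrev Jet (Ω : Set Plane) := L2 Ω × (Fin 2 → L2 Ω)

/-- The pairs `(φ, ∇φ)` for `φ ∈ C_c^∞(Ω)`. -/
def testJets (Ω : Set Plane) : Set (Jet Ω) :=
  {j | ∃ φ : Plane → ℝ, ContDiff ℝ ∞ φ ∧ HasCompactSupport φ ∧ tsupport φ ⊆ Ω ∧
    j.1 =ᵐ[volume.restrict Ω] φ ∧
    ∀ i, j.2 i =ᵐ[volume.restrict Ω] fun x => fderiv ℝ φ x (EuclideanSpace.single i 1)}

/-- `H¹(Ω)`: the pairs `(w, g)` with `∫ w ∂ᵢφ = - ∫ gᵢ φ` for all `φ ∈ C_c^∞(Ω)`. -/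
def H1 (Ω : Set Plane) : Submodule ℝ (Jet Ω) where
  carrier := {j | ∀ t ∈ testJets Ω, ∀ i, inner ℝ j.1 (t.2 i) = - inner ℝ (j.2 i) t.1}
  zero_mem' := by intro t _ i; simp
  add_mem' := by
    intro j k hj hk t ht i
    simp only [Prod.fst_add, Prod.snd_add, Pi.add_apply, inner_add_left, hj t ht i, hk t ht i]
    ring
  smul_mem' := by
    intro c j hj t ht i
    simp only [Prod.smul_fst, Prod.smul_snd, Pi.smul_apply, real_inner_smul_left, hj t ht i]
    ring

/-- `H¹₀(Ω)`: the closure of `C_c^∞(Ω)` in the topology of the `H¹` norm. -/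
def H10 (Ω : Set Plane) : Submodule ℝ (Jet Ω) :=
  (Submodule.span ℝ (testJets Ω)).topologicalClosure

/-- The velocity space `V = H¹₀(Ω)²`. -/
abbrev Velocity (Ω : Set Plane) := Fin 2 → H10 Ω

/-- The underlying element of `L²(Ω)²`. -/
def Velocity.val {Ω : Set Plane} (v : Velocity Ω) : Fin 2 → L2 Ω := fun i => (v i).1.1

/-- `v.grad i j = ∂ⱼ vᵢ`. -/
def Velocity.grad {Ω : Set Plane} (v : Velocity Ω) : Fin 2 → Fin 2 → L2 Ω :=
  fun i j => (v i).1.2 j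

/-- The divergence. -/
def Velocity.div {Ω : Set Plane} (v : Velocity Ω) : L2 Ω := ∑ i, v.grad i i

/-- `p` has mean value zero; the pressure space `Q = L²₀(Ω)` consists of these `p`. -/
def MeanZero {Ω : Set Plane} (p : L2 Ω) : Prop := ∫ x in Ω, p x = 0

/-! ### Forms and norms -/

/-- `a(u, v) = ∫ ∇u : ∇v`. -/
def aForm {Ω : Set Plane} (u v : Velocity Ω) : ℝ := ∑ i, ∑ j, inner ℝ (u.grad i j) (v.grad i j)

/-- `b(v, p) = ∫ (div v) p`. -/
def bForm {Ω : Set Plane} (v : Velocity Ω) (p : L2 Ω) : ℝ := inner ℝ v.div p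

/-- `r(f, g) = ∫ f · g`. -/
def rForm {Ω : Set Plane} (f g : Fin 2 → L2 Ω) : ℝ := ∑ i, inner ℝ (f i) (g i)

/-- `‖v‖₁`, the full `H¹(Ω)²` norm. -/
def norm1 {Ω : Set Plane} (v : Velocity Ω) : ℝ :=
  Real.sqrt (rForm v.val v.val + aForm v v)

/-- `‖f‖₋₁`, the norm of `f ∈ L²(Ω)²` as a functional on `(H¹₀(Ω)², ‖·‖₁)`. -/
def normNeg1 {Ω : Set Plane} (f : Fin 2 → L2 Ω) : ℝ :=
  sSup {t | ∃ v : Velocity Ω, norm1 v ≤ 1 ∧ t = rForm f v.val}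

/-! ### Meshes, finite element spaces and the stabilization term -/

/-- A decomposition of `closure Ω` into finitely many closed cells, each the closure of its
non-empty interior, with Lipschitz boundaries and pairwise disjoint interiors. -/
structure Mesh (Ω : Set Plane) where
  cells : Finset (Set Plane)
  closure_interior : ∀ K ∈ cells, closure (interior K) = K
  nonempty : ∀ K ∈ cells, (interior K).Nonempty
  lipschitz : ∀ K ∈ cells, HasLipschitzBoundary (interior K)
  disjoint : ∀ K ∈ cells, ∀ K' ∈ cells, K ≠ K' → Disjoint (interior K) (interior K')
  cover : (⋃ K ∈ cells, K) = closure Ω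

/-- The polynomial function on the plane given by `P`. -/
def polyFun (P : MvPolynomial (Fin 2) ℝ) (x : Plane) : ℝ := MvPolynomial.eval (fun i => x i) P

/-- A scalar finite element space `V_h` over a mesh: a finite dimensional space of continuous
functions on `closure Ω` whose restriction to each cell is a polynomial. -/
structure ScalarFE {Ω : Set Plane} (T : Mesh Ω) where
  space : Submodule ℝ C(closure Ω, ℝ)
  finiteDim : FiniteDimensional ℝ space
  piecewisePoly : ∀ w ∈ space, ∀ K ∈ T.cells, ∃ P : MvPolynomial (Fin 2) ℝ,
    ∀ x : closure Ω, (x : Plane) ∈ K → w x = polyFun P x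

/-- The class `f ∈ L²(Ω)` is represented by a function of the finite element space. -/
def ScalarFE.Contains {Ω : Set Plane} {T : Mesh Ω} (W : ScalarFE T) (f : L2 Ω) : Prop :=
  ∃ w ∈ W.space, ∀ᵐ x ∂(volume.restrict Ω), ∀ hx : x ∈ closure Ω, f x = w ⟨x, hx⟩

/-- The discrete velocity space `V_h² ∩ V`. -/
def ScalarFE.velocities {Ω : Set Plane} {T : Mesh Ω} (W : ScalarFE T) : Set (Velocity Ω) :=
  {v | ∀ i, W.Contains (v.val i)}

/-- The discrete pressure space `V_h ∩ Q`. Its elements are carried with their weak gradient. -/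
def ScalarFE.pressures {Ω : Set Plane} {T : Mesh Ω} (W : ScalarFE T) : Set (H1 Ω) :=
  {p | W.Contains p.1.1 ∧ MeanZero p.1.1}

/-- `L²(K)` for a cell `K ⊆ closure Ω` (the boundary of `Ω` is a null set). -/
abbrev L2Cell (Ω K : Set Plane) := Lp ℝ 2 ((volume.restrict Ω).restrict K)

/-- The data of a local projection stabilization: on every cell a finite dimensional projection
space `D_h(K) ⊆ L²(K)` containing the polynomials of degree `< m` (so `m = s + 1`, and `m = 0`
stands for `s = -1`), and a parameter `α_K ≥ 0`. -/
structure Stabilization (Ω : Set Plane) where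
  mesh : Mesh Ω
  m : ℕ
  D : ∀ K : mesh.cells, Submodule ℝ (L2Cell Ω K)
  finiteDim : ∀ K : mesh.cells, FiniteDimensional ℝ (D K)
  poly_mem : ∀ K : mesh.cells, ∀ P : MvPolynomial (Fin 2) ℝ, P.totalDegree < m →
    ∀ f : L2Cell Ω K, f =ᵐ[(volume.restrict Ω).restrict (K : Set Plane)] polyFun P → f ∈ D K
  α : mesh.cells → ℝ
  α_nonneg : ∀ K, 0 ≤ α K

attribute [instance] Stabilization.finiteDim

/-- The fluctuation operator on the cell `K`: `w ↦ w|_K - π_K (w|_K)` with `π_K` the orthogonal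
projection of `L²(K)` onto `D_h(K)`. -/
def Stabilization.κ {Ω : Set Plane} (S : Stabilization Ω) (K : S.mesh.cells) (w : L2 Ω) :
    L2Cell Ω K :=
  LpToLpRestrictCLM Plane ℝ ℝ (volume.restrict Ω) 2 K w -
    (S.D K).starProjection (LpToLpRestrictCLM Plane ℝ ℝ (volume.restrict Ω) 2 K w)

/-- `S_h(p, q) = ∑_K α_K (κ_h ∇p, κ_h ∇q)_K`. -/
def Stabilization.form {Ω : Set Plane} (S : Stabilization Ω) (p q : H1 Ω) : ℝ :=
  ∑ K : S.mesh.cells, S.α K * ∑ i, inner ℝ (S.κ K (p.1.2 i)) (S.κ K (q.1.2 i))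

/-! ### The four problems -/

/-- `(u, p, lam)` solves the weak Stokes eigenvalue problem, with `r(u, u) = 1`. -/
structure IsStokesEigen {Ω : Set Plane} (u : Velocity Ω) (p : L2 Ω) (lam : ℝ) : Prop where
  meanZero : MeanZero p
  normalized : rForm u.val u.val = 1
  momentum : ∀ v : Velocity Ω, aForm u v - bForm v p = lam * rForm u.val v.val
  incompressible : ∀ q : L2 Ω, MeanZero q → bForm u q = 0

/-- `(u, p)` solves the weak Stokes source problem with load `f`. -/
structure IsStokesSource {Ω : Set Plane} (f : Fin 2 → L2 Ω) (u : Velocity Ω) (p : L2 Ω) :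
    Prop where
  meanZero : MeanZero p
  momentum : ∀ v : Velocity Ω, aForm u v - bForm v p = rForm f v.val
  incompressible : ∀ q : L2 Ω, MeanZero q → bForm u q = 0

/-- `(u, p) ∈ V × Q` solves the stabilized discrete Stokes source problem with load `f` in the
discrete spaces `V`, `Q`. -/
structure IsDiscreteSource {Ω : Set Plane} (V : Set (Velocity Ω)) (Q : Set (H1 Ω))
    (S : Stabilization Ω) (f : Fin 2 → L2 Ω) (u : Velocity Ω) (p : H1 Ω) : Prop where
  mem_velocity : u ∈ V
  mem_pressure : p ∈ Q
  momentum : ∀ v ∈ V, aForm u v - bForm v p.1.1 = rForm f v.val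
  stabilized : ∀ q ∈ Q, bForm u q.1.1 + S.form p q = 0

/-- `(u, p, lam) ∈ V × Q × ℝ` solves the stabilized discrete Stokes eigenvalue problem in the
discrete spaces `V`, `Q`, with `r(u, u) = 1`. -/
structure IsDiscreteEigen {Ω : Set Plane} (V : Set (Velocity Ω)) (Q : Set (H1 Ω))
    (S : Stabilization Ω) (u : Velocity Ω) (p : H1 Ω) (lam : ℝ) : Prop where
  mem_velocity : u ∈ V
  mem_pressure : p ∈ Q
  normalized : rForm u.val u.val = 1
  momentum : ∀ v ∈ V, aForm u v - bForm v p.1.1 = lam * rForm u.val v.val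
  stabilized : ∀ q ∈ Q, bForm u q.1.1 + S.form p q = 0

/-- The Rayleigh quotient `a(w, w) / r(w, w)`. -/
def rayleigh {Ω : Set Plane} (w : Velocity Ω) : ℝ := aForm w w / rForm w.val w.val

end StokesLPS

end

open StokesLPS

noncomputable section

namespace StokesLPS

/-!
Subtracting the eigenvalue problem from the auxiliary source problem shows that `(ũ - u, p̃ - p)`
solves a Stokes problem whose load is bounded by `‖u - u_h‖₋₁ + |λ - λ_h|`. Stability of the Stokes
problem then gives the first estimate for every pair `(w, q)` near `(ũ, p̃)`, discrete or not. For
the Rayleigh quotient, the eigenvalue problem turns `a(w, w) - λ r(w, w)` into terms quadratic in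
`(w - u, q - p)` plus `2 b(w, q)`, and for the discrete solution `b(w, q)` is minus the
stabilization term.

Stability rests on the inf-sup condition `‖p‖ ≤ C ‖∇p‖₋₁` for `p` of mean value zero. The divergence
equation in a square is solved by moving mass along the coordinate lines onto a bump. In a ball, the
truncated gradient of the resolvent `(1 - cΔ)⁻¹ f` solves it up to a lower order defect, which the
square solution removes; by duality the oscillation of `p` in a ball is controlled by `‖∇p‖₋₁`.
Near a Lipschitz graph, Whitney balls give a family of such estimates with bounded overlap, and a
dilation of the heights above the graph, by a factor so close to `1` that each point stays in the
same ball as its image, propagates them down to the graph. The domain is connected and covered by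
finitely many such patches.
-/

/-! ### Partial derivatives and test functions -/

section PartialDeriv

variable {ι : Type*} [DecidableEq ι] {φ ψ : EuclideanSpace ℝ ι → ℝ}

/-- The classical partial derivative `∂ᵢφ`, written as in `testJets`; it has the junk value `0`
where `φ` is not differentiable. -/
def partialDeriv (i : ι) (φ : EuclideanSpace ℝ ι → ℝ) (x : EuclideanSpace ℝ ι) : ℝ :=
  fderiv ℝ φ x (EuclideanSpace.single i 1)

lemma partialDeriv_eq_zero_of_notMem_tsupport {x : EuclideanSpace ℝ ι} (hx : x ∉ tsupport φ)
    (i : ι) : partialDeriv i φ x = 0 := by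
  simp [partialDeriv, fderiv_of_notMem_tsupport ℝ hx]

lemma tsupport_partialDeriv_subset (φ : EuclideanSpace ℝ ι → ℝ) (i : ι) :
    tsupport (partialDeriv i φ) ⊆ tsupport φ :=
  closure_minimal
    (fun _ hx => not_not.1 fun h => hx (partialDeriv_eq_zero_of_notMem_tsupport h i))
    (isClosed_tsupport φ)

variable [Fintype ι]

lemma contDiff_partialDeriv (h : ContDiff ℝ ∞ φ) (i : ι) : ContDiff ℝ ∞ (partialDeriv i φ) :=
  (h.fderiv_right (m := ∞) (by simp)).clm_apply contDiff_const

lemma partialDeriv_add (hφ : ContDiff ℝ ∞ φ) (hψ : ContDiff ℝ ∞ ψ) (i : ι)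
    (x : EuclideanSpace ℝ ι) :
    partialDeriv i (fun y => φ y + ψ y) x = partialDeriv i φ x + partialDeriv i ψ x := by
  simp [partialDeriv,
    fderiv_fun_add (hφ.differentiable (by simp) x) (hψ.differentiable (by simp) x)]

lemma partialDeriv_sub (hφ : ContDiff ℝ ∞ φ) (hψ : ContDiff ℝ ∞ ψ) (i : ι)
    (x : EuclideanSpace ℝ ι) :
    partialDeriv i (fun y => φ y - ψ y) x = partialDeriv i φ x - partialDeriv i ψ x := by
  simp [partialDeriv,
    fderiv_fun_sub (hφ.differentiable (by simp) x) (hψ.differentiable (by simp) x)]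

lemma partialDeriv_mul (hφ : ContDiff ℝ ∞ φ) (hψ : ContDiff ℝ ∞ ψ) (i : ι)
    (x : EuclideanSpace ℝ ι) :
    partialDeriv i (fun y => φ y * ψ y) x =
      φ x * partialDeriv i ψ x + partialDeriv i φ x * ψ x := by
  simp [partialDeriv, mul_comm,
    fderiv_fun_mul (hφ.differentiable (by simp) x) (hψ.differentiable (by simp) x)]

lemma partialDeriv_const_mul (hφ : ContDiff ℝ ∞ φ) (c : ℝ) (i : ι)
    (x : EuclideanSpace ℝ ι) : partialDeriv i (fun y => c * φ y) x = c * partialDeriv i φ x := by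
  simp [partialDeriv, fderiv_const_mul (hφ.differentiable (by simp) x)]

lemma partialDeriv_sum {κ : Type*} (s : Finset κ) {φ : κ → EuclideanSpace ℝ ι → ℝ}
    (hφ : ∀ k ∈ s, ContDiff ℝ ∞ (φ k)) (i : ι) (x : EuclideanSpace ℝ ι) :
    partialDeriv i (fun y => ∑ k ∈ s, φ k y) x = ∑ k ∈ s, partialDeriv i (φ k) x := by
  simp [partialDeriv, fderiv_fun_sum fun k hk => (hφ k hk).differentiable (by simp) x]

lemma partialDeriv_comm (h : ContDiff ℝ ∞ φ) (i j : ι) (x : EuclideanSpace ℝ ι) :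
    partialDeriv i (partialDeriv j φ) x = partialDeriv j (partialDeriv i φ) x := by
  have second_deriv (a b : ι) : partialDeriv a (partialDeriv b φ) x =
      fderiv ℝ (fderiv ℝ φ) x (EuclideanSpace.single a 1) (EuclideanSpace.single b 1) := by
    have hd : DifferentiableAt ℝ (fderiv ℝ φ) x :=
      (h.fderiv_right (m := ∞) (by simp)).differentiable (by simp) x
    change fderiv ℝ (fun y => fderiv ℝ φ y (EuclideanSpace.single b 1)) x _ = _
    rw [fderiv_clm_apply hd (differentiableAt_const _)]
    simp
  have symm : IsSymmSndFDerivAt ℝ φ x := h.contDiffAt.isSymmSndFDerivAt (by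
    simpa using (WithTop.coe_le_coe.2 le_top : ((2 : ℕ∞) : WithTop ℕ∞) ≤ ∞))
  rw [second_deriv, second_deriv, symm.eq]

end PartialDeriv

/-- `φ ∈ C_c^∞(U)`; the set `U` need not be open. -/
structure IsTestFunction {E : Type*} [NormedAddCommGroup E] [NormedSpace ℝ E] (U : Set E)
    (φ : E → ℝ) : Prop where
  contDiff : ContDiff ℝ ∞ φ
  hasCompactSupport : HasCompactSupport φ
  tsupport_subset : tsupport φ ⊆ U

namespace IsTestFunction

section Algebra

variable {E : Type*} [NormedAddCommGroup E] [NormedSpace ℝ E] {U : Set E} {φ ψ : E → ℝ}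

lemma mono {V : Set E} (h : IsTestFunction U φ) (hUV : U ⊆ V) : IsTestFunction V φ :=
  ⟨h.contDiff, h.hasCompactSupport, h.tsupport_subset.trans hUV⟩

lemma differentiableAt (h : IsTestFunction U φ) (x : E) : DifferentiableAt ℝ φ x :=
  h.contDiff.differentiable (by simp) x

lemma of_eq_zero {K : Set E} (h : ContDiff ℝ ∞ φ) (hK : IsCompact K)
    (h0 : ∀ x ∉ K, φ x = 0) (hKU : K ⊆ U) : IsTestFunction U φ := by
  have hs : tsupport φ ⊆ K :=
    closure_minimal (fun x hx => not_not.1 fun hxK => hx (h0 x hxK)) hK.isClosed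
  exact ⟨h, .of_support_subset_isCompact hK (subset_closure.trans hs), hs.trans hKU⟩

lemma of_imp (h : IsTestFunction U φ) (hψ : ContDiff ℝ ∞ ψ) (h0 : ∀ x, φ x = 0 → ψ x = 0) :
    IsTestFunction U ψ :=
  of_eq_zero hψ h.hasCompactSupport (fun x hx => h0 x (image_eq_zero_of_notMem_tsupport hx))
    h.tsupport_subset

lemma eq_zero_of_notMem (hφ : IsTestFunction U φ) {x : E} (hx : x ∉ U) : φ x = 0 :=
  image_eq_zero_of_notMem_tsupport fun h => hx (hφ.tsupport_subset h)

lemma add (hφ : IsTestFunction U φ) (hψ : IsTestFunction U ψ) :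
    IsTestFunction U (fun x => φ x + ψ x) :=
  of_eq_zero (hφ.contDiff.add hψ.contDiff)
    (hφ.hasCompactSupport.isCompact.union hψ.hasCompactSupport.isCompact)
    (fun x hx => by
      rw [Set.mem_union, not_or] at hx
      simp [image_eq_zero_of_notMem_tsupport hx.1, image_eq_zero_of_notMem_tsupport hx.2])
    (Set.union_subset hφ.tsupport_subset hψ.tsupport_subset)

lemma mul_left (hφ : IsTestFunction U φ) (hψ : ContDiff ℝ ∞ ψ) :
    IsTestFunction U (fun x => ψ x * φ x) :=
  hφ.of_imp (hψ.mul hφ.contDiff) (fun x h => by simp [h])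

lemma mul_right (hφ : IsTestFunction U φ) (hψ : ContDiff ℝ ∞ ψ) :
    IsTestFunction U (fun x => φ x * ψ x) :=
  hφ.of_imp (hφ.contDiff.mul hψ) (fun x h => by simp [h])

lemma const_mul (hφ : IsTestFunction U φ) (c : ℝ) : IsTestFunction U (fun x => c * φ x) :=
  hφ.mul_left contDiff_const

lemma sub (hφ : IsTestFunction U φ) (hψ : IsTestFunction U ψ) :
    IsTestFunction U (fun x => φ x - ψ x) := by
  simpa [sub_eq_add_neg] using hφ.add (hψ.const_mul (-1))

lemma zero : IsTestFunction U (fun _ => 0) :=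
  of_eq_zero contDiff_const isCompact_empty (fun _ _ => rfl) (Set.empty_subset _)

lemma sum {κ : Type*} (s : Finset κ) {φ : κ → E → ℝ} (h : ∀ k ∈ s, IsTestFunction U (φ k)) :
    IsTestFunction U (fun x => ∑ k ∈ s, φ k x) := by
  classical
  induction s using Finset.induction_on with
  | empty => simpa using zero
  | insert a s ha ih =>
    simp only [Finset.sum_insert ha]
    exact (h a (by simp)).add (ih fun k hk => h k (by simp [hk]))

end Algebra

section Integration

variable {ι : Type*} [Fintype ι] {U : Set (EuclideanSpace ℝ ι)} {φ : EuclideanSpace ℝ ι → ℝ}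

lemma integrable (hφ : IsTestFunction U φ) : Integrable φ :=
  hφ.contDiff.continuous.integrable_of_hasCompactSupport hφ.hasCompactSupport

lemma memLp (hφ : IsTestFunction U φ) : MemLp φ 2 :=
  hφ.contDiff.continuous.memLp_of_hasCompactSupport hφ.hasCompactSupport

variable [DecidableEq ι]

lemma partialDeriv (hφ : IsTestFunction U φ) (i : ι) : IsTestFunction U (partialDeriv i φ) :=
  ⟨contDiff_partialDeriv hφ.contDiff i,
    hφ.hasCompactSupport.mono' (subset_closure.trans (tsupport_partialDeriv_subset φ i)),
    (tsupport_partialDeriv_subset φ i).trans hφ.tsupport_subset⟩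

lemma integral_partialDeriv_eq_zero (hφ : IsTestFunction U φ) (i : ι) :
    ∫ x, StokesLPS.partialDeriv i φ x = 0 := by
  have := integral_mul_fderiv_eq_neg_fderiv_mul_of_integrable
    (μ := (volume : Measure (EuclideanSpace ℝ ι))) (f := fun _ => (1 : ℝ)) (g := φ)
    (v := EuclideanSpace.single i 1) (by simp)
    (by simpa only [one_mul] using! (hφ.partialDeriv i).integrable) (by simpa using hφ.integrable)
    (by simp) (fun x _ => hφ.differentiableAt x)
  simpa [StokesLPS.partialDeriv] using this

end Integration

end IsTestFunction

/-! ### The resolvent of the Laplacian -/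

section Resolvent

open SchwartzMap LineDeriv Laplacian

/-- With Mathlib's normalization of the Fourier transform, the multiplier of the operator
`1 - (2π)⁻²Δ` is `1 + |ξ|²`. -/
lemma exists_sub_laplacian_eq {E : Type*} [NormedAddCommGroup E] [InnerProductSpace ℝ E]
    [FiniteDimensional ℝ E] [MeasurableSpace E] [BorelSpace E] (F : SchwartzMap E ℂ) :
    ∃ G : SchwartzMap E ℂ, G - ((2 * Real.pi) ^ 2)⁻¹ • Δ G = F := by
  let m : E → ℝ := fun ξ => (1 + ‖ξ‖ ^ 2) ^ (-1 : ℝ)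
  let n : E → ℝ := fun ξ => ‖ξ‖ ^ 2
  have hm : m.HasTemperateGrowth := Function.hasTemperateGrowth_one_add_norm_sq_rpow E (-1)
  have hn : n.HasTemperateGrowth := Function.hasTemperateGrowth_norm_sq E
  have inverse : m + n * m = fun _ => 1 := by
    ext ξ
    have : 1 + ‖ξ‖ ^ 2 ≠ 0 := by positivity
    simp only [Pi.add_apply, Pi.mul_apply, m, n, Real.rpow_neg_one]
    field_simp
  let G : SchwartzMap E ℂ := fourierMultiplierCLM ℂ m F
  have multiplier : ((2 * Real.pi) ^ 2)⁻¹ • Δ G = -fourierMultiplierCLM ℂ n G := by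
    rw [laplacian_eq_fourierMultiplierCLM, smul_smul, mul_neg, inv_mul_cancel₀ (by positivity),
      neg_one_smul]
  refine ⟨G, ?_⟩
  calc G - ((2 * Real.pi) ^ 2)⁻¹ • Δ G
      = fourierMultiplierCLM ℂ m F + fourierMultiplierCLM ℂ (n * m) F := by
        rw [multiplier, sub_neg_eq_add, fourierMultiplierCLM_fourierMultiplierCLM_apply hn hm]
    _ = fourierMultiplierCLM ℂ (m + n * m) F := by
        simp only [fourierMultiplierCLM_apply, smulLeftCLM_add hm (hn.mul hm),
          add_apply, FourierTransform.fourierInv_add]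
    _ = F := by simp [inverse]

variable {ι : Type*} [DecidableEq ι] [Fintype ι]

lemma partialDeriv_schwartz (k : SchwartzMap (EuclideanSpace ℝ ι) ℝ) (i : ι) :
    partialDeriv i k = (∂_{EuclideanSpace.single i (1 : ℝ)} k : SchwartzMap _ ℝ) := by
  ext x
  rw [lineDerivOp_apply_eq_fderiv, partialDeriv]

lemma partialDeriv_re (H : SchwartzMap (EuclideanSpace ℝ ι) ℂ) (i : ι) :
    partialDeriv i (fun y => (H y).re) =
      fun x => ((∂_{EuclideanSpace.single i (1 : ℝ)} H : SchwartzMap _ ℂ) x).re := by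
  ext x
  have := (Complex.reCLM.hasFDerivAt.comp x (H.hasFDerivAt x)).fderiv
  rw [lineDerivOp_apply_eq_fderiv, partialDeriv]
  exact DFunLike.congr_fun this _

lemma exists_resolvent {f : EuclideanSpace ℝ ι → ℝ} (hf : ContDiff ℝ ∞ f)
    (hfc : HasCompactSupport f) :
    ∃ g : SchwartzMap (EuclideanSpace ℝ ι) ℝ, ∀ x,
      g x - ((2 * Real.pi) ^ 2)⁻¹ * ∑ i, partialDeriv i (partialDeriv i g) x = f x := by
  have compact : HasCompactSupport (fun x => (f x : ℂ)) :=
    hfc.comp_left (g := fun t : ℝ => (t : ℂ)) (by simp)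
  have smooth : ContDiff ℝ ∞ (fun x => (f x : ℂ)) := Complex.ofRealCLM.contDiff.comp hf
  let F : SchwartzMap (EuclideanSpace ℝ ι) ℂ := compact.toSchwartzMap smooth
  obtain ⟨G, hG⟩ := exists_sub_laplacian_eq F
  refine ⟨G.postcompCLM Complex.reCLM, fun x => ?_⟩
  have hre : (G.postcompCLM Complex.reCLM : EuclideanSpace ℝ ι → ℝ) = fun y => (G y).re := by
    ext y; simp [postcompCLM_apply]
  have := congrArg (fun H : SchwartzMap (EuclideanSpace ℝ ι) ℂ => (H x).re) hG
  rw [laplacian_eq_sum (EuclideanSpace.basisFun ι ℝ)] at this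
  simp only [hre, partialDeriv_re]
  generalize ((2 * Real.pi) ^ 2)⁻¹ = c at this ⊢
  simpa [F] using this

lemma integral_mul_partialDeriv (k l : SchwartzMap (EuclideanSpace ℝ ι) ℝ) (i : ι) :
    ∫ x, k x * partialDeriv i l x = -∫ x, partialDeriv i k x * l x := by
  simpa only [partialDeriv_schwartz] using
    integral_mul_lineDerivOp_right_eq_neg_left k l (EuclideanSpace.single i 1)

lemma integral_mul_partialDeriv_partialDeriv (g : SchwartzMap (EuclideanSpace ℝ ι) ℝ) (i j : ι) :
    ∫ x, partialDeriv i (partialDeriv i g) x * partialDeriv j (partialDeriv j g) x =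
      ∫ x, partialDeriv i (partialDeriv j g) x ^ 2 := by
  have comm : partialDeriv j (partialDeriv i (partialDeriv i g)) =
      partialDeriv i (partialDeriv i (partialDeriv j g)) := by
    have hg : ContDiff ℝ ∞ g := g.smooth ⊤
    rw [funext (partialDeriv_comm (contDiff_partialDeriv hg i) j i),
      funext (partialDeriv_comm hg j i)]
  have move_j := integral_mul_partialDeriv (∂_{EuclideanSpace.single i (1 : ℝ)}
    (∂_{EuclideanSpace.single i (1 : ℝ)} g)) (∂_{EuclideanSpace.single j (1 : ℝ)} g) j
  have move_i := integral_mul_partialDeriv (∂_{EuclideanSpace.single j (1 : ℝ)} g)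
    (∂_{EuclideanSpace.single i (1 : ℝ)} (∂_{EuclideanSpace.single j (1 : ℝ)} g)) i
  simp only [← partialDeriv_schwartz] at move_j move_i
  rw [move_j, comm]
  simp only [mul_comm (partialDeriv i (partialDeriv i _) _), move_i, neg_neg, sq]

lemma integral_resolvent_sq (g : SchwartzMap (EuclideanSpace ℝ ι) ℝ) (c : ℝ) :
    ∫ x, (g x - c * ∑ i, partialDeriv i (partialDeriv i g) x) ^ 2 =
      (∫ x, g x ^ 2) + 2 * c * (∑ i, ∫ x, partialDeriv i g x ^ 2) +
        c ^ 2 * ∑ i, ∑ j, ∫ x, partialDeriv i (partialDeriv j g) x ^ 2 := by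
  have integrable_mul (k l : SchwartzMap (EuclideanSpace ℝ ι) ℝ) :
      Integrable (fun x => k x * l x) := (k.memLp 2).integrable_mul (l.memLp 2)
  have cross_integrable (i : ι) :
      Integrable (fun x => g x * partialDeriv i (partialDeriv i g) x) := by
    simpa only [partialDeriv_schwartz] using integrable_mul _ _
  have square_integrable (i j : ι) : Integrable (fun x =>
      partialDeriv i (partialDeriv i g) x * partialDeriv j (partialDeriv j g) x) := by
    simpa only [partialDeriv_schwartz] using integrable_mul _ _
  have cross (i : ι) : ∫ x, g x * partialDeriv i (partialDeriv i g) x =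
      -∫ x, partialDeriv i g x ^ 2 := by
    have := integral_mul_partialDeriv g (∂_{EuclideanSpace.single i (1 : ℝ)} g) i
    simpa only [← partialDeriv_schwartz, ← sq] using this
  have expand (x : EuclideanSpace ℝ ι) :
      (g x - c * ∑ i, partialDeriv i (partialDeriv i g) x) ^ 2 =
        g x ^ 2 - 2 * c * (∑ i, g x * partialDeriv i (partialDeriv i g) x) +
          c ^ 2 * ∑ i, ∑ j,
            partialDeriv i (partialDeriv i g) x * partialDeriv j (partialDeriv j g) x := by
    rw [← Finset.sum_mul_sum, ← Finset.mul_sum]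
    ring
  have hg : Integrable (fun x => g x ^ 2) := by simpa only [sq] using integrable_mul g g
  have hcross := (integrable_finsetSum Finset.univ fun i _ => cross_integrable i).const_mul (2 * c)
  have hsquare := (integrable_finsetSum Finset.univ fun i _ =>
    integrable_finsetSum Finset.univ fun j _ => square_integrable i j).const_mul (c ^ 2)
  simp only [expand]
  rw [integral_add (by exact hg.sub hcross) hsquare, integral_sub hg hcross, integral_const_mul,
    integral_const_mul, integral_finsetSum _ fun i _ => cross_integrable i,
    integral_finsetSum _ fun i _ => integrable_finsetSum _ fun j _ => square_integrable i j]
  simp only [integral_finsetSum _ fun j _ => square_integrable _ j, cross,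
    integral_mul_partialDeriv_partialDeriv, Finset.sum_neg_distrib]
  ring

end Resolvent

/-! ### Integrals along coordinate lines -/

section LineIntegral

variable {ι : Type*} [DecidableEq ι]

/-- The standard basis vector `eᵢ`. -/
abbrev basisVec (i : ι) : EuclideanSpace ℝ ι := EuclideanSpace.single i (1 : ℝ)

/-- `z ↦ ∫_S k (z - s eᵢ) ds`. -/
def lineInt (i : ι) (S : Set ℝ) (k : EuclideanSpace ℝ ι → ℝ) (z : EuclideanSpace ℝ ι) : ℝ :=
  ∫ s in S, k (z - s • basisVec i)

/-- The image of the Lebesgue measure on `S` under `s ↦ s eᵢ`; integration along lines is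
convolution with it. -/
def lineMeasure [Fintype ι] (i : ι) (S : Set ℝ) : Measure (EuclideanSpace ℝ ι) :=
  (volume.restrict S).map (fun s : ℝ => s • basisVec i)

variable {k : EuclideanSpace ℝ ι → ℝ}

lemma sub_smul_basisVec_self (i : ι) (z : EuclideanSpace ℝ ι) (s : ℝ) :
    (z - s • basisVec i) i = z i - s := by
  simp

lemma sub_smul_basisVec_ne {i j : ι} (h : j ≠ i) (z : EuclideanSpace ℝ ι) (s : ℝ) :
    (z - s • basisVec i) j = z j := by
  simp [h]

lemma lineInt_univ_sub_smul (i : ι) (k : EuclideanSpace ℝ ι → ℝ) (z : EuclideanSpace ℝ ι)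
    (t : ℝ) : lineInt i Set.univ k (z - t • basisVec i) = lineInt i Set.univ k z := by
  simp only [lineInt, Measure.restrict_univ, sub_sub, ← add_smul]
  exact integral_add_left_eq_self (fun s => k (z - s • basisVec i)) t

lemma hasCompactSupport_line [Finite ι] (i : ι) (hkc : HasCompactSupport k)
    (z : EuclideanSpace ℝ ι) :
    HasCompactSupport (fun s : ℝ => k (z - s • basisVec i)) := by
  cases nonempty_fintype ι
  obtain ⟨R, hR⟩ := hkc.isCompact.isBounded.subset_closedBall z
  refine HasCompactSupport.of_support_subset_isCompact (isCompact_Icc (a := -R) (b := R)) ?_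
  intro s hs
  have := hR (subset_closure (show (z - s • basisVec i) ∈ Function.support k from hs))
  simpa [norm_smul, abs_le, dist_eq_norm] using this

variable [Fintype ι]

lemma integrable_line (i : ι) (hk : ContDiff ℝ ∞ k) (hkc : HasCompactSupport k)
    (z : EuclideanSpace ℝ ι) : Integrable (fun s : ℝ => k (z - s • basisVec i)) :=
  (hk.continuous.comp (by fun_prop)).integrable_of_hasCompactSupport
    (hasCompactSupport_line i hkc z)

instance (i : ι) (S : Set ℝ) : IsFiniteMeasureOnCompacts (lineMeasure i S) where
  lt_top_of_isCompact := by
    intro K hK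
    obtain ⟨R, hR⟩ := hK.isBounded.subset_closedBall (0 : EuclideanSpace ℝ ι)
    refine (measure_mono hR).trans_lt ?_
    rw [lineMeasure, Measure.map_apply (by fun_prop) measurableSet_closedBall]
    refine (Measure.restrict_apply_le _ _).trans_lt ?_
    refine (measure_mono (t := Set.Icc (-R) R) fun s hs => ?_).trans_lt measure_Icc_lt_top
    simpa [norm_smul, abs_le] using hs

lemma lineInt_eq_convolution (i : ι) (S : Set ℝ) (hk : Continuous k) :
    lineInt i S k =
      convolution (fun _ => (1 : ℝ)) k (ContinuousLinearMap.lsmul ℝ ℝ) (lineMeasure i S) := by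
  ext z
  rw [convolution, lineMeasure, integral_map (by fun_prop) (by fun_prop)]
  simp [lineInt]

lemma contDiff_lineInt (i : ι) (S : Set ℝ) (hk : ContDiff ℝ ∞ k) (hkc : HasCompactSupport k) :
    ContDiff ℝ ∞ (lineInt i S k) := by
  rw [lineInt_eq_convolution i S hk.continuous]
  exact hkc.contDiff_convolution_right (n := ⊤) _ (locallyIntegrable_const _) hk

lemma partialDeriv_lineInt (i j : ι) (S : Set ℝ) (hk : ContDiff ℝ ∞ k)
    (hkc : HasCompactSupport k) :
    partialDeriv j (lineInt i S k) = lineInt i S (partialDeriv j k) := by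
  ext z
  let L := ContinuousLinearMap.lsmul ℝ ℝ (E := ℝ)
  let g : ℝ → EuclideanSpace ℝ ι → ℝ := fun _ => k
  have hg : ContDiff ℝ ∞ ↿g := hk.comp contDiff_snd
  have fderiv_g : (fun x => fderiv ℝ ↿g (0, x)) =
      fun x => (fderiv ℝ k x).comp (.snd ℝ ℝ (EuclideanSpace ℝ ι)) := by
    ext1 x
    have hkx := (hk.differentiable (by simp) x).hasFDerivAt
    exact (hkx.comp (f := Prod.snd) ((0 : ℝ), x) hasFDerivAt_snd).fderiv
  have key := (hasFDerivAt_convolution_right_with_param (μ := lineMeasure i S)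
    (f := fun _ => (1 : ℝ)) L (g := g) isOpen_univ hkc.isCompact
    (fun _ _ _ hx => image_eq_zero_of_notMem_tsupport hx) (locallyIntegrable_const _)
    (hg.of_le (by simp)).contDiffOn (0, z) trivial).comp z (hasFDerivAt_prodMk_right 0 z)
  have compact : HasCompactSupport
      fun x => (fderiv ℝ k x).comp (.snd ℝ ℝ (EuclideanSpace ℝ ι)) :=
    (hkc.fderiv ℝ).comp_left (g := fun A : EuclideanSpace ℝ ι →L[ℝ] ℝ =>
      A.comp (.snd ℝ ℝ (EuclideanSpace ℝ ι))) (ContinuousLinearMap.zero_comp _)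
  calc partialDeriv j (lineInt i S k) z
      = convolution (fun _ => (1 : ℝ)) (fun x => fderiv ℝ ↿g (0, x))
          (L.precompR (ℝ × EuclideanSpace ℝ ι)) (lineMeasure i S) z (0, basisVec j) := by
        rw [lineInt_eq_convolution i S hk.continuous]
        exact DFunLike.congr_fun key.fderiv (basisVec j)
    _ = lineInt i S (partialDeriv j k) z := by
        rw [fderiv_g, convolution_precompR_apply _ (locallyIntegrable_const _) compact
          (by exact (hk.continuous_fderiv (by simp)).clm_comp continuous_const),
          lineInt_eq_convolution i S (contDiff_partialDeriv hk j).continuous]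
        rfl

lemma hasDerivAt_line (i : ι) (hk : ContDiff ℝ ∞ k) (z : EuclideanSpace ℝ ι) (s : ℝ) :
    HasDerivAt (fun s : ℝ => k (z - s • basisVec i))
      (-partialDeriv i k (z - s • basisVec i)) s := by
  have line : HasDerivAt (fun s : ℝ => z - s • basisVec i) (-basisVec i) s := by
    simpa using ((hasDerivAt_id s).smul_const (basisVec i)).const_sub z
  have := (hk.differentiable (by simp) (z - s • basisVec i)).hasFDerivAt.comp_hasDerivAt s line
  simpa [partialDeriv, Function.comp_def] using this

lemma lineInt_Ioi_partialDeriv (i : ι) (hk : ContDiff ℝ ∞ k) (hkc : HasCompactSupport k)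
    (z : EuclideanSpace ℝ ι) : lineInt i (Set.Ioi 0) (partialDeriv i k) z = k z := by
  have hline : ContDiff ℝ 1 (fun s : ℝ => k (z - s • basisVec i)) :=
    (hk.of_le (by simp)).comp (by fun_prop)
  have := (hasCompactSupport_line i hkc z).integral_Ioi_deriv_eq hline 0
  simp only [fun s => (hasDerivAt_line i hk z s).deriv, integral_neg, zero_smul,
    sub_zero, neg_inj] at this
  exact this

lemma partialDeriv_lineInt_univ_self (i : ι) (hk : ContDiff ℝ ∞ k) (hkc : HasCompactSupport k)
    (z : EuclideanSpace ℝ ι) : partialDeriv i (lineInt i Set.univ k) z = 0 := by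
  have h := hasDerivAt_line i (contDiff_lineInt i Set.univ hk hkc) z 0
  simp only [lineInt_univ_sub_smul, zero_smul, sub_zero] at h
  linarith [h.unique (hasDerivAt_const 0 _)]

lemma sq_integral_le {α : Type*} [MeasurableSpace α] {μ : Measure α} [IsFiniteMeasure μ]
    {f : α → ℝ} (hf : MemLp f 2 μ) : (∫ x, f x ∂μ) ^ 2 ≤ μ.real Set.univ * ∫ x, f x ^ 2 ∂μ := by
  have hf1 : Integrable f μ := hf.integrable (by norm_num)
  rcases eq_zero_or_neZero μ with rfl | _
  · simp
  have jensen := (even_two.convexOn_pow (𝕜 := ℝ)).map_average_le (by fun_prop) isClosed_univ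
    (by simp) hf1 hf.integrable_sq
  simp only [average_eq, smul_eq_mul] at jensen
  have hμ : 0 < μ.real Set.univ := by simp [measureReal_def, ENNReal.toReal_pos_iff, NeZero.ne μ]
  have := mul_le_mul_of_nonneg_left jensen (sq_nonneg (μ.real Set.univ))
  field_simp at this
  linarith

lemma integrable_prod_line (i : ι) {S : Set ℝ} (hS : volume S ≠ ⊤) {F : EuclideanSpace ℝ ι → ℝ}
    (hF : Continuous F) (hFi : Integrable F) :
    Integrable (fun q : ℝ × EuclideanSpace ℝ ι => F (q.2 - q.1 • basisVec i))
      ((volume.restrict S).prod volume) := by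
  rw [integrable_prod_iff (by exact (hF.comp (by fun_prop)).aestronglyMeasurable)]
  refine ⟨Eventually.of_forall fun s => hFi.comp_sub_right (s • basisVec i), ?_⟩
  simp only [fun s : ℝ => integral_sub_right_eq_self (μ := volume) (fun z => ‖F z‖)
    (s • basisVec i)]
  exact integrableOn_const hS

lemma integral_lineInt (i : ι) {S : Set ℝ} (hS : volume S ≠ ⊤) {F : EuclideanSpace ℝ ι → ℝ}
    (hF : Continuous F) (hFi : Integrable F) :
    ∫ z, lineInt i S F z = volume.real S * ∫ z, F z := by
  simp only [lineInt]
  rw [integral_integral_swap (by exact (integrable_prod_line i hS hF hFi).swap)]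
  simp only [fun s : ℝ => integral_sub_right_eq_self (μ := volume) F (s • basisVec i)]
  simp

end LineIntegral

/-! ### The divergence equation in a square -/

section Box

/-- The square `[-2, 2]²`. -/
def box : Set Plane := {z | ∀ i, |z i| ≤ 2}

lemma box_subset_ball : box ⊆ Metric.ball 0 4 := by
  intro z hz
  rw [mem_ball_zero_iff, EuclideanSpace.norm_eq, Real.sqrt_lt' (by norm_num)]
  simp only [Fin.sum_univ_two, Real.norm_eq_abs]
  nlinarith [abs_nonneg (z 0), abs_nonneg (z 1), hz 0, hz 1]

lemma ball_subset_box : Metric.ball (0 : Plane) 2 ⊆ box := fun z hz i =>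
  (PiLp.norm_apply_le z i).trans (mem_ball_zero_iff.1 hz).le

lemma isCompact_box : IsCompact box := by
  refine Metric.isCompact_of_isClosed_isBounded ?_ (Metric.isBounded_ball.subset box_subset_ball)
  simp only [box, Set.ofPred_forall]
  exact isClosed_iInter fun i => isClosed_le (by fun_prop) continuous_const

lemma isTestFunction_box {φ : Plane → ℝ} (h : ContDiff ℝ ∞ φ)
    (h0 : ∀ z i, 2 < |z i| → φ z = 0) : IsTestFunction box φ := by
  refine IsTestFunction.of_eq_zero h isCompact_box (fun z hz => ?_) le_rfl
  simp only [box, Set.mem_ofPred_eq, not_forall, not_le] at hz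
  obtain ⟨i, hi⟩ := hz
  exact h0 z i hi

variable {k : Plane → ℝ}

lemma IsTestFunction.box_eq_zero (hk : IsTestFunction box k) {z : Plane} {i : Fin 2}
    (hz : 2 < |z i|) : k z = 0 :=
  hk.eq_zero_of_notMem fun hb => absurd (hb i) (not_le.2 hz)

lemma abs_lineInt_le {i : Fin 2} {S : Set ℝ} (hk : IsTestFunction box k) {z : Plane}
    (hz : |z i| ≤ 2) : |lineInt i S k z| ≤ lineInt i (Set.Icc (-4) 4) (fun x => |k x|) z := by
  calc |lineInt i S k z| ≤ ∫ s in S, |k (z - s • basisVec i)| := abs_integral_le_integral_abs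
    _ ≤ ∫ s, |k (z - s • basisVec i)| :=
        setIntegral_le_integral (integrable_line i hk.contDiff hk.hasCompactSupport z).abs
          (Eventually.of_forall fun _ => abs_nonneg _)
    _ = lineInt i (Set.Icc (-4) 4) (fun x => |k x|) z := by
        refine (setIntegral_eq_integral_of_forall_compl_eq_zero fun s hs => ?_).symm
        rw [hk.box_eq_zero (i := i), abs_zero]
        rw [sub_smul_basisVec_self]
        contrapose! hs
        rw [abs_le] at hs hz
        constructor <;> linarith

lemma sq_lineInt_le {i : Fin 2} {S : Set ℝ} (hk : IsTestFunction box k) {z : Plane}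
    (hz : |z i| ≤ 2) :
    lineInt i S k z ^ 2 ≤ 8 * lineInt i (Set.Icc (-4) 4) (fun x => k x ^ 2) z := by
  have continuous : Continuous fun s : ℝ => |k (z - s • basisVec i)| :=
    continuous_abs.comp (hk.contDiff.continuous.comp (by fun_prop))
  have memLp : MemLp (fun s : ℝ => |k (z - s • basisVec i)|) 2
      (volume.restrict (Set.Icc (-4) 4)) :=
    continuous.memLp_of_hasCompactSupport (hasCompactSupport_line i hk.hasCompactSupport z).norm
  calc lineInt i S k z ^ 2 = |lineInt i S k z| ^ 2 := (sq_abs _).symm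
    _ ≤ lineInt i (Set.Icc (-4) 4) (fun x => |k x|) z ^ 2 := by
        gcongr
        exact abs_lineInt_le hk hz
    _ ≤ _ := (sq_integral_le memLp).trans_eq (by norm_num [lineInt, measureReal_def])

lemma integral_sq_le_of_lineInt {i : Fin 2} {S : Set ℝ} {F : Plane → ℝ} {C : ℝ}
    (hk : IsTestFunction box k) (hF0 : ∀ z, 2 < |z i| → F z = 0)
    (hFk : ∀ z, |F z| ≤ C * |lineInt i S k z|) :
    ∫ z, F z ^ 2 ≤ 64 * C ^ 2 * ∫ z, k z ^ 2 := by
  have continuous : Continuous fun z => k z ^ 2 := hk.contDiff.continuous.pow 2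
  have pointwise (z) : F z ^ 2 ≤
      C ^ 2 * 8 * lineInt i (Set.Icc (-4) 4) (fun x => k x ^ 2) z := by
    by_cases hz : 2 < |z i|
    · have : 0 ≤ lineInt i (Set.Icc (-4) 4) (fun x => k x ^ 2) z :=
        integral_nonneg fun _ => sq_nonneg _
      rw [hF0 z hz, zero_pow two_ne_zero]
      positivity
    · calc F z ^ 2 = |F z| ^ 2 := (sq_abs _).symm
        _ ≤ (C * |lineInt i S k z|) ^ 2 := by
            gcongr
            exact hFk z
        _ = C ^ 2 * lineInt i S k z ^ 2 := by rw [mul_pow, sq_abs]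
        _ ≤ _ := by
            rw [mul_assoc]
            gcongr
            exact sq_lineInt_le hk (not_lt.1 hz)
  calc ∫ z, F z ^ 2 ≤ ∫ z, C ^ 2 * 8 * lineInt i (Set.Icc (-4) 4) (fun x => k x ^ 2) z :=
        integral_mono_of_nonneg (Eventually.of_forall fun _ => sq_nonneg _)
          ((integrable_prod_line i (by simp) continuous
            hk.memLp.integrable_sq).integral_prod_right.const_mul _)
          (Eventually.of_forall pointwise)
    _ = 64 * C ^ 2 * ∫ z, k z ^ 2 := by
        rw [integral_const_mul, integral_lineInt i (by simp) continuous hk.memLp.integrable_sq]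
        norm_num [measureReal_def]
        ring

lemma lineInt_Ioi_eq_zero {i : Fin 2} (hk : IsTestFunction box k) {z : Plane}
    (h0 : lineInt i Set.univ k z = 0) (hz : 2 < |z i|) : lineInt i (Set.Ioi 0) k z = 0 := by
  rcases lt_abs.1 hz with h | h
  · refine Eq.trans ?_ h0
    rw [lineInt, lineInt, setIntegral_univ]
    refine setIntegral_eq_integral_of_forall_compl_eq_zero fun s hs => ?_
    refine hk.box_eq_zero (i := i) (lt_abs.2 (.inl ?_))
    rw [sub_smul_basisVec_self]
    linarith [Set.notMem_Ioi.1 hs]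
  · refine setIntegral_eq_zero_of_forall_eq_zero fun s hs => ?_
    refine hk.box_eq_zero (i := i) (lt_abs.2 (.inr ?_))
    rw [sub_smul_basisVec_self]
    linarith [Set.mem_Ioi.1 hs]

lemma lineInt_eq_zero_of_ne {i j : Fin 2} (hij : j ≠ i) {S : Set ℝ} (hk : IsTestFunction box k)
    {z : Plane} (hz : 2 < |z j|) : lineInt i S k z = 0 :=
  integral_eq_zero_of_ae (Eventually.of_forall fun s =>
    hk.box_eq_zero (i := j) (by rwa [sub_smul_basisVec_ne hij]))

lemma isTestFunction_lineInt_Ioi {i : Fin 2} (hk : IsTestFunction box k)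
    (h0 : ∀ z, lineInt i Set.univ k z = 0) : IsTestFunction box (lineInt i (Set.Ioi 0) k) := by
  refine isTestFunction_box (contDiff_lineInt i _ hk.contDiff hk.hasCompactSupport)
    fun z j hz => ?_
  by_cases hij : j = i
  · subst hij
    exact lineInt_Ioi_eq_zero hk (h0 z) hz
  · exact lineInt_eq_zero_of_ne hij hk hz

lemma integral_sq_partialDeriv_lineInt_Ioi_le {i j : Fin 2} (hk : IsTestFunction box k)
    (h0 : ∀ z, lineInt i Set.univ k z = 0) :
    ∫ z, partialDeriv j (lineInt i (Set.Ioi 0) k) z ^ 2 ≤ 64 * ∫ z, partialDeriv j k z ^ 2 := by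
  have := integral_sq_le_of_lineInt (i := i) (S := Set.Ioi 0) (C := 1) (hk.partialDeriv j)
    (fun z hz => ((isTestFunction_lineInt_Ioi hk h0).partialDeriv j).box_eq_zero hz)
    (fun z => by rw [partialDeriv_lineInt i j _ hk.contDiff hk.hasCompactSupport, one_mul])
  simpa using this

lemma lineInt_lineInt_univ (hk : Integrable k) (z : Plane) :
    lineInt 1 Set.univ (lineInt 0 Set.univ k) z = ∫ x, k x := by
  let e : Plane ≃ᵐ ℝ × ℝ :=
    (MeasurableEquiv.toLp 2 (Fin 2 → ℝ)).symm.trans MeasurableEquiv.finTwoArrow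
  have he : MeasurePreserving e.symm :=
    ((volume_preserving_finTwoArrow ℝ).comp (PiLp.volume_preserving_ofLp (Fin 2))).symm e
  have coords (q : ℝ × ℝ) : z - q.2 • basisVec 1 - q.1 • basisVec 0 = z - e.symm q := by
    ext i
    fin_cases i <;> simp [e]
  have hint : Integrable (fun q : ℝ × ℝ => k (z - q.2 • basisVec 1 - q.1 • basisVec 0))
      (volume.prod volume) := by
    simp only [coords]
    exact he.integrable_comp_of_integrable (hk.comp_sub_left z)
  calc lineInt 1 Set.univ (lineInt 0 Set.univ k) z
      = ∫ q : ℝ × ℝ, k (z - q.2 • basisVec 1 - q.1 • basisVec 0) := by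
        rw [Measure.volume_eq_prod, integral_prod_symm _ hint]
        simp only [lineInt, setIntegral_univ]
    _ = ∫ x, k (z - x) := by
        simp only [coords]
        exact he.integral_comp' (fun x => k (z - x))
    _ = ∫ x, k x := integral_sub_left_eq_self k volume z

/-- A smooth density on the line, supported in `[-1, 1]` and of total mass one. -/
def lineBump : ℝ → ℝ :=
  (⟨1 / 2, 1, by norm_num, by norm_num⟩ : ContDiffBump (0 : ℝ)).normed volume

lemma contDiff_lineBump : ContDiff ℝ ∞ lineBump := ContDiffBump.contDiff_normed _

lemma lineBump_eq_zero {t : ℝ} (ht : 2 < |t|) : lineBump t = 0 := by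
  rw [← Function.notMem_support, lineBump, ContDiffBump.support_normed_eq]
  simp only [Metric.mem_ball, dist_zero_right, Real.norm_eq_abs]
  linarith

lemma integral_lineBump : ∫ t, lineBump t = 1 := ContDiffBump.integral_normed _

lemma exists_lineBump_bounds :
    ∃ C : ℝ, ∀ t, |lineBump t| ≤ C ∧ |deriv lineBump t| ≤ C := by
  have compact : HasCompactSupport lineBump := ContDiffBump.hasCompactSupport_normed _
  obtain ⟨C₁, hC₁⟩ := contDiff_lineBump.continuous.bounded_above_of_compact_support compact
  obtain ⟨C₂, hC₂⟩ := (contDiff_lineBump.continuous_deriv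
    (by simp)).bounded_above_of_compact_support compact.deriv
  exact ⟨max C₁ C₂, fun t => ⟨(hC₁ t).trans (le_max_left _ _), (hC₂ t).trans (le_max_right _ _)⟩⟩

lemma contDiff_lineBump_comp (i : Fin 2) : ContDiff ℝ ∞ fun z : Plane => lineBump (z i) :=
  contDiff_lineBump.comp (by fun_prop)

lemma partialDeriv_lineBump_comp (i j : Fin 2) (z : Plane) :
    partialDeriv j (fun z : Plane => lineBump (z i)) z = deriv lineBump (z i) * basisVec j i := by
  have coord : HasFDerivAt (fun z : Plane => z i) (EuclideanSpace.proj i : Plane →L[ℝ] ℝ) z :=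
    (EuclideanSpace.proj i : Plane →L[ℝ] ℝ).hasFDerivAt
  have bump := (contDiff_lineBump.differentiable (by simp) (z i)).hasDerivAt
  exact DFunLike.congr_fun (bump.comp_hasFDerivAt z coord).fderiv _

/-- The function obtained by replacing `h` along each horizontal line by the multiple of the bump
density that has the same integral. -/
def smear (h : Plane → ℝ) (z : Plane) : ℝ := lineBump (z 0) * lineInt 0 Set.univ h z

variable {h : Plane → ℝ}

lemma isTestFunction_smear (hh : IsTestFunction box h) : IsTestFunction box (smear h) := by
  refine isTestFunction_box ((contDiff_lineBump_comp 0).mul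
    (contDiff_lineInt 0 _ hh.contDiff hh.hasCompactSupport)) fun z i hz => ?_
  fin_cases i
  · rw [smear, lineBump_eq_zero (t := z 0) hz, zero_mul]
  · rw [smear, lineInt_eq_zero_of_ne (j := 1) (by decide) hh hz, mul_zero]

lemma partialDeriv_one_smear (hh : IsTestFunction box h) :
    partialDeriv 1 (smear h) = smear (partialDeriv 1 h) := by
  ext z
  change partialDeriv 1 (fun z : Plane => lineBump (z 0) * lineInt 0 Set.univ h z) z = _
  rw [partialDeriv_mul (contDiff_lineBump_comp 0)
    (contDiff_lineInt 0 _ hh.contDiff hh.hasCompactSupport), partialDeriv_lineBump_comp,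
    partialDeriv_lineInt 0 1 _ hh.contDiff hh.hasCompactSupport]
  simp [smear]

lemma partialDeriv_zero_smear (hh : IsTestFunction box h) (z : Plane) :
    partialDeriv 0 (smear h) z = deriv lineBump (z 0) * lineInt 0 Set.univ h z := by
  change partialDeriv 0 (fun z : Plane => lineBump (z 0) * lineInt 0 Set.univ h z) z = _
  rw [partialDeriv_mul (contDiff_lineBump_comp 0)
    (contDiff_lineInt 0 _ hh.contDiff hh.hasCompactSupport), partialDeriv_lineBump_comp,
    partialDeriv_lineInt_univ_self 0 hh.contDiff hh.hasCompactSupport]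
  simp

lemma lineInt_zero_smear (h : Plane → ℝ) (z : Plane) :
    lineInt 0 Set.univ (smear h) z = lineInt 0 Set.univ h z := by
  calc lineInt 0 Set.univ (smear h) z
      = ∫ s, lineBump (z 0 - s) * lineInt 0 Set.univ h z := by
        rw [lineInt, setIntegral_univ]
        simp only [smear, lineInt_univ_sub_smul, sub_smul_basisVec_self]
    _ = lineInt 0 Set.univ h z := by
        rw [integral_mul_const, integral_sub_left_eq_self lineBump volume (z 0),
          integral_lineBump, one_mul]

lemma lineInt_zero_sub_smear (hh : IsTestFunction box h) (z : Plane) :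
    lineInt 0 Set.univ (fun x => h x - smear h x) z = 0 := by
  have hs := isTestFunction_smear hh
  rw [← sub_eq_zero_of_eq (lineInt_zero_smear h z).symm]
  simp only [lineInt, setIntegral_univ]
  exact integral_sub (integrable_line 0 hh.contDiff hh.hasCompactSupport z)
    (integrable_line 0 hs.contDiff hs.hasCompactSupport z)

lemma lineInt_one_smear (hh : IsTestFunction box h) (mean : ∫ x, h x = 0) (z : Plane) :
    lineInt 1 Set.univ (smear h) z = 0 := by
  calc lineInt 1 Set.univ (smear h) z
      = lineBump (z 0) * lineInt 1 Set.univ (lineInt 0 Set.univ h) z := by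
        simp only [lineInt, smear, setIntegral_univ, ← integral_const_mul,
          sub_smul_basisVec_ne zero_ne_one]
    _ = 0 := by rw [lineInt_lineInt_univ hh.integrable, mean, mul_zero]

lemma exists_smear_bounds : ∃ C : ℝ, 0 ≤ C ∧ ∀ h, IsTestFunction box h →
    ∫ z, smear h z ^ 2 ≤ C * ∫ z, h z ^ 2 ∧
    ∫ z, partialDeriv 0 (smear h) z ^ 2 ≤ C * ∫ z, h z ^ 2 := by
  obtain ⟨C, hC⟩ := exists_lineBump_bounds
  refine ⟨64 * C ^ 2, by positivity, fun h hh => ⟨?_, ?_⟩⟩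
  · refine integral_sq_le_of_lineInt (i := 0) (S := Set.univ) hh
      (fun z hz => (isTestFunction_smear hh).box_eq_zero hz) fun z => ?_
    rw [smear, abs_mul]
    gcongr
    exact (hC _).1
  · refine integral_sq_le_of_lineInt (i := 0) (S := Set.univ) hh
      (fun z hz => ((isTestFunction_smear hh).partialDeriv 0).box_eq_zero hz) fun z => ?_
    rw [partialDeriv_zero_smear hh, abs_mul]
    gcongr
    exact (hC _).2

lemma integral_sub_sq_le {α : Type*} [MeasurableSpace α] {μ : Measure α} {f g : α → ℝ}
    (hf : MemLp f 2 μ) (hg : MemLp g 2 μ) :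
    ∫ x, (f x - g x) ^ 2 ∂μ ≤ 2 * (∫ x, f x ^ 2 ∂μ) + 2 * ∫ x, g x ^ 2 ∂μ := by
  rw [← integral_const_mul, ← integral_const_mul, ← integral_add (hf.integrable_sq.const_mul 2)
    (hg.integrable_sq.const_mul 2)]
  refine integral_mono (hf.sub hg).integrable_sq
    ((hf.integrable_sq.const_mul 2).add (hg.integrable_sq.const_mul 2)) fun x => ?_
  linarith [sq_nonneg (f x + g x)]

/-- The Dirichlet energy `∫ |∇w|²` of a smooth vector field `w` on the plane. -/
def energy (w : Fin 2 → Plane → ℝ) : ℝ := ∑ i, ∑ j, ∫ x, partialDeriv j (w i) x ^ 2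

/-- The field moves the mass of `h` along horizontal lines onto the bump, then the smeared mass
along vertical lines. -/
lemma exists_div_eq_of_box : ∃ C : ℝ, 0 ≤ C ∧ ∀ h : Plane → ℝ, IsTestFunction box h →
    ∫ x, h x = 0 → ∃ W : Fin 2 → Plane → ℝ, (∀ i, IsTestFunction box (W i)) ∧
      (∀ x, ∑ i, partialDeriv i (W i) x = h x) ∧
      energy W ≤ C * ((∫ x, h x ^ 2) + ∫ x, partialDeriv 1 h x ^ 2) := by
  obtain ⟨C, hC, bounds⟩ := exists_smear_bounds
  refine ⟨65 * (2 + 2 * C) + 65 * C, by positivity, fun h hh mean => ?_⟩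
  have hs := isTestFunction_smear hh
  have hr := hh.sub hs
  have r0 := lineInt_zero_sub_smear hh
  have s0 := lineInt_one_smear hh mean
  set r : Plane → ℝ := fun x => h x - smear h x
  let W : Fin 2 → Plane → ℝ := ![lineInt 0 (Set.Ioi 0) r, lineInt 1 (Set.Ioi 0) (smear h)]
  have diag0 (x) : partialDeriv 0 (W 0) x = r x := by
    simp only [W, Matrix.cons_val_zero]
    rw [partialDeriv_lineInt 0 0 _ hr.contDiff hr.hasCompactSupport,
      lineInt_Ioi_partialDeriv 0 hr.contDiff hr.hasCompactSupport]
  have diag1 (x) : partialDeriv 1 (W 1) x = smear h x := by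
    simp only [W, Matrix.cons_val_one, Matrix.cons_val_fin_one]
    rw [partialDeriv_lineInt 1 1 _ hs.contDiff hs.hasCompactSupport,
      lineInt_Ioi_partialDeriv 1 hs.contDiff hs.hasCompactSupport]
  have dr (x) : partialDeriv 1 r x = partialDeriv 1 h x - smear (partialDeriv 1 h) x := by
    rw [partialDeriv_sub hh.contDiff hs.contDiff, partialDeriv_one_smear hh]
  refine ⟨W, ?_, fun x => ?_, ?_⟩
  · exact Fin.forall_fin_two.2
      ⟨isTestFunction_lineInt_Ioi hr r0, isTestFunction_lineInt_Ioi hs s0⟩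
  · rw [Fin.sum_univ_two, diag0, diag1, sub_add_cancel]
  · have hh1 := hh.partialDeriv 1
    have e00 : ∫ x, r x ^ 2 ≤ (2 + 2 * C) * ∫ x, h x ^ 2 := by
      linarith [integral_sub_sq_le hh.memLp hs.memLp, (bounds h hh).1]
    have e01 : ∫ x, partialDeriv 1 (W 0) x ^ 2 ≤
        64 * ((2 + 2 * C) * ∫ x, partialDeriv 1 h x ^ 2) := by
      refine (integral_sq_partialDeriv_lineInt_Ioi_le hr r0).trans ?_
      simp only [dr]
      linarith [integral_sub_sq_le hh1.memLp (isTestFunction_smear hh1).memLp, (bounds _ hh1).1]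
    have e10 : ∫ x, partialDeriv 0 (W 1) x ^ 2 ≤ 64 * (C * ∫ x, h x ^ 2) :=
      (integral_sq_partialDeriv_lineInt_Ioi_le hs s0).trans (by linarith [(bounds h hh).2])
    have sq_integral_nonneg : 0 ≤ ∫ x, h x ^ 2 := integral_nonneg fun _ => sq_nonneg _
    have deriv_sq_integral_nonneg : 0 ≤ ∫ x, partialDeriv 1 h x ^ 2 :=
      integral_nonneg fun _ => sq_nonneg _
    simp only [energy, Fin.sum_univ_two, diag0, diag1]
    nlinarith [(bounds h hh).1]

end Box

/-! ### The divergence equation in balls -/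

section Cutoff

open Asymptotics

variable {ι : Type*} [DecidableEq ι] [Fintype ι]

/-- The sum of the squares of `g` and of its partial derivatives up to order two. -/
def jetSq (g : EuclideanSpace ℝ ι → ℝ) (x : EuclideanSpace ℝ ι) : ℝ :=
  g x ^ 2 + (∑ i, partialDeriv i g x ^ 2) + ∑ i, ∑ j, partialDeriv i (partialDeriv j g) x ^ 2

lemma jetSq_nonneg (g : EuclideanSpace ℝ ι → ℝ) (x : EuclideanSpace ℝ ι) : 0 ≤ jetSq g x := by
  unfold jetSq
  positivity

section Integral

variable (g : SchwartzMap (EuclideanSpace ℝ ι) ℝ)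

lemma memLp_partialDeriv_schwartz (i : ι) : MemLp (partialDeriv i g) 2 := by
  rw [partialDeriv_schwartz]
  exact (LineDeriv.lineDerivOp (EuclideanSpace.single i (1 : ℝ)) g :
    SchwartzMap (EuclideanSpace ℝ ι) ℝ).memLp 2

lemma memLp_partialDeriv_partialDeriv_schwartz (i j : ι) :
    MemLp (partialDeriv i (partialDeriv j g)) 2 := by
  rw [partialDeriv_schwartz]
  exact memLp_partialDeriv_schwartz _ i

lemma integrable_sum_sq_partialDeriv : Integrable fun x => ∑ i, partialDeriv i g x ^ 2 :=
  integrable_finsetSum _ fun i _ => (memLp_partialDeriv_schwartz g i).integrable_sq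

lemma integrable_sum_sq_partialDeriv_partialDeriv :
    Integrable fun x => ∑ i, ∑ j, partialDeriv i (partialDeriv j g) x ^ 2 :=
  integrable_finsetSum _ fun i _ => integrable_finsetSum _ fun j _ =>
    (memLp_partialDeriv_partialDeriv_schwartz g i j).integrable_sq

lemma integrable_jetSq : Integrable (jetSq g) :=
  ((g.memLp 2).integrable_sq.add (integrable_sum_sq_partialDeriv g)).add
    (integrable_sum_sq_partialDeriv_partialDeriv g)

lemma integral_jetSq : ∫ x, jetSq g x = (∫ x, g x ^ 2) + (∑ i, ∫ x, partialDeriv i g x ^ 2) +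
    ∑ i, ∑ j, ∫ x, partialDeriv i (partialDeriv j g) x ^ 2 := by
  have h0 : Integrable fun x => g x ^ 2 := (g.memLp 2).integrable_sq
  have h1 (i : ι) := (memLp_partialDeriv_schwartz g i).integrable_sq
  have h2 (i j : ι) := (memLp_partialDeriv_partialDeriv_schwartz g i j).integrable_sq
  simp only [jetSq]
  rw [integral_add (by exact h0.add (integrable_sum_sq_partialDeriv g))
    (integrable_sum_sq_partialDeriv_partialDeriv g),
    integral_add h0 (integrable_sum_sq_partialDeriv g), integral_finsetSum _ fun i _ => h1 i,
    integral_finsetSum _ fun i _ => integrable_finsetSum _ fun j _ => h2 i j]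
  simp only [integral_finsetSum _ fun j _ => h2 _ j]

lemma sq_mul_integral_jetSq_le {c : ℝ} (hc0 : 0 ≤ c) (hc1 : c ≤ 1) :
    c ^ 2 * ∫ x, jetSq g x ≤ ∫ x, (g x - c * ∑ i, partialDeriv i (partialDeriv i g) x) ^ 2 := by
  have h0 : 0 ≤ ∫ x, g x ^ 2 := integral_nonneg fun _ => sq_nonneg _
  have : 0 ≤ ∑ i, ∫ x, partialDeriv i g x ^ 2 :=
    Finset.sum_nonneg fun i _ => integral_nonneg fun _ => sq_nonneg _
  have hc2 : c ^ 2 ≤ c := by nlinarith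
  rw [integral_jetSq, integral_resolvent_sq, mul_add, mul_add]
  gcongr
  · exact mul_le_of_le_one_left h0 (hc2.trans hc1)
  · linarith

end Integral

/-- `T g` is bounded pointwise by the derivatives of `g` up to order two, uniformly in `g`. -/
def JetBounded (T : SchwartzMap (EuclideanSpace ℝ ι) ℝ → EuclideanSpace ℝ ι → ℝ) : Prop :=
  (fun p : SchwartzMap (EuclideanSpace ℝ ι) ℝ × EuclideanSpace ℝ ι => T p.1 p.2) =O[⊤]
    fun p => √(jetSq p.1 p.2)

namespace JetBounded

variable {T T' : SchwartzMap (EuclideanSpace ℝ ι) ℝ → EuclideanSpace ℝ ι → ℝ}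

lemma of_sq_le (h : ∀ g x, T g x ^ 2 ≤ jetSq g x) : JetBounded T :=
  isBigO_top.2 ⟨1, fun p => by
    rw [one_mul, Real.norm_eq_abs, Real.norm_of_nonneg (Real.sqrt_nonneg _)]
    exact Real.abs_le_sqrt (h p.1 p.2)⟩

lemma apply : JetBounded (ι := ι) fun g => g :=
  of_sq_le fun g x => by
    rw [jetSq, add_assoc]
    exact le_add_of_nonneg_right (by positivity)

lemma partialDeriv (i : ι) : JetBounded fun g => partialDeriv i g :=
  of_sq_le fun g x => by
    have := Finset.single_le_sum (f := fun i => StokesLPS.partialDeriv i g x ^ 2)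
      (fun i _ => sq_nonneg _) (Finset.mem_univ i)
    have : 0 ≤ ∑ i, ∑ j, StokesLPS.partialDeriv i (StokesLPS.partialDeriv j g) x ^ 2 := by
      positivity
    rw [jetSq]
    linarith [sq_nonneg (g x)]

lemma partialDeriv_partialDeriv (i j : ι) :
    JetBounded fun g => StokesLPS.partialDeriv i (StokesLPS.partialDeriv j g) :=
  of_sq_le fun g x => by
    have := Finset.single_le_sum
      (f := fun j => StokesLPS.partialDeriv i (StokesLPS.partialDeriv j g) x ^ 2)
      (fun j _ => sq_nonneg _) (Finset.mem_univ j)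
    have := Finset.single_le_sum
      (f := fun i => ∑ j, StokesLPS.partialDeriv i (StokesLPS.partialDeriv j g) x ^ 2)
      (fun i _ => Finset.sum_nonneg fun j _ => sq_nonneg _) (Finset.mem_univ i)
    have : 0 ≤ ∑ i, StokesLPS.partialDeriv i g x ^ 2 := by positivity
    rw [jetSq]
    linarith [sq_nonneg (g x)]

lemma add (hT : JetBounded T) (hT' : JetBounded T') : JetBounded fun g x => T g x + T' g x :=
  IsBigO.add hT hT'

lemma const_mul (hT : JetBounded T) (c : ℝ) : JetBounded fun g x => c * T g x :=
  IsBigO.const_mul_left hT c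

lemma sum {κ : Type*} {s : Finset κ}
    {T : κ → SchwartzMap (EuclideanSpace ℝ ι) ℝ → EuclideanSpace ℝ ι → ℝ}
    (hT : ∀ k ∈ s, JetBounded (T k)) : JetBounded fun g x => ∑ k ∈ s, T k g x := by
  simpa only [JetBounded, Finset.sum_fn] using IsBigO.sum hT

lemma mul_left (hT : JetBounded T) {U : Set (EuclideanSpace ℝ ι)} {φ : EuclideanSpace ℝ ι → ℝ}
    (hφ : IsTestFunction U φ) : JetBounded fun g x => φ x * T g x := by
  obtain ⟨B, hB⟩ :=
    hφ.contDiff.continuous.bounded_above_of_compact_support hφ.hasCompactSupport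
  have bounded : (fun p : SchwartzMap (EuclideanSpace ℝ ι) ℝ × EuclideanSpace ℝ ι => φ p.2)
      =O[⊤] fun _ => (1 : ℝ) := isBigO_top.2 ⟨B, fun p => by simpa using hB p.2⟩
  have := bounded.mul hT
  simp only [one_mul] at this
  exact this

lemma exists_integral_sq_le (hT : JetBounded T) :
    ∃ C : ℝ, 0 ≤ C ∧ ∀ g, ∫ x, T g x ^ 2 ≤ C * ∫ x, jetSq g x := by
  obtain ⟨C, hC⟩ := isBigO_top.1 hT
  refine ⟨C ^ 2, sq_nonneg C, fun g => ?_⟩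
  rw [← integral_const_mul]
  refine integral_mono_of_nonneg (Eventually.of_forall fun _ => sq_nonneg _)
    ((integrable_jetSq g).const_mul _) (Eventually.of_forall fun x => ?_)
  calc T g x ^ 2 = ‖T g x‖ ^ 2 := (sq_abs _).symm
    _ ≤ (C * ‖√(jetSq g x)‖) ^ 2 := by
        gcongr
        exact hC (g, x)
    _ = C ^ 2 * jetSq g x := by
        rw [mul_pow, Real.norm_eq_abs, sq_abs, Real.sq_sqrt (jetSq_nonneg g x)]

end JetBounded

/-- The components `-c χ ∂ᵢg` of the truncated gradient field. If `f = g - c Δg` is supported where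
`χ = 1`, its divergence is `f` up to the `cutoffDefect`. -/
def cutoffGrad (χ : EuclideanSpace ℝ ι → ℝ) (c : ℝ) (g : EuclideanSpace ℝ ι → ℝ) (i : ι)
    (x : EuclideanSpace ℝ ι) : ℝ :=
  χ x * (-c * partialDeriv i g x)

/-- The terms of lower order in the divergence of the `cutoffGrad`. -/
def cutoffDefect (χ : EuclideanSpace ℝ ι → ℝ) (c : ℝ) (g : EuclideanSpace ℝ ι → ℝ)
    (x : EuclideanSpace ℝ ι) : ℝ :=
  χ x * g x + c * ∑ i, partialDeriv i χ x * partialDeriv i g x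

variable {U : Set (EuclideanSpace ℝ ι)} {χ g : EuclideanSpace ℝ ι → ℝ}

lemma isTestFunction_cutoffGrad (hχ : IsTestFunction U χ) (hg : ContDiff ℝ ∞ g) (c : ℝ) (i : ι) :
    IsTestFunction U (cutoffGrad χ c g i) :=
  hχ.mul_right (contDiff_const.mul (contDiff_partialDeriv hg i))

lemma isTestFunction_cutoffDefect (hχ : IsTestFunction U χ) (hg : ContDiff ℝ ∞ g) (c : ℝ) :
    IsTestFunction U (cutoffDefect χ c g) :=
  (hχ.mul_right hg).add ((IsTestFunction.sum Finset.univ fun i _ =>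
    (hχ.partialDeriv i).mul_right (contDiff_partialDeriv hg i)).const_mul c)

lemma partialDeriv_cutoffGrad (hχ : ContDiff ℝ ∞ χ) (hg : ContDiff ℝ ∞ g) (c : ℝ) (i j : ι)
    (x : EuclideanSpace ℝ ι) : partialDeriv j (cutoffGrad χ c g i) x =
      -c * (χ x * partialDeriv j (partialDeriv i g) x) +
        -c * (partialDeriv j χ x * partialDeriv i g x) := by
  simp only [funext fun y => show cutoffGrad χ c g i y = χ y * (-c * partialDeriv i g y) from rfl]
  rw [partialDeriv_mul hχ (contDiff_const.mul (contDiff_partialDeriv hg i)),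
    partialDeriv_const_mul (contDiff_partialDeriv hg i)]
  ring

lemma sum_partialDeriv_cutoffGrad (hχ : ContDiff ℝ ∞ χ) (hg : ContDiff ℝ ∞ g) (c : ℝ)
    (x : EuclideanSpace ℝ ι) : ∑ i, partialDeriv i (cutoffGrad χ c g i) x =
      χ x * (g x - c * ∑ i, partialDeriv i (partialDeriv i g) x) - cutoffDefect χ c g x := by
  simp only [partialDeriv_cutoffGrad hχ hg, Finset.sum_add_distrib, ← Finset.mul_sum,
    cutoffDefect]
  ring

lemma partialDeriv_cutoffDefect (hχ : IsTestFunction U χ) (hg : ContDiff ℝ ∞ g) (c : ℝ) (j : ι)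
    (x : EuclideanSpace ℝ ι) : partialDeriv j (cutoffDefect χ c g) x =
      χ x * partialDeriv j g x + partialDeriv j χ x * g x +
        c * ∑ i, (partialDeriv i χ x * partialDeriv j (partialDeriv i g) x +
          partialDeriv j (partialDeriv i χ) x * partialDeriv i g x) := by
  have smooth (i : ι) : ContDiff ℝ ∞ fun x => partialDeriv i χ x * partialDeriv i g x :=
    (hχ.partialDeriv i).contDiff.mul (contDiff_partialDeriv hg i)
  have smooth_sum : ContDiff ℝ ∞ fun x => ∑ i, partialDeriv i χ x * partialDeriv i g x :=
    ContDiff.sum fun i _ => smooth i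
  simp only [funext fun y => show cutoffDefect χ c g y =
    χ y * g y + c * ∑ i, partialDeriv i χ y * partialDeriv i g y from rfl]
  rw [partialDeriv_add (hχ.contDiff.mul hg) (contDiff_const.mul smooth_sum),
    partialDeriv_mul hχ.contDiff hg, partialDeriv_const_mul smooth_sum,
    partialDeriv_sum _ fun i _ => smooth i]
  simp only [partialDeriv_mul (hχ.partialDeriv _).contDiff (contDiff_partialDeriv hg _)]

lemma jetBounded_partialDeriv_cutoffGrad (hχ : IsTestFunction U χ) (c : ℝ) (i j : ι) :
    JetBounded fun g => partialDeriv j (cutoffGrad χ c g i) := by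
  simp only [funext fun g : SchwartzMap (EuclideanSpace ℝ ι) ℝ => funext fun x =>
    partialDeriv_cutoffGrad hχ.contDiff (g.smooth ⊤) c i j x]
  exact (((JetBounded.partialDeriv_partialDeriv j i).mul_left hχ).const_mul _).add
    (((JetBounded.partialDeriv i).mul_left (hχ.partialDeriv j)).const_mul _)

lemma jetBounded_cutoffDefect (hχ : IsTestFunction U χ) (c : ℝ) :
    JetBounded fun g => cutoffDefect χ c g :=
  (JetBounded.apply.mul_left hχ).add ((JetBounded.sum fun i _ =>
    (JetBounded.partialDeriv i).mul_left (hχ.partialDeriv i)).const_mul c)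

lemma jetBounded_partialDeriv_cutoffDefect (hχ : IsTestFunction U χ) (c : ℝ) (j : ι) :
    JetBounded fun g => partialDeriv j (cutoffDefect χ c g) := by
  simp only [funext fun g : SchwartzMap (EuclideanSpace ℝ ι) ℝ => funext fun x =>
    partialDeriv_cutoffDefect hχ (g.smooth ⊤) c j x]
  exact (((JetBounded.partialDeriv j).mul_left hχ).add
    (JetBounded.apply.mul_left (hχ.partialDeriv j))).add ((JetBounded.sum fun i _ =>
      ((JetBounded.partialDeriv_partialDeriv j i).mul_left (hχ.partialDeriv i)).add
        ((JetBounded.partialDeriv i).mul_left ((hχ.partialDeriv i).partialDeriv j))).const_mul c)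

lemma integral_cutoffDefect (hχ : IsTestFunction U χ) (hg : ContDiff ℝ ∞ g) {c : ℝ}
    {f : EuclideanSpace ℝ ι → ℝ} (hf : IsTestFunction U f) (mean : ∫ x, f x = 0)
    (hdiv : ∀ x, ∑ i, partialDeriv i (cutoffGrad χ c g i) x = f x - cutoffDefect χ c g x) :
    ∫ x, cutoffDefect χ c g x = 0 := by
  have hV (i : ι) := isTestFunction_cutoffGrad hχ hg c i
  have defect (x) : cutoffDefect χ c g x = f x - ∑ i, partialDeriv i (cutoffGrad χ c g i) x := by
    rw [hdiv, sub_sub_cancel]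
  simp only [defect]
  rw [integral_sub hf.integrable
    (integrable_finsetSum _ fun i _ => ((hV i).partialDeriv i).integrable), mean,
    integral_finsetSum _ fun i _ => ((hV i).partialDeriv i).integrable]
  simp only [fun i => (hV i).integral_partialDeriv_eq_zero i, Finset.sum_const_zero, sub_zero]

end Cutoff

section Ball

lemma exists_energy_cutoffGrad_le {U : Set Plane} {χ : Plane → ℝ} (hχ : IsTestFunction U χ)
    (c : ℝ) : ∃ C : ℝ, 0 ≤ C ∧ ∀ g : SchwartzMap Plane ℝ,
      energy (cutoffGrad χ c g) ≤ C * ∫ x, jetSq g x := by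
  choose C hC bound using fun i j =>
    (jetBounded_partialDeriv_cutoffGrad hχ c i j).exists_integral_sq_le
  refine ⟨∑ i, ∑ j, C i j, Finset.sum_nonneg fun i _ => Finset.sum_nonneg fun j _ => hC i j,
    fun g => ?_⟩
  simp only [energy, Finset.sum_mul]
  exact Finset.sum_le_sum fun i _ => Finset.sum_le_sum fun j _ => bound i j g

lemma energy_add_le {U : Set Plane} {v w : Fin 2 → Plane → ℝ}
    (hv : ∀ i, IsTestFunction U (v i)) (hw : ∀ i, IsTestFunction U (w i)) :
    energy (fun i x => v i x + w i x) ≤ 2 * energy v + 2 * energy w := by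
  simp only [energy, Finset.mul_sum, ← Finset.sum_add_distrib]
  refine Finset.sum_le_sum fun i _ => Finset.sum_le_sum fun j _ => ?_
  have := integral_sub_sq_le ((hv i).partialDeriv j).memLp ((hw i).partialDeriv j).memLp.neg
  simpa only [partialDeriv_add (hv i).contDiff (hw i).contDiff, Pi.neg_apply, sub_neg_eq_add,
    neg_sq] using this

lemma exists_cutoff : ∃ χ : Plane → ℝ, IsTestFunction (Metric.ball 0 2) χ ∧
    ∀ x ∈ Metric.ball (0 : Plane) 1, χ x = 1 := by
  let b : ContDiffBump (0 : Plane) := ⟨1, 3 / 2, by norm_num, by norm_num⟩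
  refine ⟨b, ⟨b.contDiff, b.hasCompactSupport, ?_⟩, fun x hx =>
    b.one_of_mem_closedBall (Metric.ball_subset_closedBall hx)⟩
  rw [b.tsupport_eq]
  exact Metric.closedBall_subset_ball (by norm_num [b])

lemma exists_div_eq_cutoffDefect {χ : Plane → ℝ} (hχ : IsTestFunction (Metric.ball 0 2) χ) (c : ℝ) :
    ∃ C : ℝ, 0 ≤ C ∧ ∀ g : SchwartzMap Plane ℝ, ∫ x, cutoffDefect χ c g x = 0 →
    ∃ W : Fin 2 → Plane → ℝ, (∀ i, IsTestFunction box (W i)) ∧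
      (∀ x, ∑ i, partialDeriv i (W i) x = cutoffDefect χ c g x) ∧
      energy W ≤ C * ∫ x, jetSq g x := by
  obtain ⟨Cb, hCb, solve_box⟩ := exists_div_eq_of_box
  obtain ⟨C₀, hC₀, defect_le⟩ := (jetBounded_cutoffDefect hχ c).exists_integral_sq_le
  obtain ⟨C₁, hC₁, partialDeriv_defect_le⟩ :=
    (jetBounded_partialDeriv_cutoffDefect hχ c 1).exists_integral_sq_le
  refine ⟨Cb * (C₀ + C₁), by positivity, fun g mean => ?_⟩
  obtain ⟨W, hW, hdiv, energy_le⟩ := solve_box _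
    ((isTestFunction_cutoffDefect hχ (g.smooth ⊤) c).mono ball_subset_box) mean
  refine ⟨W, hW, hdiv, energy_le.trans ?_⟩
  rw [mul_assoc, add_mul]
  exact mul_le_mul_of_nonneg_left (add_le_add (defect_le g) (partialDeriv_defect_le g)) hCb

/-- The truncated gradient of the resolvent solves the equation up to a defect which is small enough
in `H¹` to be removed by `exists_div_eq_of_box`. -/
lemma exists_div_eq_unit : ∃ C : ℝ, 0 ≤ C ∧ ∀ f : Plane → ℝ,
    IsTestFunction (Metric.ball 0 1) f → ∫ x, f x = 0 →
    ∃ w : Fin 2 → Plane → ℝ, (∀ i, IsTestFunction (Metric.ball 0 4) (w i)) ∧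
      (∀ x, ∑ i, partialDeriv i (w i) x = f x) ∧ energy w ≤ C * ∫ x, f x ^ 2 := by
  obtain ⟨χ, hχ, χ_one⟩ := exists_cutoff
  set c : ℝ := ((2 * Real.pi) ^ 2)⁻¹ with hc
  have c_pos : 0 < c := by positivity
  have c_le_one : c ≤ 1 := inv_le_one_of_one_le₀ (by nlinarith [Real.pi_gt_three])
  obtain ⟨Cv, hCv, energy_grad⟩ := exists_energy_cutoffGrad_le hχ c
  obtain ⟨Cd, hCd, solve_defect⟩ := exists_div_eq_cutoffDefect hχ c
  refine ⟨(2 * Cv + 2 * Cd) * (c ^ 2)⁻¹, by positivity, fun f hf mean => ?_⟩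
  obtain ⟨g, hg⟩ := exists_resolvent hf.contDiff hf.hasCompactSupport
  rw [← hc] at hg
  have smooth : ContDiff ℝ ∞ g := g.smooth ⊤
  have cutoff_f (x) : χ x * f x = f x := by
    by_cases hx : x ∈ Metric.ball (0 : Plane) 1
    · rw [χ_one x hx, one_mul]
    · rw [hf.eq_zero_of_notMem hx, mul_zero]
  have hdiv (x) : ∑ i, partialDeriv i (cutoffGrad χ c g i) x = f x - cutoffDefect χ c g x := by
    rw [sum_partialDeriv_cutoffGrad hχ.contDiff smooth, hg, cutoff_f]
  obtain ⟨W, hW, divW, energyW⟩ := solve_defect g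
    (integral_cutoffDefect hχ smooth (hf.mono (Metric.ball_subset_ball one_le_two)) mean hdiv)
  have hV (i) : IsTestFunction (Metric.ball 0 4) (cutoffGrad χ c g i) :=
    (isTestFunction_cutoffGrad hχ smooth c i).mono (Metric.ball_subset_ball (by norm_num))
  have hW' (i) := (hW i).mono box_subset_ball
  refine ⟨fun i x => cutoffGrad χ c g i x + W i x, fun i => (hV i).add (hW' i), fun x => ?_, ?_⟩
  · simp only [partialDeriv_add (hV _).contDiff (hW _).contDiff, Finset.sum_add_distrib, hdiv,
      divW, sub_add_cancel]
  · have jet_le : ∫ x, jetSq g x ≤ (c ^ 2)⁻¹ * ∫ x, f x ^ 2 := by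
      rw [← div_eq_inv_mul, le_div_iff₀' (by positivity)]
      simpa only [hg] using sq_mul_integral_jetSq_le g c_pos.le c_le_one
    calc energy (fun i x => cutoffGrad χ c g i x + W i x)
        ≤ 2 * energy (cutoffGrad χ c g) + 2 * energy W := energy_add_le hV hW'
      _ ≤ 2 * (Cv * ∫ x, jetSq g x) + 2 * (Cd * ∫ x, jetSq g x) := by
          gcongr
          exact energy_grad g
      _ = (2 * Cv + 2 * Cd) * ∫ x, jetSq g x := by ring
      _ ≤ (2 * Cv + 2 * Cd) * ((c ^ 2)⁻¹ * ∫ x, f x ^ 2) := by gcongr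
      _ = _ := by ring

lemma integral_comp_smul_sub {E F : Type*} [NormedAddCommGroup E] [NormedSpace ℝ E]
    [MeasurableSpace E] [BorelSpace E] [FiniteDimensional ℝ E] (μ : Measure E)
    [μ.IsAddHaarMeasure] [NormedAddCommGroup F] [NormedSpace ℝ F] (f : E → F) (z : E) {r : ℝ}
    (hr : 0 ≤ r) :
    ∫ x, f (r⁻¹ • (x - z)) ∂μ = r ^ Module.finrank ℝ E • ∫ x, f x ∂μ := by
  rw [integral_sub_right_eq_self (fun x => f (r⁻¹ • x)) z, Measure.integral_comp_smul, inv_pow,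
    inv_inv, abs_of_nonneg (pow_nonneg hr _)]

lemma partialDeriv_comp_smul_sub {ι : Type*} [DecidableEq ι] [Fintype ι]
    {φ : EuclideanSpace ℝ ι → ℝ} (hφ : ContDiff ℝ ∞ φ) (z : EuclideanSpace ℝ ι) (a : ℝ) (j : ι)
    (x : EuclideanSpace ℝ ι) :
    partialDeriv j (fun x => φ (a • (x - z))) x = a * partialDeriv j φ (a • (x - z)) := by
  have affine : HasFDerivAt (fun x => a • (x - z)) (a • .id ℝ (EuclideanSpace ℝ ι)) x :=
    ((hasFDerivAt_id x).sub_const z).const_smul a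
  have := (hφ.differentiable (by simp) (a • (x - z))).hasFDerivAt.comp x affine
  exact (DFunLike.congr_fun this.fderiv _).trans (by simp [partialDeriv])

lemma IsTestFunction.comp_homeomorph {E F : Type*} [NormedAddCommGroup E] [NormedSpace ℝ E]
    [NormedAddCommGroup F] [NormedSpace ℝ F] {U : Set F} {φ : F → ℝ} (hφ : IsTestFunction U φ)
    (e : E ≃ₜ F) (he : ContDiff ℝ ∞ e) : IsTestFunction (e ⁻¹' U) (φ ∘ e) where
  contDiff := hφ.contDiff.comp he
  hasCompactSupport := hφ.hasCompactSupport.comp_homeomorph e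
  tsupport_subset := by
    rw [tsupport_comp_eq_preimage]
    exact Set.preimage_mono hφ.tsupport_subset

lemma exists_div_eq_ball : ∃ C : ℝ, 0 ≤ C ∧ ∀ (z : Plane) (r : ℝ), 0 < r → ∀ f : Plane → ℝ,
    IsTestFunction (Metric.ball z r) f → ∫ x, f x = 0 →
    ∃ w : Fin 2 → Plane → ℝ, (∀ i, IsTestFunction (Metric.ball z (4 * r)) (w i)) ∧
      (∀ x, ∑ i, partialDeriv i (w i) x = f x) ∧ energy w ≤ C * ∫ x, f x ^ 2 := by
  obtain ⟨C, hC, solve_unit⟩ := exists_div_eq_unit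
  refine ⟨C, hC, fun z r hr f hf mean => ?_⟩
  let e : Plane ≃ₜ Plane :=
    (Homeomorph.subRight z).trans (Homeomorph.smulOfNeZero r⁻¹ (inv_pos.2 hr).ne')
  have e_apply (x) : e x = r⁻¹ • (x - z) := rfl
  have e_symm_apply (x) : e.symm x = r • x + z :=
    e.symm_apply_eq.2 (by simp [e_apply, hr.ne'])
  have scale (F : Plane → ℝ) : ∫ x, F (e x) = r ^ 2 * ∫ x, F x := by
    simpa [e_apply] using integral_comp_smul_sub volume F z hr.le
  have mem_ball (x) (ρ : ℝ) : x ∈ Metric.ball z (ρ * r) ↔ e x ∈ Metric.ball 0 ρ := by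
    rw [e_apply, mem_ball_zero_iff, Metric.mem_ball, dist_eq_norm, norm_smul, norm_inv,
      Real.norm_of_nonneg hr.le, inv_mul_lt_iff₀' hr]
  have hf₁ : IsTestFunction (Metric.ball 0 1) (f ∘ e.symm) := by
    refine (hf.comp_homeomorph e.symm ?_).mono fun y hy => ?_
    · simp only [funext e_symm_apply]
      fun_prop
    · simpa using (mem_ball (e.symm y) 1).1 (by simpa using hy)
  have mean₁ : ∫ y, (f ∘ e.symm) y = 0 := by
    have := scale (f ∘ e.symm)
    simp only [Function.comp_apply, e.symm_apply_apply, mean] at this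
    exact (mul_eq_zero.1 this.symm).resolve_left (by positivity)
  obtain ⟨w, hw, hdiv, hE⟩ := solve_unit _ hf₁ mean₁
  have e_contDiff : ContDiff ℝ ∞ e := by
    simp only [funext e_apply]
    fun_prop
  have partialDeriv_scaled (i j x) :
      partialDeriv j (fun x => r * w i (e x)) x = partialDeriv j (w i) (e x) := by
    have smooth : ContDiff ℝ ∞ fun x => w i (e x) := (hw i).contDiff.comp e_contDiff
    rw [partialDeriv_const_mul smooth]
    simp only [e_apply, partialDeriv_comp_smul_sub (hw i).contDiff]
    field_simp
  refine ⟨fun i x => r * w i (e x), fun i => ?_, fun x => ?_, ?_⟩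
  · exact (((hw i).comp_homeomorph e e_contDiff).mono fun x => (mem_ball x 4).2).const_mul r
  · simp [partialDeriv_scaled, hdiv]
  · calc energy (fun i x => r * w i (e x)) = r ^ 2 * energy w := by
          simp only [energy, partialDeriv_scaled, Finset.mul_sum,
            fun i j => scale fun x => partialDeriv j (w i) x ^ 2]
      _ ≤ r ^ 2 * (C * ∫ x, (f ∘ e.symm) x ^ 2) := by gcongr
      _ = C * ∫ x, f x ^ 2 := by
          rw [mul_left_comm, ← scale]
          simp only [Function.comp_apply, e.symm_apply_apply]

end Ball

/-! ### Oscillation and the gradient in `H⁻¹` -/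

section MeanZeroTests

variable {B : Set Plane}

/-- The classes in `L²(B)` of the test functions on `B` with mean value zero. -/
def meanZeroTests (B : Set Plane) : Submodule ℝ (L2 B) where
  carrier := {j | ∃ f, IsTestFunction B f ∧ ∫ x, f x = 0 ∧ j =ᵐ[volume.restrict B] f}
  zero_mem' := ⟨fun _ => 0, .zero, by simp, Lp.coeFn_zero _ _ _⟩
  add_mem' := by
    rintro j k ⟨f, hf, f_mean, hjf⟩ ⟨g, hg, g_mean, hkg⟩
    refine ⟨fun x => f x + g x, hf.add hg, ?_, ?_⟩
    · rw [integral_add hf.integrable hg.integrable, f_mean, g_mean, add_zero]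
    · filter_upwards [Lp.coeFn_add j k, hjf, hkg] with x h h₁ h₂
      rw [h, Pi.add_apply, h₁, h₂]
  smul_mem' := by
    rintro c j ⟨f, hf, f_mean, hjf⟩
    refine ⟨fun x => c * f x, hf.const_mul c, ?_, ?_⟩
    · rw [integral_const_mul, f_mean, mul_zero]
    · filter_upwards [Lp.coeFn_smul c j, hjf] with x h h₁
      rw [h, Pi.smul_apply, h₁, smul_eq_mul]

lemma inner_eq_integral (u v : L2 B) : inner ℝ u v = ∫ x in B, u x * v x := by
  simp [L2.inner_def, mul_comm]

lemma inner_eq_integral_of_ae_eq {u v : L2 B} {f g : Plane → ℝ} (hf : u =ᵐ[volume.restrict B] f)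
    (hg : v =ᵐ[volume.restrict B] g) : inner ℝ u v = ∫ x in B, f x * g x := by
  rw [inner_eq_integral]
  exact integral_congr_ae (hf.mul hg)

lemma sq_norm_eq_integral_of_ae_eq {u : L2 B} {f : Plane → ℝ} (hf : u =ᵐ[volume.restrict B] f) :
    ‖u‖ ^ 2 = ∫ x in B, f x ^ 2 := by
  rw [← real_inner_self_eq_norm_sq, inner_eq_integral_of_ae_eq hf hf]
  simp only [pow_two]

lemma IsTestFunction.setIntegral_eq {f : Plane → ℝ} (hf : IsTestFunction B f) :
    ∫ x in B, f x = ∫ x, f x :=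
  setIntegral_eq_integral_of_forall_compl_eq_zero fun _ hx => hf.eq_zero_of_notMem hx

lemma IsTestFunction.setIntegral_mul_eq {f : Plane → ℝ} (hf : IsTestFunction B f)
    (p : Plane → ℝ) : ∫ x in B, p x * f x = ∫ x, p x * f x :=
  setIntegral_eq_integral_of_forall_compl_eq_zero fun x hx => by
    rw [hf.eq_zero_of_notMem hx, mul_zero]

lemma IsTestFunction.memLp_restrict {f : Plane → ℝ} (hf : IsTestFunction B f) (A : Set Plane) :
    MemLp f 2 (volume.restrict A) :=
  hf.memLp.mono_measure Measure.restrict_le_self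

lemma IsTestFunction.integrable_mul {f p : Plane → ℝ} (hf : IsTestFunction B f) {A : Set Plane}
    (hp : MemLp p 2 (volume.restrict A)) : IntegrableOn (fun x => p x * f x) A :=
  MemLp.integrable_mul hp (hf.memLp_restrict A)

lemma exists_isTestFunction_integral_eq_one (hB : IsOpen B) (hne : B.Nonempty) :
    ∃ ψ, IsTestFunction B ψ ∧ ∫ x, ψ x = 1 := by
  obtain ⟨z, hz⟩ := hne
  obtain ⟨ρ, hρ, ball_subset⟩ := Metric.isOpen_iff.1 hB z hz
  let b : ContDiffBump z := ⟨ρ / 4, ρ / 2, by linarith, by linarith⟩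
  refine ⟨b.normed volume, ⟨b.contDiff_normed, b.hasCompactSupport_normed, ?_⟩, b.integral_normed⟩
  rw [b.tsupport_normed_eq]
  exact (Metric.closedBall_subset_ball (half_lt_self hρ)).trans ball_subset

lemma integral_mul_eq_of_orthogonal {u : L2 B} (hu : u ∈ (meanZeroTests B)ᗮ) {φ ψ : Plane → ℝ}
    (hφ : IsTestFunction B φ) (hψ : IsTestFunction B ψ) (hψ₁ : ∫ x, ψ x = 1) :
    ∫ x in B, u x * φ x = (∫ x in B, u x * ψ x) * ∫ x, φ x := by
  have hf : IsTestFunction B fun x => φ x - (∫ y, φ y) * ψ x := hφ.sub (hψ.const_mul _)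
  have mean : ∫ x, (φ x - (∫ y, φ y) * ψ x) = 0 := by
    rw [integral_sub hφ.integrable (hψ.integrable.const_mul _), integral_const_mul, hψ₁, mul_one,
      sub_self]
  have hf' := (hf.memLp_restrict B).coeFn_toLp
  have orthogonal := (Submodule.mem_orthogonal' _ _).1 hu _ ⟨_, hf, mean, hf'⟩
  rw [inner_eq_integral_of_ae_eq .rfl hf'] at orthogonal
  simp only [mul_sub, mul_left_comm (u _)] at orthogonal
  rwa [integral_sub (hφ.integrable_mul (Lp.memLp u))
    ((hψ.integrable_mul (Lp.memLp u)).const_mul _), integral_const_mul, sub_eq_zero,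
    mul_comm] at orthogonal

lemma ae_eq_const_of_orthogonal (hB : IsOpen B) (hb : Bornology.IsBounded B) (hne : B.Nonempty)
    {u : L2 B} (hu : u ∈ (meanZeroTests B)ᗮ) : ∃ a : ℝ, ∀ᵐ x ∂volume.restrict B, u x = a := by
  have : IsFiniteMeasure (volume.restrict B) := ⟨by simpa using hb.measure_lt_top⟩
  obtain ⟨ψ, hψ, hψ₁⟩ := exists_isTestFunction_integral_eq_one hB hne
  set a := ∫ x in B, u x * ψ x
  refine ⟨a, ?_⟩
  have hint : LocallyIntegrableOn (fun x => u x - a) B :=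
    IntegrableOn.locallyIntegrableOn
      (((Lp.memLp u).integrable (by norm_num)).sub (integrable_const a))
  have ae_zero := hB.ae_eq_zero_of_integral_contDiff_smul_eq_zero hint fun φ h h' h'' => by
    have hφ : IsTestFunction B φ := ⟨h, h', h''⟩
    calc ∫ x, φ x • (u x - a) = ∫ x in B, (u x - a) * φ x := by
          rw [hφ.setIntegral_mul_eq]
          simp only [smul_eq_mul, mul_comm]
      _ = (∫ x in B, u x * φ x) - a * ∫ x in B, φ x := by
          rw [← integral_const_mul, ← integral_sub (hφ.integrable_mul (Lp.memLp u))
            (hφ.integrable.restrict.const_mul _)]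
          simp only [sub_mul]
      _ = 0 := by
          rw [hφ.setIntegral_eq, integral_mul_eq_of_orthogonal hu hφ hψ hψ₁, sub_self]
  rw [ae_restrict_iff' hB.measurableSet]
  filter_upwards [ae_zero] with x hx hxB
  exact sub_eq_zero.1 (hx hxB)

lemma exists_mem_sq_norm_le_inner {E : Type*} [NormedAddCommGroup E] [InnerProductSpace ℝ E]
    {K : Submodule ℝ E} {q : E} (hq : q ∈ K.topologicalClosure) :
    ∃ j ∈ K, ‖j‖ ≤ 2 * ‖q‖ ∧ ‖q‖ ^ 2 / 2 ≤ inner ℝ q j := by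
  rcases eq_or_ne q 0 with rfl | hq₀
  · exact ⟨0, K.zero_mem, by simp, by simp⟩
  obtain ⟨j, hj, close⟩ := Metric.mem_closure_iff.1 hq (‖q‖ / 2) (half_pos (norm_pos_iff.2 hq₀))
  rw [dist_eq_norm] at close
  refine ⟨j, hj, ?_, ?_⟩
  · linarith [norm_sub_norm_le j q, norm_sub_rev j q, norm_nonneg q]
  · have split : inner ℝ q j = ‖q‖ ^ 2 - inner ℝ q (q - j) := by
      rw [inner_sub_right, real_inner_self_eq_norm_sq, sub_sub_cancel]
    nlinarith [real_inner_le_norm q (q - j), norm_nonneg q]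

/-- The squared oscillation of `p` on `B`: the squared distance in `L²(B)` from `p` to its mean. -/
def sqOsc (B : Set Plane) (p : Plane → ℝ) : ℝ := ∫ x in B, (p x - ⨍ y in B, p y) ^ 2

lemma sqOsc_nonneg (B : Set Plane) (p : Plane → ℝ) : 0 ≤ sqOsc B p :=
  integral_nonneg fun _ => sq_nonneg _

lemma exists_test_approx (hB : IsOpen B) (hb : Bornology.IsBounded B) (hne : B.Nonempty)
    {p : Plane → ℝ} (hp : MemLp p 2 (volume.restrict B)) :
    ∃ f, IsTestFunction B f ∧ ∫ x, f x = 0 ∧ ∫ x, f x ^ 2 ≤ 4 * sqOsc B p ∧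
      sqOsc B p / 2 ≤ ∫ x, p x * f x := by
  have : IsFiniteMeasure (volume.restrict B) := ⟨by simpa using hb.measure_lt_top⟩
  set c := ⨍ y in B, p y with hc
  have hq : MemLp (fun x => p x - c) 2 (volume.restrict B) := hp.sub (memLp_const c)
  have norm_q : ‖hq.toLp‖ ^ 2 = sqOsc B p := sq_norm_eq_integral_of_ae_eq hq.coeFn_toLp
  have closure : hq.toLp ∈ (meanZeroTests B).topologicalClosure := by
    rw [← Submodule.orthogonal_orthogonal_eq_closure, Submodule.mem_orthogonal]
    intro u hu
    obtain ⟨a, ha⟩ := ae_eq_const_of_orthogonal hB hb hne hu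
    rw [inner_eq_integral_of_ae_eq ha hq.coeFn_toLp, integral_const_mul, hc,
      integral_sub_average (volume.restrict B) p, mul_zero]
  obtain ⟨j, ⟨f, hf, mean, hjf⟩, norm_j, inner_j⟩ := exists_mem_sq_norm_le_inner closure
  refine ⟨f, hf, mean, ?_, ?_⟩
  · calc ∫ x, f x ^ 2 = ‖j‖ ^ 2 := by
          rw [sq_norm_eq_integral_of_ae_eq hjf]
          simp only [pow_two, hf.setIntegral_mul_eq]
      _ ≤ (2 * ‖hq.toLp‖) ^ 2 := by gcongr
      _ = 4 * sqOsc B p := by rw [mul_pow, norm_q]; norm_num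
  · calc sqOsc B p / 2 ≤ inner ℝ hq.toLp j := norm_q ▸ inner_j
      _ = ∫ x in B, (p x * f x - c * f x) := by
          simp only [inner_eq_integral_of_ae_eq hq.coeFn_toLp hjf, sub_mul]
      _ = ∫ x, p x * f x := by
          rw [integral_sub (hf.integrable_mul hp)
            (hf.integrable.restrict.const_mul _), integral_const_mul, hf.setIntegral_mul_eq,
            hf.setIntegral_eq, mean, mul_zero, sub_zero]

end MeanZeroTests

section GradBound

/-- The distributional gradient of `p` has norm at most `M` in `H⁻¹(Ω)²`. -/
def GradBound (Ω : Set Plane) (p : Plane → ℝ) (M : ℝ) : Prop :=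
  ∀ w : Fin 2 → Plane → ℝ, (∀ i, IsTestFunction Ω (w i)) →
    |∫ x in Ω, p x * ∑ i, partialDeriv i (w i) x| ≤ M * √(energy w)

lemma energy_nonneg (w : Fin 2 → Plane → ℝ) : 0 ≤ energy w :=
  Finset.sum_nonneg fun _ _ => Finset.sum_nonneg fun _ _ => integral_nonneg fun _ => sq_nonneg _

variable {κ : Type*} {s : Finset κ} {A : κ → Set Plane} {N : ℝ}

lemma integral_sq_sum_le {f : κ → Plane → ℝ} (hf : ∀ k ∈ s, IsTestFunction (A k) (f k))
    (overlap : ∀ x, ∑ k ∈ s, (A k).indicator 1 x ≤ N) :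
    ∫ x, (∑ k ∈ s, f k x) ^ 2 ≤ N * ∑ k ∈ s, ∫ x, f k x ^ 2 := by
  have integrable : ∀ k ∈ s, Integrable fun x => f k x ^ 2 :=
    fun k hk => (hf k hk).memLp.integrable_sq
  rw [← integral_finsetSum _ integrable, ← integral_const_mul]
  refine integral_mono_of_nonneg (Eventually.of_forall fun _ => sq_nonneg _)
    ((integrable_finsetSum _ integrable).const_mul _) (Eventually.of_forall fun x => ?_)
  have localize : ∀ k ∈ s, f k x = (A k).indicator 1 x * f k x := fun k hk => by
    by_cases hx : x ∈ A k
    · simp [hx]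
    · simp [hx, (hf k hk).eq_zero_of_notMem hx]
  calc (∑ k ∈ s, f k x) ^ 2 = (∑ k ∈ s, (A k).indicator 1 x * f k x) ^ 2 := by
        rw [Finset.sum_congr rfl localize]
    _ ≤ (∑ k ∈ s, (A k).indicator (1 : Plane → ℝ) x ^ 2) * ∑ k ∈ s, f k x ^ 2 :=
        Finset.sum_mul_sq_le_sq_mul_sq _ _ _
    _ ≤ N * ∑ k ∈ s, f k x ^ 2 := by
        gcongr
        refine (Finset.sum_congr rfl fun k _ => ?_).trans_le (overlap x)
        by_cases hx : x ∈ A k <;> simp [hx]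

lemma energy_sum_le {w : κ → Fin 2 → Plane → ℝ} (hw : ∀ k ∈ s, ∀ i, IsTestFunction (A k) (w k i))
    (overlap : ∀ x, ∑ k ∈ s, (A k).indicator 1 x ≤ N) :
    energy (fun i x => ∑ k ∈ s, w k i x) ≤ N * ∑ k ∈ s, energy (w k) := by
  calc energy (fun i x => ∑ k ∈ s, w k i x)
      = ∑ i, ∑ j, ∫ x, (∑ k ∈ s, partialDeriv j (w k i) x) ^ 2 := by
        simp only [energy, fun i => partialDeriv_sum s fun k hk => (hw k hk i).contDiff]
    _ ≤ ∑ i, ∑ j, N * ∑ k ∈ s, ∫ x, partialDeriv j (w k i) x ^ 2 :=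
        Finset.sum_le_sum fun i _ => Finset.sum_le_sum fun j _ =>
          integral_sq_sum_le (fun k hk => (hw k hk i).partialDeriv j) overlap
    _ = N * ∑ k ∈ s, energy (w k) := by
        simp only [energy, Fin.sum_univ_two, Finset.sum_add_distrib]
        ring

lemma exists_velocity_of_ball : ∃ C : ℝ, 0 ≤ C ∧ ∀ (z : Plane) (r : ℝ), 0 < r →
    ∀ p : Plane → ℝ, MemLp p 2 (volume.restrict (Metric.ball z r)) →
    ∃ (f : Plane → ℝ) (w : Fin 2 → Plane → ℝ), IsTestFunction (Metric.ball z r) f ∧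
      (∀ i, IsTestFunction (Metric.ball z (4 * r)) (w i)) ∧
      (∀ x, ∑ i, partialDeriv i (w i) x = f x) ∧ energy w ≤ C * sqOsc (Metric.ball z r) p ∧
      sqOsc (Metric.ball z r) p / 2 ≤ ∫ x, p x * f x := by
  obtain ⟨C, hC, solve⟩ := exists_div_eq_ball
  refine ⟨C * 4, by positivity, fun z r hr p hp => ?_⟩
  obtain ⟨f, hf, mean, sq_le, le_integral⟩ := exists_test_approx Metric.isOpen_ball
    Metric.isBounded_ball (Metric.nonempty_ball.2 hr) hp
  obtain ⟨w, hw, hdiv, energy_le⟩ := solve z r hr f hf mean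
  refine ⟨f, w, hf, hw, hdiv, energy_le.trans ?_, le_integral⟩
  rw [mul_assoc]
  gcongr

lemma le_mul_sq_of_half_le_mul_sqrt {S M A E : ℝ} (hS : 0 ≤ S) (hA : 0 ≤ A) (hE : 0 ≤ E)
    (lower : S / 2 ≤ M * √E) (upper : E ≤ A * S) : S ≤ 4 * A * M ^ 2 := by
  have quadratic : S * S ≤ 4 * A * M ^ 2 * S := by
    have sq_le : (S / 2) ^ 2 ≤ M ^ 2 * (A * S) := by
      calc (S / 2) ^ 2 ≤ (M * √E) ^ 2 := by gcongr
        _ = M ^ 2 * E := by rw [mul_pow, Real.sq_sqrt hE]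
        _ ≤ M ^ 2 * (A * S) := by gcongr
    linarith
  obtain zero | pos := hS.eq_or_lt
  · rw [← zero]
    positivity
  · exact le_of_mul_le_mul_right quadratic pos

lemma exists_sum_sqOsc_le : ∃ C : ℝ, 0 ≤ C ∧ ∀ (Ω : Set Plane) (p : Plane → ℝ) (M : ℝ),
    MemLp p 2 (volume.restrict Ω) → GradBound Ω p M →
    ∀ {κ : Type} (s : Finset κ) (z : κ → Plane) (r : κ → ℝ) (N : ℝ), (∀ k, 0 < r k) →
    (∀ k, Metric.ball (z k) (4 * r k) ⊆ Ω) →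
    (∀ x, ∑ k ∈ s, (Metric.ball (z k) (4 * r k)).indicator 1 x ≤ N) →
    ∑ k ∈ s, sqOsc (Metric.ball (z k) (r k)) p ≤ C * N * M ^ 2 := by
  obtain ⟨C, hC, velocity⟩ := exists_velocity_of_ball
  refine ⟨4 * C, by positivity, fun Ω p M hp hM κ s z r N hr hsub overlap => ?_⟩
  have hN : 0 ≤ N := (Finset.sum_nonneg fun k _ =>
    Set.indicator_nonneg (fun _ _ => zero_le_one) _).trans (overlap 0)
  have hsub' (k) : Metric.ball (z k) (r k) ⊆ Ω :=
    (Metric.ball_subset_ball (by linarith [hr k])).trans (hsub k)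
  choose f w hf hw hdiv energy_le le_integral using fun k => velocity (z k) (r k) (hr k) p
    (hp.mono_measure (Measure.restrict_mono (hsub' k) le_rfl))
  set W : Fin 2 → Plane → ℝ := fun i x => ∑ k ∈ s, w k i x with hW
  set S := ∑ k ∈ s, sqOsc (Metric.ball (z k) (r k)) p with hS
  have S_nonneg : 0 ≤ S := Finset.sum_nonneg fun k _ => sqOsc_nonneg _ _
  have div_W (x) : ∑ i, partialDeriv i (W i) x = ∑ k ∈ s, f k x := by
    simp only [hW, partialDeriv_sum s fun k _ => (hw k _).contDiff, ← hdiv]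
    exact Finset.sum_comm
  have lower : S / 2 ≤ M * √(energy W) := by
    calc S / 2 ≤ ∑ k ∈ s, ∫ x in Ω, p x * f k x := by
          rw [hS, Finset.sum_div]
          refine Finset.sum_le_sum fun k _ => ?_
          rw [((hf k).mono (hsub' k)).setIntegral_mul_eq]
          exact le_integral k
      _ = ∫ x in Ω, p x * ∑ i, partialDeriv i (W i) x := by
          simp only [div_W, Finset.mul_sum]
          exact (integral_finsetSum _ fun k _ => (hf k).integrable_mul hp).symm
      _ ≤ M * √(energy W) := (le_abs_self _).trans
          (hM W fun i => .sum s fun k _ => (hw k i).mono (hsub k))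
  have upper : energy W ≤ C * N * S := by
    calc energy W ≤ N * ∑ k ∈ s, energy (w k) := energy_sum_le (fun k _ => hw k) overlap
      _ ≤ N * ∑ k ∈ s, C * sqOsc (Metric.ball (z k) (r k)) p := by
          gcongr with k
          exact energy_le k
      _ = C * N * S := by rw [← Finset.mul_sum]; ring
  rw [mul_assoc 4]
  exact le_mul_sq_of_half_le_mul_sqrt S_nonneg (by positivity) (energy_nonneg W) lower upper

end GradBound

section Topology

variable {X : Type*} [TopologicalSpace X]

lemma biUnion_union_of_isPreconnected {κ : Type*} {S : Set X}
    (hS : IsPreconnected S) {P : Set X → Prop} {t : Finset κ} (ht : t.Nonempty) {A : κ → Set X}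
    (hA : ∀ k ∈ t, IsOpen (A k)) (hAS : ∀ k ∈ t, A k ⊆ S) (hne : ∀ k ∈ t, (A k).Nonempty)
    (cover : S ⊆ ⋃ k ∈ t, A k) (hP : ∀ k ∈ t, P (A k))
    (union : ∀ U V, IsOpen U → IsOpen V → U ⊆ S → V ⊆ S → (U ∩ V).Nonempty → P U → P V →
      P (U ∪ V)) : P S := by
  classical
  let U (s : Finset κ) : Set X := ⋃ k ∈ s, A k
  have isOpen_U {s} (hs : s ⊆ t) : IsOpen (U s) := isOpen_biUnion fun k hk => hA k (hs hk)
  have U_subset {s} (hs : s ⊆ t) : U s ⊆ S := Set.iUnion₂_subset fun k hk => hAS k (hs hk)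
  have meets {s} (hs : s ⊆ t) (h : s.Nonempty) : (S ∩ U s).Nonempty := by
    obtain ⟨k, hk⟩ := h
    obtain ⟨x, hx⟩ := hne k (hs hk)
    exact ⟨x, hAS k (hs hk) hx, Set.mem_iUnion₂.2 ⟨k, hk, hx⟩⟩
  obtain ⟨k₀, hk₀⟩ := ht
  obtain ⟨s, hs, maximal⟩ := (t.powerset.filter fun s => s.Nonempty ∧ P (U s)).exists_max_image
    Finset.card ⟨{k₀}, by simpa [U, hk₀] using hP k₀ hk₀⟩
  simp only [Finset.mem_filter, Finset.mem_powerset] at hs maximal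
  obtain ⟨hst, hs_ne, hPs⟩ := hs
  have eq : s = t := by
    refine hst.antisymm (Finset.sdiff_eq_empty_iff_subset.1 ?_)
    by_contra! rest_ne
    have split : S ⊆ U s ∪ U (t \ s) := by
      rwa [← Finset.set_biUnion_union, Finset.union_sdiff_of_subset hst]
    obtain ⟨x, -, hxs, hxt⟩ := hS _ _ (isOpen_U hst) (isOpen_U Finset.sdiff_subset) split
      (meets hst hs_ne) (meets Finset.sdiff_subset rest_ne)
    obtain ⟨k, hk, hxk⟩ := Set.mem_iUnion₂.1 hxt
    obtain ⟨hkt, hks⟩ := Finset.mem_sdiff.1 hk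
    have hP_insert : P (U (insert k s)) := by
      simp only [U, Finset.set_biUnion_insert]
      exact union _ _ (hA k hkt) (isOpen_U hst) (hAS k hkt) (U_subset hst) ⟨x, hxk, hxs⟩
        (hP k hkt) hPs
    have := maximal _ ⟨Finset.insert_subset hkt hst, Finset.insert_nonempty _ _, hP_insert⟩
    rw [Finset.card_insert_of_notMem hks] at this
    omega
  rwa [← (U_subset hst).antisymm (eq ▸ cover)]

end Topology

section SetIntegral

variable {α : Type*} [MeasurableSpace α] {μ : Measure α} {f : α → ℝ} {U V : Set α} {c c₁ c₂ : ℝ}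

lemma measureReal_mul_sq_sub_le (hU : μ U ≠ ⊤) (h₁ : IntegrableOn (fun x => (f x - c₁) ^ 2) U μ)
    (h₂ : IntegrableOn (fun x => (f x - c₂) ^ 2) U μ) :
    μ.real U * (c₁ - c₂) ^ 2 ≤
      2 * (∫ x in U, (f x - c₁) ^ 2 ∂μ) + 2 * ∫ x in U, (f x - c₂) ^ 2 ∂μ := by
  calc μ.real U * (c₁ - c₂) ^ 2 = ∫ _ in U, (c₁ - c₂) ^ 2 ∂μ := by
        rw [setIntegral_const, smul_eq_mul]
    _ ≤ ∫ x in U, (2 * (f x - c₁) ^ 2 + 2 * (f x - c₂) ^ 2) ∂μ :=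
        setIntegral_mono (integrableOn_const hU)
          (by exact (h₁.const_mul 2).add (h₂.const_mul 2)) fun x => by
          nlinarith [sq_nonneg ((f x - c₁) + (f x - c₂))]
    _ = _ := by
        rw [integral_add (h₁.const_mul 2) (h₂.const_mul 2), integral_const_mul, integral_const_mul]

lemma setIntegral_sq_sub_le (hU : μ U ≠ ⊤) (h₁ : IntegrableOn (fun x => (f x - c₁) ^ 2) U μ)
    (h₂ : IntegrableOn (fun x => (f x - c₂) ^ 2) U μ) :
    ∫ x in U, (f x - c₁) ^ 2 ∂μ ≤
      2 * (∫ x in U, (f x - c₂) ^ 2 ∂μ) + 2 * (μ.real U * (c₁ - c₂) ^ 2) := by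
  have const : IntegrableOn (fun _ => 2 * (c₁ - c₂) ^ 2) U μ := integrableOn_const hU
  calc ∫ x in U, (f x - c₁) ^ 2 ∂μ ≤ ∫ x in U, (2 * (f x - c₂) ^ 2 + 2 * (c₁ - c₂) ^ 2) ∂μ :=
        setIntegral_mono h₁ (by exact (h₂.const_mul 2).add const) fun x => by
          nlinarith [sq_nonneg ((f x - c₂) + (c₁ - c₂))]
    _ = _ := by
        rw [integral_add (h₂.const_mul 2) const, integral_const_mul, setIntegral_const, smul_eq_mul,
          mul_left_comm]

lemma setIntegral_union_le (hU : MeasurableSet U) (hV : MeasurableSet V) (hf : ∀ x, 0 ≤ f x)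
    (h₁ : IntegrableOn f U μ) (h₂ : IntegrableOn f V μ) :
    ∫ x in U ∪ V, f x ∂μ ≤ (∫ x in U, f x ∂μ) + ∫ x in V, f x ∂μ := by
  rw [← Set.union_sdiff_self, setIntegral_union Set.disjoint_sdiff_right (hV.diff hU) h₁
    (h₂.mono_set Set.sdiff_subset)]
  exact add_le_add le_rfl
    (setIntegral_mono_set h₂ (Eventually.of_forall hf) Set.sdiff_subset.eventuallyLE)

end SetIntegral

section OscControlled

/-- On `U` the distance of `p` to the constants is controlled by the gradient of `p` in
`H⁻¹(Ω)²`. -/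
def OscControlled (Ω U : Set Plane) : Prop :=
  ∃ C : ℝ, 0 ≤ C ∧ ∀ (p : Plane → ℝ) (M : ℝ), MemLp p 2 (volume.restrict Ω) →
    GradBound Ω p M → ∃ c : ℝ, ∫ x in U, (p x - c) ^ 2 ≤ C * M ^ 2

variable {Ω U V : Set Plane}

lemma integrableOn_sq_sub_const (hb : Bornology.IsBounded Ω) (hU : U ⊆ Ω) {p : Plane → ℝ}
    (hp : MemLp p 2 (volume.restrict Ω)) (c : ℝ) : IntegrableOn (fun x => (p x - c) ^ 2) U := by
  have : IsFiniteMeasure (volume.restrict Ω) := ⟨by simpa using hb.measure_lt_top⟩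
  exact IntegrableOn.mono_set (hp.sub (memLp_const c)).integrable_sq hU

namespace OscControlled

lemma mono (hb : Bornology.IsBounded Ω) (hU : U ⊆ Ω) (h : OscControlled Ω U) (hVU : V ⊆ U) :
    OscControlled Ω V := by
  obtain ⟨C, hC, control⟩ := h
  refine ⟨C, hC, fun p M hp hM => ?_⟩
  obtain ⟨c, hc⟩ := control p M hp hM
  exact ⟨c, (setIntegral_mono_set (integrableOn_sq_sub_const hb hU hp c)
    (Eventually.of_forall fun _ => sq_nonneg _) hVU.eventuallyLE).trans hc⟩

lemma of_ball {z : Plane} {r : ℝ} (hr : 0 < r) (h : Metric.ball z (4 * r) ⊆ Ω) :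
    OscControlled Ω (Metric.ball z r) := by
  obtain ⟨C, hC, sum_le⟩ := exists_sum_sqOsc_le
  refine ⟨C, hC, fun p M hp hM => ⟨⨍ y in Metric.ball z r, p y, ?_⟩⟩
  simpa [sqOsc] using sum_le Ω p M hp hM ({()} : Finset Unit) (fun _ => z) (fun _ => r) 1
    (fun _ => hr) (fun _ => h) (fun x => by
      by_cases hx : x ∈ Metric.ball z (4 * r) <;> simp [hx])

lemma union (hb : Bornology.IsBounded Ω) (hU : U ⊆ Ω) (hV : V ⊆ Ω) (hUo : IsOpen U)
    (hVo : IsOpen V) (hne : (U ∩ V).Nonempty) (h₁ : OscControlled Ω U) (h₂ : OscControlled Ω V) :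
    OscControlled Ω (U ∪ V) := by
  obtain ⟨C₁, hC₁, control₁⟩ := h₁
  obtain ⟨C₂, hC₂, control₂⟩ := h₂
  have finite {A} (hA : A ⊆ Ω) : volume A ≠ ⊤ := (hb.subset hA).measure_lt_top.ne
  have hUV : U ∩ V ⊆ Ω := Set.inter_subset_left.trans hU
  set m := volume.real (U ∩ V)
  have m_pos : 0 < m :=
    ENNReal.toReal_pos ((hUo.inter hVo).measure_pos _ hne).ne' (finite hUV)
  refine ⟨C₁ + (2 * C₂ + 2 * (volume.real V * ((2 * C₁ + 2 * C₂) / m))), by positivity,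
    fun p M hp hM => ?_⟩
  obtain ⟨c₁, hc₁⟩ := control₁ p M hp hM
  obtain ⟨c₂, hc₂⟩ := control₂ p M hp hM
  refine ⟨c₁, ?_⟩
  have integrable {A} (hA : A ⊆ Ω) := integrableOn_sq_sub_const hb hA hp
  have mono {A B} (hA : A ⊆ B) (hB : B ⊆ Ω) (c : ℝ) :
      ∫ x in A, (p x - c) ^ 2 ≤ ∫ x in B, (p x - c) ^ 2 :=
    setIntegral_mono_set (integrable hB c) (Eventually.of_forall fun _ => sq_nonneg _)
      hA.eventuallyLE
  have constants_close : (c₁ - c₂) ^ 2 ≤ (2 * C₁ + 2 * C₂) / m * M ^ 2 := by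
    rw [div_mul_eq_mul_div, le_div_iff₀' m_pos]
    linarith [measureReal_mul_sq_sub_le (finite hUV) (integrable hUV c₁) (integrable hUV c₂),
      mono (A := U ∩ V) Set.inter_subset_left hU c₁,
      mono (A := U ∩ V) Set.inter_subset_right hV c₂]
  calc ∫ x in U ∪ V, (p x - c₁) ^ 2
      ≤ (∫ x in U, (p x - c₁) ^ 2) + ∫ x in V, (p x - c₁) ^ 2 :=
        setIntegral_union_le hUo.measurableSet hVo.measurableSet (fun _ => sq_nonneg _)
          (integrable hU c₁) (integrable hV c₁)
    _ ≤ C₁ * M ^ 2 + (2 * (∫ x in V, (p x - c₂) ^ 2) + 2 * (volume.real V * (c₁ - c₂) ^ 2)) :=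
        add_le_add hc₁ (setIntegral_sq_sub_le (finite hV) (integrable hV c₁) (integrable hV c₂))
    _ ≤ C₁ * M ^ 2 + (2 * (C₂ * M ^ 2) +
          2 * (volume.real V * ((2 * C₁ + 2 * C₂) / m * M ^ 2))) := by gcongr
    _ = _ := by ring

lemma of_local (hb : Bornology.IsBounded Ω) (ho : IsOpen Ω) (hc : IsConnected Ω)
    (hloc : ∀ x ∈ closure Ω, ∃ O, IsOpen O ∧ x ∈ O ∧ OscControlled Ω (O ∩ Ω)) :
    OscControlled Ω Ω := by
  classical
  choose! O isOpen mem_O control using hloc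
  obtain ⟨t, t_subset, cover⟩ := hb.isCompact_closure.elim_nhds_subcover O fun x hx =>
    (isOpen x hx).mem_nhds (mem_O x hx)
  have cover' : Ω ⊆ ⋃ x ∈ t, O x ∩ Ω := fun x hx => by
    obtain ⟨y, hy, hxy⟩ := Set.mem_iUnion₂.1 (cover (subset_closure hx))
    exact Set.mem_iUnion₂.2 ⟨y, hy, hxy, hx⟩
  have ht : t.Nonempty := by
    obtain ⟨x, hx⟩ := hc.nonempty
    obtain ⟨y, hy, -⟩ := Set.mem_iUnion₂.1 (cover' hx)
    exact ⟨y, hy⟩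
  exact biUnion_union_of_isPreconnected hc.isPreconnected ht
    (fun x hx => (isOpen x (t_subset x hx)).inter ho) (fun _ _ => Set.inter_subset_right)
    (fun x hx => mem_closure_iff.1 (t_subset x hx) _ (isOpen x (t_subset x hx))
      (mem_O x (t_subset x hx))) cover' (fun x hx => control x (t_subset x hx))
    fun _ _ hU hV hUΩ hVΩ hne hPU hPV => hPU.union hb hUΩ hVΩ hU hV hne hPV

end OscControlled

end OscControlled

section SetIntegral

variable {α : Type*} [MeasurableSpace α] {μ : Measure α} {T : α → α} {θ : ℝ} {f g : α → ℝ}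
  {A B P : Set α}

lemma setIntegral_le_of_sum_le {ι : Type*} [Countable ι] {A : ι → Set α} (hf : ∀ x, 0 ≤ f x)
    (hfA : ∀ i, IntegrableOn f (A i) μ) (cover : P ⊆ ⋃ i, A i) {K : ℝ}
    (hK : ∀ s : Finset ι, ∑ i ∈ s, ∫ x in A i, f x ∂μ ≤ K) : ∫ x in P, f x ∂μ ≤ K := by
  have measurable : AEStronglyMeasurable f (μ.restrict P) :=
    (aestronglyMeasurable_iUnion_iff.2 fun i => (hfA i).aestronglyMeasurable).mono_set cover
  rw [integral_eq_lintegral_of_nonneg_ae (Eventually.of_forall hf) measurable]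
  refine ENNReal.toReal_le_of_le_ofReal (by simpa using hK ∅) ?_
  calc ∫⁻ x in P, ENNReal.ofReal (f x) ∂μ ≤ ∫⁻ x in ⋃ i, A i, ENNReal.ofReal (f x) ∂μ :=
        lintegral_mono_set cover
    _ ≤ ∑' i, ∫⁻ x in A i, ENNReal.ofReal (f x) ∂μ := lintegral_iUnion_le _ _
    _ = ∑' i, ENNReal.ofReal (∫ x in A i, f x ∂μ) := by
        simp only [ofReal_integral_eq_lintegral_ofReal (hfA _) (Eventually.of_forall hf)]
    _ ≤ ENNReal.ofReal K := by
        rw [ENNReal.tsum_eq_iSup_sum]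
        refine iSup_le fun s => ?_
        rw [← ENNReal.ofReal_sum_of_nonneg fun i _ => integral_nonneg hf]
        exact ENNReal.ofReal_le_ofReal (hK s)

lemma memLp_comp_preimage (hT : MeasurePreserving T μ (ENNReal.ofReal θ • μ))
    (emb : MeasurableEmbedding T) (hg : MemLp g 2 (μ.restrict A)) :
    MemLp (fun x => g (T x)) 2 (μ.restrict (T ⁻¹' A)) := by
  have := hT.restrict_preimage_emb emb A
  rw [Measure.restrict_smul] at this
  exact (hg.smul_measure ENNReal.ofReal_ne_top).comp_measurePreserving this

lemma memLp_sub_comp (hT : MeasurePreserving T μ (ENNReal.ofReal θ • μ))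
    (emb : MeasurableEmbedding T) (hg : MemLp g 2 (μ.restrict B)) :
    MemLp (fun x => g x - g (T x)) 2 (μ.restrict (B ∩ T ⁻¹' B)) :=
  (hg.mono_measure (Measure.restrict_mono_set μ Set.inter_subset_left)).sub
    ((memLp_comp_preimage hT emb hg).mono_measure
      (Measure.restrict_mono_set μ Set.inter_subset_right))

lemma setIntegral_comp_preimage (hθ : 0 ≤ θ)
    (hT : MeasurePreserving T μ (ENNReal.ofReal θ • μ)) (emb : MeasurableEmbedding T)
    (f : α → ℝ) (A : Set α) : ∫ x in T ⁻¹' A, f (T x) ∂μ = θ * ∫ x in A, f x ∂μ := by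
  rw [hT.setIntegral_preimage_emb emb, Measure.restrict_smul, integral_smul_measure,
    ENNReal.toReal_ofReal hθ, smul_eq_mul]

lemma setIntegral_sq_sub_comp_le (hθ₀ : 0 ≤ θ) (hθ : θ ≤ 1)
    (hT : MeasurePreserving T μ (ENNReal.ofReal θ • μ)) (emb : MeasurableEmbedding T)
    (hg : MemLp g 2 (μ.restrict B)) :
    ∫ x in B ∩ T ⁻¹' B, (g x - g (T x)) ^ 2 ∂μ ≤ 4 * ∫ x in B, g x ^ 2 ∂μ := by
  have sq := hg.integrable_sq
  have sq' := (memLp_comp_preimage hT emb hg).integrable_sq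
  have h₁ : IntegrableOn (fun x => 2 * g x ^ 2) (B ∩ T ⁻¹' B) μ :=
    (IntegrableOn.mono_set sq Set.inter_subset_left).const_mul 2
  have h₂ : IntegrableOn (fun x => 2 * g (T x) ^ 2) (B ∩ T ⁻¹' B) μ :=
    (IntegrableOn.mono_set sq' Set.inter_subset_right).const_mul 2
  calc ∫ x in B ∩ T ⁻¹' B, (g x - g (T x)) ^ 2 ∂μ
      ≤ ∫ x in B ∩ T ⁻¹' B, (2 * g x ^ 2 + 2 * g (T x) ^ 2) ∂μ :=
        integral_mono_of_nonneg (Eventually.of_forall fun _ => sq_nonneg _)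
          (by exact h₁.add h₂)
          (Eventually.of_forall fun x => by dsimp only; nlinarith [sq_nonneg (g x + g (T x))])
    _ = 2 * (∫ x in B ∩ T ⁻¹' B, g x ^ 2 ∂μ) + 2 * ∫ x in B ∩ T ⁻¹' B, g (T x) ^ 2 ∂μ := by
        rw [integral_add h₁ h₂, integral_const_mul, integral_const_mul]
    _ ≤ 2 * (∫ x in B, g x ^ 2 ∂μ) + 2 * ∫ x in T ⁻¹' B, g (T x) ^ 2 ∂μ := by
        refine add_le_add (mul_le_mul_of_nonneg_left ?_ zero_le_two)
          (mul_le_mul_of_nonneg_left ?_ zero_le_two)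
        · exact setIntegral_mono_set sq (Eventually.of_forall fun _ => sq_nonneg _)
            Set.inter_subset_left.eventuallyLE
        · exact setIntegral_mono_set sq' (Eventually.of_forall fun _ => sq_nonneg _)
            Set.inter_subset_right.eventuallyLE
    _ = (2 + 2 * θ) * ∫ x in B, g x ^ 2 ∂μ := by
        rw [setIntegral_comp_preimage hθ₀ hT emb (fun x => g x ^ 2)]
        ring
    _ ≤ 4 * ∫ x in B, g x ^ 2 ∂μ := by gcongr; linarith

lemma add_sq_le_mul_add_mul {η : ℝ} (hη : 0 < η) (a b : ℝ) :
    (a + b) ^ 2 ≤ (1 + 1 / η) * a ^ 2 + (1 + η) * b ^ 2 := by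
  have : (1 + 1 / η) * a ^ 2 + (1 + η) * b ^ 2 - (a + b) ^ 2 = (a - η * b) ^ 2 / η := by
    field_simp
    ring
  linarith [div_nonneg (sq_nonneg (a - η * b)) hη.le]

lemma le_of_le_mul_add {a b d : ℝ} (hb : 0 ≤ b) (ha : 0 ≤ a) (hd : 0 ≤ d) (hθ₀ : 0 ≤ θ)
    (hθ : θ < 1)
    (h : a ≤ (1 + 1 / ((1 - θ) / 2)) * d + (1 + (1 - θ) / 2) * (θ * (a + b))) :
    a ≤ 6 / (1 - θ) ^ 2 * (d + b) := by
  obtain ⟨s, rfl⟩ : ∃ s, θ = 1 - s := ⟨1 - θ, by ring⟩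
  rw [sub_sub_cancel] at h ⊢
  have hs : 0 < s := by linarith
  rw [div_mul_eq_mul_div, le_div_iff₀ (by positivity)]
  have h' : a * s ≤ (s + 2) * d + (1 + s / 2) * (1 - s) * s * (a + b) := by
    calc a * s ≤ ((1 + 1 / (s / 2)) * d + (1 + s / 2) * ((1 - s) * (a + b))) * s := by gcongr
      _ = _ := by field_simp
  nlinarith [mul_nonneg ha hs.le, mul_nonneg hb hs.le, mul_nonneg hd hs.le,
    mul_nonneg (mul_nonneg ha hs.le) hs.le, mul_nonneg (mul_nonneg hb hs.le) hs.le]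

lemma setIntegral_sq_le_of_subset_preimage (hθ₀ : 0 ≤ θ) (hθ : θ < 1)
    (hT : MeasurePreserving T μ (ENNReal.ofReal θ • μ)) (emb : MeasurableEmbedding T)
    (hP : MeasurableSet P) (hB : MeasurableSet B) (hPT : P ⊆ T ⁻¹' (P ∪ B))
    (hg : MemLp g 2 (μ.restrict (P ∪ B))) :
    ∫ x in P, g x ^ 2 ∂μ ≤
      6 / (1 - θ) ^ 2 * ((∫ x in P, (g x - g (T x)) ^ 2 ∂μ) + ∫ x in B, g x ^ 2 ∂μ) := by
  set η := (1 - θ) / 2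
  have hη : 0 < η := by simp only [η]; linarith
  have hgP : MemLp g 2 (μ.restrict P) := hg.mono_measure (Measure.restrict_mono_set μ (by simp))
  have hgB : MemLp g 2 (μ.restrict B) := hg.mono_measure (Measure.restrict_mono_set μ (by simp))
  have comp := memLp_comp_preimage hT emb hg
  have compP := comp.mono_measure (Measure.restrict_mono_set μ hPT)
  have image_le : ∫ x in P, g (T x) ^ 2 ∂μ ≤
      θ * ((∫ x in P, g x ^ 2 ∂μ) + ∫ x in B, g x ^ 2 ∂μ) := by
    calc ∫ x in P, g (T x) ^ 2 ∂μ ≤ ∫ x in T ⁻¹' (P ∪ B), g (T x) ^ 2 ∂μ :=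
          setIntegral_mono_set comp.integrable_sq (Eventually.of_forall fun _ => sq_nonneg _)
            hPT.eventuallyLE
      _ = θ * ∫ x in P ∪ B, g x ^ 2 ∂μ :=
          setIntegral_comp_preimage hθ₀ hT emb (fun x => g x ^ 2) _
      _ ≤ _ := mul_le_mul_of_nonneg_left (setIntegral_union_le hP hB (fun _ => sq_nonneg _)
          hgP.integrable_sq hgB.integrable_sq) hθ₀
  refine le_of_le_mul_add (integral_nonneg fun _ => sq_nonneg _)
    (integral_nonneg fun _ => sq_nonneg _) (integral_nonneg fun _ => sq_nonneg _) hθ₀ hθ ?_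
  have h₁ : Integrable (fun x => (1 + 1 / η) * (g x - g (T x)) ^ 2) (μ.restrict P) :=
    (hgP.sub compP).integrable_sq.const_mul _
  have h₂ : Integrable (fun x => (1 + η) * g (T x) ^ 2) (μ.restrict P) :=
    compP.integrable_sq.const_mul _
  calc ∫ x in P, g x ^ 2 ∂μ
      ≤ ∫ x in P, ((1 + 1 / η) * (g x - g (T x)) ^ 2 + (1 + η) * g (T x) ^ 2) ∂μ :=
        integral_mono hgP.integrable_sq (h₁.add h₂) fun x => by
          simpa using add_sq_le_mul_add_mul hη (g x - g (T x)) (g (T x))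
    _ = (1 + 1 / η) * (∫ x in P, (g x - g (T x)) ^ 2 ∂μ) +
          (1 + η) * ∫ x in P, g (T x) ^ 2 ∂μ := by
        rw [integral_add h₁ h₂, integral_const_mul, integral_const_mul]
    _ ≤ _ := by gcongr

end SetIntegral

lemma OscControlled.of_whitney {Ω P : Set Plane} (hb : Bornology.IsBounded Ω)
    (hP : MeasurableSet P) {ι : Type} [Countable ι] {z : ι → Plane} {r : ι → ℝ} {N : ℝ}
    (hr : ∀ i, 0 < r i) (hsub : ∀ i, Metric.ball (z i) (4 * r i) ⊆ Ω)
    (overlap : ∀ (s : Finset ι) x, ∑ i ∈ s, (Metric.ball (z i) (4 * r i)).indicator 1 x ≤ N)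
    {T : Plane → Plane} {θ : ℝ} (hθ₀ : 0 ≤ θ) (hθ : θ < 1)
    (hT : MeasurePreserving T volume (ENNReal.ofReal θ • volume)) (emb : MeasurableEmbedding T)
    (cover : P ⊆ ⋃ i, Metric.ball (z i) (r i) ∩ T ⁻¹' Metric.ball (z i) (r i)) (i₀ : ι)
    (maps : P ⊆ T ⁻¹' (P ∪ Metric.ball (z i₀) (r i₀))) : OscControlled Ω P := by
  obtain ⟨C, hC, sum_le⟩ := exists_sum_sqOsc_le
  have hN : 0 ≤ N := by simpa using overlap ∅ 0
  have finite : IsFiniteMeasure (volume.restrict Ω) := ⟨by simpa using hb.measure_lt_top⟩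
  let B i := Metric.ball (z i) (r i)
  have hBΩ i : B i ⊆ Ω :=
    (Metric.ball_subset_ball (by linarith [hr i])).trans (hsub i)
  have hPΩ : P ⊆ Ω := fun x hx => by
    obtain ⟨i, hi, -⟩ := Set.mem_iUnion.1 (cover hx)
    exact hBΩ i hi
  refine ⟨6 / (1 - θ) ^ 2 * (4 * (C * N) + C * N), by positivity, fun p M hp hM => ?_⟩
  have sum_le' (s : Finset ι) : ∑ i ∈ s, sqOsc (B i) p ≤ C * N * M ^ 2 :=
    sum_le Ω p M hp hM s z r N hr hsub (overlap s)
  have memLp {A} (hA : A ⊆ Ω) (c : ℝ) : MemLp (fun x => p x - c) 2 (volume.restrict A) :=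
    (hp.sub (memLp_const c)).mono_measure (Measure.restrict_mono_set _ hA)
  have increments_le : ∫ x in P, (p x - p (T x)) ^ 2 ≤ 4 * (C * N * M ^ 2) := by
    refine setIntegral_le_of_sum_le (fun _ => sq_nonneg _) (fun i => ?_) cover fun s => ?_
    · simpa [IntegrableOn, B] using (memLp_sub_comp hT emb (memLp (hBΩ i) 0)).integrable_sq
    · calc ∑ i ∈ s, ∫ x in B i ∩ T ⁻¹' B i, (p x - p (T x)) ^ 2 ≤ ∑ i ∈ s, 4 * sqOsc (B i) p :=
            Finset.sum_le_sum fun i _ => by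
              simpa [sqOsc] using
                setIntegral_sq_sub_comp_le hθ₀ hθ.le hT emb (memLp (hBΩ i) (⨍ y in B i, p y))
        _ ≤ 4 * (C * N * M ^ 2) := by
            rw [← Finset.mul_sum]
            exact mul_le_mul_of_nonneg_left (sum_le' s) (by norm_num)
  refine ⟨⨍ y in B i₀, p y, ?_⟩
  calc ∫ x in P, (p x - ⨍ y in B i₀, p y) ^ 2
      ≤ 6 / (1 - θ) ^ 2 * ((∫ x in P, (p x - p (T x)) ^ 2) + sqOsc (B i₀) p) := by
        simpa [sqOsc] using setIntegral_sq_le_of_subset_preimage hθ₀ hθ hT emb hP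
          Metric.isOpen_ball.measurableSet maps
          (memLp (Set.union_subset hPΩ (hBΩ i₀)) (⨍ y in B i₀, p y))
    _ ≤ 6 / (1 - θ) ^ 2 * (4 * (C * N * M ^ 2) + C * N * M ^ 2) := by
        gcongr
        simpa using sum_le' {i₀}
    _ = _ := by ring

/-! ### Coordinates above a Lipschitz graph -/

section Graph

variable {e : Plane ≃ₗᵢ[ℝ] Plane} {γ : ℝ → ℝ} {L : ℝ≥0} {l : ℝ}

/-- The height of `y` above the graph of `γ`, in the coordinates given by `e`. -/
def height (e : Plane ≃ₗᵢ[ℝ] Plane) (γ : ℝ → ℝ) (y : Plane) : ℝ := e y 1 - γ (e y 0)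

/-- The point with abscissa `X` and height `t` above the graph of `γ`, in the coordinates given
by `e`. -/
def graphPoint (e : Plane ≃ₗᵢ[ℝ] Plane) (γ : ℝ → ℝ) (X t : ℝ) : Plane :=
  e.symm !₂[X, γ X + t]

/-- The dilation by `l` of the heights above the graph of `γ`; the abscissas are fixed. -/
def dilate (e : Plane ≃ₗᵢ[ℝ] Plane) (γ : ℝ → ℝ) (l : ℝ) (y : Plane) : Plane :=
  graphPoint e γ (e y 0) (l * height e γ y)

@[simp] lemma graphPoint_fst (X t : ℝ) : e (graphPoint e γ X t) 0 = X := by simp [graphPoint]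

@[simp] lemma graphPoint_snd (X t : ℝ) : e (graphPoint e γ X t) 1 = γ X + t := by
  simp [graphPoint]

@[simp] lemma height_graphPoint (X t : ℝ) : height e γ (graphPoint e γ X t) = t := by
  simp [height]

lemma graphPoint_height (y : Plane) : graphPoint e γ (e y 0) (height e γ y) = y := by
  refine e.injective ?_
  ext i
  fin_cases i <;> simp [height]

@[simp] lemma dilate_fst (y : Plane) : e (dilate e γ l y) 0 = e y 0 := graphPoint_fst _ _

@[simp] lemma height_dilate (y : Plane) : height e γ (dilate e γ l y) = l * height e γ y :=
  height_graphPoint _ _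

lemma abs_coord_sub_le (i : Fin 2) (y z : Plane) : |e y i - e z i| ≤ dist y z := by
  rw [← e.dist_map y z, dist_eq_norm]
  exact PiLp.norm_apply_le (e y - e z) i

lemma dist_le_coords (y z : Plane) : dist y z ≤ |e y 0 - e z 0| + |e y 1 - e z 1| := by
  rw [← e.dist_map y z, EuclideanSpace.dist_eq, Fin.sum_univ_two, Real.dist_eq, Real.dist_eq]
  refine Real.sqrt_le_iff.2 ⟨by positivity, ?_⟩
  nlinarith [mul_nonneg (abs_nonneg (e y 0 - e z 0)) (abs_nonneg (e y 1 - e z 1))]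

lemma abs_height_sub_le (hγ : LipschitzWith L γ) (y z : Plane) :
    |height e γ y - height e γ z| ≤ (1 + L) * dist y z := by
  calc |height e γ y - height e γ z|
      = |(e y 1 - e z 1) - (γ (e y 0) - γ (e z 0))| := by rw [height, height]; ring_nf
    _ ≤ |e y 1 - e z 1| + |γ (e y 0) - γ (e z 0)| := abs_sub _ _
    _ ≤ dist y z + L * |e y 0 - e z 0| :=
        add_le_add (abs_coord_sub_le 1 y z) (hγ.dist_le_mul _ _)
    _ ≤ dist y z + L * dist y z := by gcongr; exact abs_coord_sub_le 0 y z
    _ = _ := by ring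

lemma dist_graphPoint_le (hγ : LipschitzWith L γ) (y : Plane) (X t : ℝ) :
    dist y (graphPoint e γ X t) ≤ (1 + L) * |e y 0 - X| + |height e γ y - t| := by
  calc dist y (graphPoint e γ X t)
      ≤ |e y 0 - X| + |(γ (e y 0) - γ X) + (height e γ y - t)| := by
        convert dist_le_coords (e := e) y (graphPoint e γ X t) using 3
        · simp
        · rw [graphPoint_snd, height]
          ring
    _ ≤ |e y 0 - X| + (|γ (e y 0) - γ X| + |height e γ y - t|) := by
        gcongr
        exact abs_add_le _ _
    _ ≤ |e y 0 - X| + (L * |e y 0 - X| + |height e γ y - t|) := by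
        gcongr
        exact hγ.dist_le_mul _ _
    _ = _ := by ring

lemma continuous_height (hγ : Continuous γ) : Continuous (height e γ) := by
  unfold height
  fun_prop

lemma continuous_dilate (hγ : Continuous γ) : Continuous (dilate e γ l) := by
  have := continuous_height (e := e) hγ
  unfold dilate graphPoint
  fun_prop

lemma measurableEmbedding_dilate (hγ : Continuous γ) (hl : 0 < l) :
    MeasurableEmbedding (dilate e γ l) := by
  refine (continuous_dilate hγ).measurableEmbedding
    (Function.LeftInverse.injective (g := dilate e γ l⁻¹) fun y => ?_)
  rw [dilate, dilate_fst, height_dilate, inv_mul_cancel_left₀ hl.ne', graphPoint_height]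

lemma measurePreserving_skew_affine {g : ℝ → ℝ} (hg : Measurable g) (hl : 0 < l) :
    MeasurePreserving (fun q : ℝ × ℝ => (q.1, l * q.2 - g q.1)) volume
      (ENNReal.ofReal l⁻¹ • volume) := by
  have := MeasurePreserving.skew_product (μa := (volume : Measure ℝ)) (μb := volume)
    (μc := (volume : Measure ℝ)) (μd := ENNReal.ofReal l⁻¹ • volume)
    (MeasurePreserving.id volume) (g := fun a b => l * b - g a)
    (show Measurable fun q : ℝ × ℝ => l * q.2 - g q.1 by fun_prop)
    (Eventually.of_forall fun a => by
      rw [show (fun b => l * b - g a) = (fun b => b - g a) ∘ (l * ·) from rfl,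
        ← Measure.map_map (by fun_prop) (by fun_prop), Real.map_volume_mul_left hl.ne',
        Measure.map_smul, abs_of_pos (inv_pos.2 hl),
        (measurePreserving_sub_right volume (g a)).map_eq])
  rwa [Measure.prod_smul_right] at this

lemma measurePreserving_dilate (hγ : Measurable γ) (hl : 0 < l) :
    MeasurePreserving (dilate e γ l) volume (ENNReal.ofReal l⁻¹ • volume) := by
  let coords : Plane ≃ᵐ ℝ × ℝ :=
    (e.toMeasurableEquiv.trans (MeasurableEquiv.toLp 2 (Fin 2 → ℝ)).symm).trans
      MeasurableEquiv.finTwoArrow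
  have preserving : MeasurePreserving coords volume volume :=
    ((volume_preserving_finTwoArrow ℝ).comp (PiLp.volume_preserving_ofLp (Fin 2))).comp
      e.measurePreserving
  have conj : dilate e γ l =
      coords.symm ∘ (fun q : ℝ × ℝ => (q.1, l * q.2 - (l - 1) * γ q.1)) ∘ coords := by
    ext1 y
    apply coords.injective
    rw [Function.comp_apply, MeasurableEquiv.apply_symm_apply]
    change (e (dilate e γ l y) 0, e (dilate e γ l y) 1) =
      (e y 0, l * e y 1 - (l - 1) * γ (e y 0))
    rw [dilate, graphPoint_fst, graphPoint_snd, height]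
    ring_nf
  rw [conj]
  exact ((preserving.symm _).smul_measure _).comp
    ((measurePreserving_skew_affine (hγ.const_mul _) hl).comp preserving)

end Graph

section Whitney

variable {e : Plane ≃ₗᵢ[ℝ] Plane} {γ : ℝ → ℝ} {L : ℝ≥0} {a h : ℝ}

/-- The ratio of the mesh width to the height in the Whitney decomposition of the region above the
graph of an `L`-Lipschitz function. -/
def whitneyWidth (L : ℝ≥0) : ℝ := (8 * (3 + (L : ℝ)) ^ 2)⁻¹

/-- The height of the `k`-th layer of Whitney balls, where `h` is the height of the top layer. -/
def layer (L : ℝ≥0) (h : ℝ) (k : ℕ) : ℝ := h * ((1 + whitneyWidth L)⁻¹) ^ k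

/-- The horizontal mesh width in the `k`-th layer of Whitney balls. -/
def meshWidth (L : ℝ≥0) (h : ℝ) (k : ℕ) : ℝ := whitneyWidth L * layer L h k

/-- The centres of the Whitney balls above the abscissas near `a`; the index consists of the layer
and the horizontal position. -/
def whitneyCenter (e : Plane ≃ₗᵢ[ℝ] Plane) (γ : ℝ → ℝ) (L : ℝ≥0) (a h : ℝ) (i : ℕ × ℤ) : Plane :=
  graphPoint e γ (a + i.2 * meshWidth L h i.1) (layer L h i.1)

/-- The radii of the Whitney balls. -/
def whitneyRadius (L : ℝ≥0) (h : ℝ) (i : ℕ × ℤ) : ℝ := (3 + L) * meshWidth L h i.1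

lemma whitneyWidth_pos : 0 < whitneyWidth L := by
  unfold whitneyWidth
  positivity

lemma mul_whitneyWidth_eq : 8 * (3 + (L : ℝ)) ^ 2 * whitneyWidth L = 1 :=
  mul_inv_cancel₀ (by positivity)

lemma whitneyWidth_le : whitneyWidth L ≤ 1 / 72 := by
  rw [whitneyWidth, one_div]
  refine inv_anti₀ (by norm_num) ?_
  nlinarith [NNReal.coe_nonneg L]

lemma layer_pos (hh : 0 < h) (k : ℕ) : 0 < layer L h k := by
  have := whitneyWidth_pos (L := L)
  unfold layer
  positivity

lemma meshWidth_pos (hh : 0 < h) (k : ℕ) : 0 < meshWidth L h k :=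
  mul_pos whitneyWidth_pos (layer_pos hh k)

lemma whitneyRadius_pos (hh : 0 < h) (i : ℕ × ℤ) : 0 < whitneyRadius L h i :=
  mul_pos (by positivity) (meshWidth_pos hh i.1)

lemma layer_zero : layer L h 0 = h := by simp [layer]

lemma layer_le (hh : 0 < h) (k : ℕ) : layer L h k ≤ h := by
  have := whitneyWidth_pos (L := L)
  exact mul_le_of_le_one_right hh.le
    (pow_le_one₀ (by positivity) (inv_le_one_of_one_le₀ (by linarith)))

lemma pow_mul_layer_add (k m : ℕ) : (1 + whitneyWidth L) ^ m * layer L h (k + m) = layer L h k := by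
  have : 1 + whitneyWidth L ≠ 0 := by linarith [whitneyWidth_pos (L := L)]
  unfold layer
  rw [pow_add, inv_pow _ m]
  field_simp

lemma mul_whitneyRadius_le (hh : 0 < h) (i : ℕ × ℤ) :
    (1 + (L : ℝ)) * (4 * whitneyRadius L h i) ≤ layer L h i.1 / 2 := by
  have width_small : (1 + (L : ℝ)) * (4 * ((3 + (L : ℝ)) * whitneyWidth L)) ≤ 1 / 2 := by
    nlinarith [mul_whitneyWidth_eq (L := L), whitneyWidth_pos (L := L),
      mul_nonneg L.2 (whitneyWidth_pos (L := L)).le]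
  calc (1 + (L : ℝ)) * (4 * whitneyRadius L h i)
      = (1 + (L : ℝ)) * (4 * ((3 + (L : ℝ)) * whitneyWidth L)) * layer L h i.1 := by
        rw [whitneyRadius, meshWidth]
        ring
    _ ≤ 1 / 2 * layer L h i.1 := mul_le_mul_of_nonneg_right width_small (layer_pos hh i.1).le
    _ = _ := by ring

lemma mem_whitneyBall (hγ : LipschitzWith L γ) (hh : 0 < h) (i : ℕ × ℤ) {y : Plane}
    (abscissa : |e y 0 - (a + i.2 * meshWidth L h i.1)| ≤ meshWidth L h i.1)
    (height_near : |height e γ y - layer L h i.1| ≤ meshWidth L h i.1) :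
    y ∈ Metric.ball (whitneyCenter e γ L a h i) (whitneyRadius L h i) := by
  calc dist y (whitneyCenter e γ L a h i)
      ≤ (1 + L) * |e y 0 - (a + i.2 * meshWidth L h i.1)| + |height e γ y - layer L h i.1| :=
        dist_graphPoint_le hγ y _ _
    _ ≤ (1 + L) * meshWidth L h i.1 + meshWidth L h i.1 := by gcongr
    _ < (1 + L) * meshWidth L h i.1 + 2 * meshWidth L h i.1 := by
        linarith [meshWidth_pos (L := L) hh i.1]
    _ = whitneyRadius L h i := by
        rw [whitneyRadius]
        ring

lemma height_mem_Icc_of_mem_whitneyBall (hγ : LipschitzWith L γ) (hh : 0 < h) {i : ℕ × ℤ}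
    {y : Plane} (hy : y ∈ Metric.ball (whitneyCenter e γ L a h i) (4 * whitneyRadius L h i)) :
    height e γ y ∈ Set.Icc (layer L h i.1 / 2) (3 * (layer L h i.1 / 2)) := by
  have near : |height e γ y - layer L h i.1| ≤ layer L h i.1 / 2 := by
    calc |height e γ y - layer L h i.1|
        ≤ (1 + L) * dist y (whitneyCenter e γ L a h i) := by
          simpa [whitneyCenter] using
            abs_height_sub_le (e := e) hγ y (whitneyCenter e γ L a h i)
      _ ≤ (1 + L) * (4 * whitneyRadius L h i) := by
          gcongr
          exact (Metric.mem_ball.1 hy).le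
      _ ≤ _ := mul_whitneyRadius_le hh i
  rw [abs_le] at near
  constructor <;> linarith

lemma whitneyBall_subset (hγ : LipschitzWith L γ) {Ω : Set Plane} {x₀ : Plane} {ρ : ℝ}
    (hh : 0 < h) (hx₀ : height e γ x₀ = 0) (hρ : (4 + L) * h ≤ ρ)
    (hΩ : ∀ y ∈ Metric.ball x₀ ρ, (y ∈ Ω ↔ 0 < height e γ y)) {i : ℕ × ℤ}
    (hi : |i.2 * meshWidth L h i.1| ≤ h) :
    Metric.ball (whitneyCenter e γ L (e x₀ 0) h i) (4 * whitneyRadius L h i) ⊆ Ω := by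
  intro y hy
  have radius_le : 4 * whitneyRadius L h i ≤ h := by
    nlinarith [mul_whitneyRadius_le (L := L) hh i, whitneyRadius_pos (L := L) hh i,
      layer_le (L := L) hh i.1, mul_nonneg L.2 (whitneyRadius_pos (L := L) hh i).le]
  have center_near : dist x₀ (whitneyCenter e γ L (e x₀ 0) h i) ≤ (1 + L) * h + h := by
    calc dist x₀ (whitneyCenter e γ L (e x₀ 0) h i)
        ≤ (1 + L) * |i.2 * meshWidth L h i.1| + layer L h i.1 := by
          have := dist_graphPoint_le (e := e) hγ x₀ (e x₀ 0 + i.2 * meshWidth L h i.1)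
            (layer L h i.1)
          rwa [hx₀, sub_add_cancel_left, abs_neg, zero_sub, abs_neg,
            abs_of_pos (layer_pos hh i.1)] at this
      _ ≤ _ := by
          gcongr
          exact layer_le hh i.1
  refine (hΩ y (Metric.mem_ball.2 ?_)).2 ?_
  · linarith [Metric.mem_ball.1 hy,
      dist_triangle_right y x₀ (whitneyCenter e γ L (e x₀ 0) h i)]
  · linarith [(height_mem_Icc_of_mem_whitneyBall hγ hh hy).1, layer_pos (L := L) hh i.1]

lemma card_le_of_layers {s : Finset (ℕ × ℤ)} {m q : ℕ} {c : ℕ → ℝ}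
    (hm : ∀ i ∈ s, ∀ j ∈ s, i.1 ≤ j.1 + m) (hq : ∀ i ∈ s, |i.2 - c i.1| ≤ q) :
    s.card ≤ (m + 1) * (2 * q + 1) := by
  obtain rfl | hs := s.eq_empty_or_nonempty
  · simp
  obtain ⟨i₀, hi₀, lowest⟩ := s.exists_min_image Prod.fst hs
  have card_eq : (Finset.range (m + 1) ×ˢ Finset.Icc (-(q : ℤ)) q).card =
      (m + 1) * (2 * q + 1) := by
    rw [Finset.card_product, Finset.card_range, Int.card_Icc]
    congr 1
    omega
  rw [← card_eq]
  refine Finset.card_le_card_of_injOn (fun i => (i.1 - i₀.1, i.2 - ⌊c i.1⌋)) (fun i hi => ?_)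
    fun i hi j hj hij => ?_
  · obtain ⟨lower, upper⟩ := abs_le.1 (hq i hi)
    have floor_le := Int.floor_le (c i.1)
    have lt_floor := Int.lt_floor_add_one (c i.1)
    have lower' : -(q : ℤ) ≤ i.2 - ⌊c i.1⌋ := by
      rify
      linarith
    have upper' : i.2 - ⌊c i.1⌋ < (q : ℤ) + 1 := by
      rify
      linarith
    have := hm i hi i₀ hi₀
    simp only [Finset.coe_product, Set.mem_prod, Finset.mem_coe, Finset.mem_range, Finset.mem_Icc]
    omega
  · have hi' := lowest i hi
    have hj' := lowest j hj
    obtain ⟨same_layer, same_position⟩ := Prod.mk.inj hij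
    have fst_eq : i.1 = j.1 := by omega
    rw [fst_eq, sub_left_inj] at same_position
    exact Prod.ext fst_eq same_position

lemma layer_index_le (hγ : LipschitzWith L γ) (hh : 0 < h) {i j : ℕ × ℤ} {x : Plane}
    (hi : x ∈ Metric.ball (whitneyCenter e γ L a h i) (4 * whitneyRadius L h i))
    (hj : x ∈ Metric.ball (whitneyCenter e γ L a h j) (4 * whitneyRadius L h j)) :
    i.1 ≤ j.1 + ⌈2 / whitneyWidth L⌉₊ := by
  obtain hle | hle := le_total i.1 j.1
  · omega
  obtain ⟨d, hd⟩ := Nat.exists_eq_add_of_le hle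
  have layer_le : layer L h j.1 ≤ 3 * layer L h i.1 := by
    linarith [(height_mem_Icc_of_mem_whitneyBall hγ hh hj).1,
      (height_mem_Icc_of_mem_whitneyBall hγ hh hi).2]
  have pow_le : (1 + whitneyWidth L) ^ d ≤ 3 := by
    rw [← pow_mul_layer_add j.1 d, ← hd] at layer_le
    exact le_of_mul_le_mul_right layer_le (layer_pos hh i.1)
  have bernoulli := one_add_mul_le_pow
    (by linarith [whitneyWidth_pos (L := L)] : (-2 : ℝ) ≤ whitneyWidth L) d
  have : (d : ℝ) ≤ 2 / whitneyWidth L := by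
    rw [le_div_iff₀ whitneyWidth_pos]
    linarith
  have : d ≤ ⌈2 / whitneyWidth L⌉₊ := by exact_mod_cast this.trans (Nat.le_ceil _)
  omega

lemma abs_position_sub_le (hh : 0 < h) {i : ℕ × ℤ} {x : Plane}
    (hi : x ∈ Metric.ball (whitneyCenter e γ L a h i) (4 * whitneyRadius L h i)) :
    |i.2 - (e x 0 - a) / meshWidth L h i.1| ≤ 4 * (3 + L) := by
  have mesh_pos := meshWidth_pos (L := L) hh i.1
  have : i.2 - (e x 0 - a) / meshWidth L h i.1 =
      -(e x 0 - (a + i.2 * meshWidth L h i.1)) / meshWidth L h i.1 := by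
    field_simp
    ring
  rw [this, abs_div, abs_neg, abs_of_pos mesh_pos, div_le_iff₀ mesh_pos, mul_assoc]
  simpa [whitneyCenter, whitneyRadius] using
    (abs_coord_sub_le (e := e) 0 x (whitneyCenter e γ L a h i)).trans (Metric.mem_ball.1 hi).le

/-- A bound for the number of Whitney balls whose fourfold dilates have a common point. -/
def whitneyOverlap (L : ℝ≥0) : ℕ :=
  (⌈2 / whitneyWidth L⌉₊ + 1) * (2 * ⌈4 * (3 + (L : ℝ))⌉₊ + 1)

lemma sum_indicator_whitneyBall_le (hγ : LipschitzWith L γ) (hh : 0 < h) (s : Finset (ℕ × ℤ))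
    (x : Plane) :
    ∑ i ∈ s, (Metric.ball (whitneyCenter e γ L a h i) (4 * whitneyRadius L h i)).indicator 1 x ≤
      (whitneyOverlap L : ℝ) := by
  classical
  simp only [Set.indicator_apply, Pi.one_apply, Finset.sum_boole, Nat.cast_le]
  refine card_le_of_layers (c := fun k => (e x 0 - a) / meshWidth L h k)
    (fun i hi j hj => layer_index_le hγ hh (Finset.mem_filter.1 hi).2 (Finset.mem_filter.1 hj).2)
    fun i hi => (abs_position_sub_le hh (Finset.mem_filter.1 hi).2).trans (Nat.le_ceil _)

/-- The points with abscissa close to `a` between the graph and its vertical translate by `h`. -/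
def patch (e : Plane ≃ₗᵢ[ℝ] Plane) (γ : ℝ → ℝ) (L : ℝ≥0) (a h : ℝ) : Set Plane :=
  {y | |e y 0 - a| < whitneyWidth L * h ∧ 0 < height e γ y ∧ height e γ y < h}

lemma isOpen_patch (hγ : Continuous γ) : IsOpen (patch e γ L a h) := by
  have abscissa : Continuous fun y => |e y 0 - a| := by fun_prop
  have := continuous_height (e := e) hγ
  exact (isOpen_lt abscissa continuous_const).inter
    ((isOpen_lt continuous_const this).inter (isOpen_lt this continuous_const))

lemma exists_layer (hh : 0 < h) {t : ℝ} (ht : 0 < t) (hth : t ≤ h) :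
    ∃ k, layer L h (k + 1) < t ∧ t ≤ layer L h k := by
  have := whitneyWidth_pos (L := L)
  obtain ⟨k, lower, upper⟩ := exists_nat_pow_near_of_lt_one (x := t / h) (by positivity)
    (by rwa [div_le_one hh]) (y := (1 + whitneyWidth L)⁻¹) (by positivity)
    (inv_lt_one_of_one_lt₀ (by linarith))
  rw [lt_div_iff₀' hh] at lower
  rw [div_le_iff₀' hh] at upper
  exact ⟨k, lower, upper⟩

lemma exists_whitneyBall (hγ : LipschitzWith L γ) (hh : 0 < h) {y : Plane}
    (hy : y ∈ patch e γ L a h) : ∃ i : ℕ × ℤ, |i.2 * meshWidth L h i.1| ≤ h ∧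
      y ∈ Metric.ball (whitneyCenter e γ L a h i) (whitneyRadius L h i) ∧
      dilate e γ (1 + whitneyWidth L) y ∈
        Metric.ball (whitneyCenter e γ L a h i) (whitneyRadius L h i) := by
  obtain ⟨near, height_pos, height_lt⟩ := hy
  have width_pos := whitneyWidth_pos (L := L)
  obtain ⟨k, lower, upper⟩ := exists_layer (L := L) hh height_pos height_lt.le
  have succ_eq : layer L h (k + 1) + whitneyWidth L * layer L h (k + 1) = layer L h k := by
    linarith [pow_mul_layer_add (L := L) (h := h) k 1]
  have mesh_eq : meshWidth L h k = whitneyWidth L * layer L h k := rfl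
  have mesh_le : meshWidth L h k ≤ whitneyWidth L * h := by
    rw [mesh_eq]
    gcongr
    exact layer_le hh k
  have mesh_le' : whitneyWidth L * layer L h (k + 1) ≤ meshWidth L h k := by
    rw [mesh_eq]
    gcongr
    linarith [mul_pos width_pos (layer_pos (L := L) hh (k + 1))]
  have width_le : whitneyWidth L * h ≤ 1 / 72 * h :=
    mul_le_mul_of_nonneg_right whitneyWidth_le hh.le
  obtain ⟨j, ⟨hj, hj'⟩, -⟩ := existsUnique_zsmul_near_of_pos (meshWidth_pos (L := L) hh k)
    (e y 0 - a)
  simp only [zsmul_eq_mul, Int.cast_add, Int.cast_one, add_mul, one_mul] at hj hj'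
  have abscissa : |e y 0 - (a + j * meshWidth L h k)| ≤ meshWidth L h k :=
    abs_le.2 ⟨by linarith, by linarith⟩
  have height_mul_le : whitneyWidth L * height e γ y ≤ meshWidth L h k := by
    rw [mesh_eq]
    gcongr
  have height_mul_pos := mul_pos width_pos height_pos
  refine ⟨(k, j), ?_, mem_whitneyBall hγ hh _ abscissa ?_, mem_whitneyBall hγ hh _ ?_ ?_⟩
  · obtain ⟨left, right⟩ := abs_lt.1 near
    exact abs_le.2 ⟨by linarith, by linarith⟩
  · exact abs_le.2 ⟨by linarith, by linarith⟩
  · rwa [dilate_fst]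
  · rw [height_dilate, add_mul, one_mul]
    exact abs_le.2 ⟨by linarith, by linarith⟩

lemma patch_subset_preimage_dilate (hγ : LipschitzWith L γ) (hh : 0 < h) :
    patch e γ L a h ⊆ dilate e γ (1 + whitneyWidth L) ⁻¹' (patch e γ L a h ∪
      Metric.ball (whitneyCenter e γ L a h (0, 0)) (whitneyRadius L h (0, 0))) := by
  rintro y ⟨near, height_pos, height_lt⟩
  have width_pos := whitneyWidth_pos (L := L)
  obtain hlt | hge := lt_or_ge ((1 + whitneyWidth L) * height e γ y) h
  · left
    refine ⟨by rwa [dilate_fst], ?_, by rwa [height_dilate]⟩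
    rw [height_dilate]
    positivity
  · right
    have mul_le : whitneyWidth L * height e γ y ≤ whitneyWidth L * h := by gcongr
    refine mem_whitneyBall hγ hh _ ?_ ?_
    · simpa [meshWidth, layer_zero] using near.le
    · rw [height_dilate, meshWidth, layer_zero]
      exact abs_le.2 ⟨by nlinarith, by linarith⟩

lemma patch_subset (hγ : LipschitzWith L γ) {Ω : Set Plane} {x₀ : Plane} {ρ : ℝ} (hh : 0 < h)
    (hx₀ : height e γ x₀ = 0) (hρ : (4 + L) * h ≤ ρ)
    (hΩ : ∀ y ∈ Metric.ball x₀ ρ, (y ∈ Ω ↔ 0 < height e γ y)) :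
    patch e γ L (e x₀ 0) h ⊆ Ω := by
  intro y hy
  obtain ⟨i, hi, mem, -⟩ := exists_whitneyBall hγ hh hy
  have radius_pos := whitneyRadius_pos (L := L) hh i
  exact whitneyBall_subset hγ hh hx₀ hρ hΩ hi (Metric.ball_subset_ball (by linarith) mem)

lemma oscControlled_patch (hγ : LipschitzWith L γ) {Ω : Set Plane} (hb : Bornology.IsBounded Ω)
    {x₀ : Plane} {ρ : ℝ} (hh : 0 < h) (hx₀ : height e γ x₀ = 0) (hρ : (4 + L) * h ≤ ρ)
    (hΩ : ∀ y ∈ Metric.ball x₀ ρ, (y ∈ Ω ↔ 0 < height e γ y)) :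
    OscControlled Ω (patch e γ L (e x₀ 0) h) := by
  have width_pos := whitneyWidth_pos (L := L)
  let J := {i : ℕ × ℤ // |i.2 * meshWidth L h i.1| ≤ h}
  refine OscControlled.of_whitney hb (isOpen_patch hγ.continuous).measurableSet (ι := J)
    (z := fun i => whitneyCenter e γ L (e x₀ 0) h i) (r := fun i => whitneyRadius L h i)
    (N := whitneyOverlap L) (fun i => whitneyRadius_pos hh i)
    (fun i => whitneyBall_subset hγ hh hx₀ hρ hΩ i.2) (fun s x => ?_)
    (T := dilate e γ (1 + whitneyWidth L)) (θ := (1 + whitneyWidth L)⁻¹) (by positivity)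
    (inv_lt_one_of_one_lt₀ (by linarith))
    (measurePreserving_dilate hγ.continuous.measurable (by positivity))
    (measurableEmbedding_dilate hγ.continuous (by positivity)) (fun y hy => ?_)
    ⟨(0, 0), by simpa using hh.le⟩ (patch_subset_preimage_dilate hγ hh)
  · simpa using sum_indicator_whitneyBall_le hγ hh (s.map (Function.Embedding.subtype _)) x
  · obtain ⟨i, hi, mem⟩ := exists_whitneyBall hγ hh hy
    exact Set.mem_iUnion.2 ⟨⟨i, hi⟩, mem⟩

end Whitney

lemma height_eq_zero_of_mem_frontier {e : Plane ≃ₗᵢ[ℝ] Plane} {γ : ℝ → ℝ} {Ω : Set Plane}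
    {x : Plane} (hγ : Continuous γ) (ho : IsOpen Ω) (hx : x ∈ frontier Ω)
    (hΩ : ∀ᶠ y in 𝓝 x, (y ∈ Ω ↔ 0 < height e γ y)) : height e γ x = 0 := by
  rw [ho.frontier_eq] at hx
  refine le_antisymm (not_lt.1 fun above => hx.2 (hΩ.self_of_nhds.2 above)) ?_
  by_contra! below
  have below_near : ∀ᶠ y in 𝓝 x, height e γ y < 0 :=
    (continuous_height hγ).continuousAt.eventually_lt_const below
  obtain ⟨y, hyΩ, hy, hy'⟩ :=
    ((mem_closure_iff_frequently.1 hx.1).and_eventually (below_near.and hΩ)).exists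
  exact hy.not_gt (hy'.1 hyΩ)

lemma exists_nhds_oscControlled_of_mem {Ω : Set Plane} (ho : IsOpen Ω)
    (hb : Bornology.IsBounded Ω) {x : Plane} (hx : x ∈ Ω) :
    ∃ O, IsOpen O ∧ x ∈ O ∧ OscControlled Ω (O ∩ Ω) := by
  obtain ⟨ρ, hρ, hsub⟩ := Metric.isOpen_iff.1 ho x hx
  have subset : Metric.ball x (4 * (ρ / 4)) ⊆ Ω := by rwa [mul_div_cancel₀ ρ four_ne_zero]
  refine ⟨Metric.ball x (ρ / 4), Metric.isOpen_ball, Metric.mem_ball_self (by positivity), ?_⟩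
  exact (OscControlled.of_ball (by positivity) subset).mono hb
    ((Metric.ball_subset_ball (by linarith)).trans hsub) Set.inter_subset_left

lemma exists_nhds_oscControlled_of_mem_frontier {Ω : Set Plane} (hΩ : IsBoundedLipschitzDomain Ω)
    {x : Plane} (hx : x ∈ frontier Ω) :
    ∃ O, IsOpen O ∧ x ∈ O ∧ OscControlled Ω (O ∩ Ω) := by
  obtain ⟨e, γ, L, hγ, hgraph⟩ := hΩ.lipschitzBoundary x hx
  replace hgraph : ∀ᶠ y in 𝓝 x, (y ∈ Ω ↔ 0 < height e γ y) := by simpa [height] using hgraph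
  obtain ⟨ρ, hρ, hball⟩ := Metric.eventually_nhds_iff_ball.1 hgraph
  have on_graph := height_eq_zero_of_mem_frontier hγ.continuous hΩ.isOpen hx hgraph
  let h := ρ / (4 + L)
  have hh : 0 < h := by positivity
  have hρ' : (4 + L) * h ≤ ρ := (mul_div_cancel₀ ρ (by positivity)).le
  let O := {y | |e y 0 - e x 0| < whitneyWidth L * h} ∩ {y | height e γ y < h} ∩ Metric.ball x ρ
  refine ⟨O, ?_, ?_, ?_⟩
  · have abscissa : Continuous fun y => |e y 0 - e x 0| := by fun_prop
    exact ((isOpen_lt abscissa continuous_const).inter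
      (isOpen_lt (continuous_height hγ.continuous) continuous_const)).inter Metric.isOpen_ball
  · have abscissa_near : |e x 0 - e x 0| < whitneyWidth L * h := by
      simpa using mul_pos whitneyWidth_pos hh
    exact ⟨⟨abscissa_near, on_graph.trans_lt hh⟩, Metric.mem_ball_self hρ⟩
  · refine (oscControlled_patch hγ hΩ.isBounded hh on_graph hρ' hball).mono hΩ.isBounded
      (patch_subset hγ hh on_graph hρ' hball) ?_
    rintro y ⟨⟨⟨abscissa_near, height_lt⟩, near⟩, hyΩ⟩
    exact ⟨abscissa_near, (hball y near).1 hyΩ, height_lt⟩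

theorem oscControlled_of_lipschitz {Ω : Set Plane} (hΩ : IsBoundedLipschitzDomain Ω) :
    OscControlled Ω Ω := by
  refine OscControlled.of_local hΩ.isBounded hΩ.isOpen hΩ.isConnected fun x hx => ?_
  by_cases hxΩ : x ∈ Ω
  · exact exists_nhds_oscControlled_of_mem hΩ.isOpen hΩ.isBounded hxΩ
  · refine exists_nhds_oscControlled_of_mem_frontier hΩ ?_
    rw [hΩ.isOpen.frontier_eq]
    exact ⟨hx, hxΩ⟩

/-! ### Test functions in the Sobolev spaces -/

section Sobolev

variable {Ω : Set Plane}

/-- The element `(φ, ∇φ)` of `L²(Ω) × L²(Ω)²` given by a test function `φ`. -/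
def IsTestFunction.jet {φ : Plane → ℝ} (hφ : IsTestFunction Ω φ) : Jet Ω :=
  ((hφ.memLp_restrict Ω).toLp φ,
    fun i => ((hφ.partialDeriv i).memLp_restrict Ω).toLp (StokesLPS.partialDeriv i φ))

lemma IsTestFunction.jet_fst_ae_eq {φ : Plane → ℝ} (hφ : IsTestFunction Ω φ) :
    hφ.jet.1 =ᵐ[volume.restrict Ω] φ :=
  (hφ.memLp_restrict Ω).coeFn_toLp

lemma IsTestFunction.jet_snd_ae_eq {φ : Plane → ℝ} (hφ : IsTestFunction Ω φ) (i : Fin 2) :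
    hφ.jet.2 i =ᵐ[volume.restrict Ω] StokesLPS.partialDeriv i φ :=
  ((hφ.partialDeriv i).memLp_restrict Ω).coeFn_toLp

lemma IsTestFunction.jet_mem_H10 {φ : Plane → ℝ} (hφ : IsTestFunction Ω φ) : hφ.jet ∈ H10 Ω :=
  Submodule.le_topologicalClosure _ <| Submodule.subset_span
    ⟨φ, hφ.contDiff, hφ.hasCompactSupport, hφ.tsupport_subset, hφ.jet_fst_ae_eq,
      hφ.jet_snd_ae_eq⟩

/-- The element of `H¹₀(Ω)²` given by a pair of test functions. -/
def testVelocity {w : Fin 2 → Plane → ℝ} (hw : ∀ i, IsTestFunction Ω (w i)) : Velocity Ω :=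
  fun i => ⟨(hw i).jet, (hw i).jet_mem_H10⟩

lemma aForm_testVelocity {w : Fin 2 → Plane → ℝ} (hw : ∀ i, IsTestFunction Ω (w i)) :
    aForm (testVelocity hw) (testVelocity hw) = energy w := by
  refine Finset.sum_congr rfl fun i _ => Finset.sum_congr rfl fun j _ => ?_
  have grad_eq := (hw i).jet_snd_ae_eq j
  calc inner ℝ ((testVelocity hw).grad i j) ((testVelocity hw).grad i j)
      = ∫ x in Ω, partialDeriv j (w i) x * partialDeriv j (w i) x :=
        inner_eq_integral_of_ae_eq grad_eq grad_eq
    _ = ∫ x, partialDeriv j (w i) x ^ 2 := by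
        rw [((hw i).partialDeriv j).setIntegral_mul_eq]
        simp only [pow_two]

lemma bForm_testVelocity {w : Fin 2 → Plane → ℝ} (hw : ∀ i, IsTestFunction Ω (w i)) (p : L2 Ω) :
    bForm (testVelocity hw) p = ∫ x in Ω, p x * ∑ i, partialDeriv i (w i) x := by
  simp only [Finset.mul_sum]
  rw [bForm, Velocity.div, sum_inner, integral_finsetSum _
    fun i _ => ((hw i).partialDeriv i).integrable_mul (Lp.memLp p)]
  refine Finset.sum_congr rfl fun i _ => ?_
  rw [real_inner_comm]
  exact inner_eq_integral_of_ae_eq (ae_eq_refl p) ((hw i).jet_snd_ae_eq i)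

lemma MeanZero.sq_norm_le_integral_sq_sub {p : L2 Ω} (hb : Bornology.IsBounded Ω)
    (hp : MeanZero p) (c : ℝ) : ‖p‖ ^ 2 ≤ ∫ x in Ω, (p x - c) ^ 2 := by
  have : IsFiniteMeasure (volume.restrict Ω) := ⟨by simpa using hb.measure_lt_top⟩
  have sq_integrable : Integrable (fun x => p x ^ 2) (volume.restrict Ω) :=
    (Lp.memLp p).integrable_sq
  have mul_integrable : Integrable (fun x => 2 * c * p x) (volume.restrict Ω) :=
    ((Lp.memLp p).integrable one_le_two).const_mul _
  calc ‖p‖ ^ 2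
      = ∫ x in Ω, (p x ^ 2 - 2 * c * p x) := by
        rw [integral_sub sq_integrable mul_integrable, integral_const_mul,
          show ∫ x in Ω, p x = 0 from hp, mul_zero, sub_zero]
        exact sq_norm_eq_integral_of_ae_eq (ae_eq_refl p)
    _ ≤ ∫ x in Ω, (p x - c) ^ 2 := by
        refine integral_mono (sq_integrable.sub mul_integrable)
          ((Lp.memLp p).sub (memLp_const c)).integrable_sq fun x => ?_
        simp only
        linarith [sq_nonneg c, sub_sq (p x) c]

lemma mem_testJets_of_mem_span {j : Jet Ω} (hj : j ∈ Submodule.span ℝ (testJets Ω)) :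
    j ∈ testJets Ω := by
  induction hj using Submodule.span_induction with
  | mem _ hj => exact hj
  | zero =>
    have zero : IsTestFunction Ω (fun _ => (0 : ℝ)) := .zero
    refine ⟨_, zero.contDiff, zero.hasCompactSupport, zero.tsupport_subset,
      Lp.coeFn_zero _ _ _, fun i => ?_⟩
    filter_upwards [Lp.coeFn_zero ℝ 2 (volume.restrict Ω)] with x hx
    simpa using hx
  | add j k _ _ hj hk =>
    obtain ⟨φ, hφ, hφc, hφΩ, fst_φ, snd_φ⟩ := hj
    obtain ⟨ψ, hψ, hψc, hψΩ, fst_ψ, snd_ψ⟩ := hk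
    have add := IsTestFunction.add ⟨hφ, hφc, hφΩ⟩ ⟨hψ, hψc, hψΩ⟩
    refine ⟨_, add.contDiff, add.hasCompactSupport, add.tsupport_subset, ?_, fun i => ?_⟩
    · filter_upwards [Lp.coeFn_add j.1 k.1, fst_φ, fst_ψ] with x add_x φ_x ψ_x
      rw [Prod.fst_add, add_x, Pi.add_apply, φ_x, ψ_x]
    · filter_upwards [Lp.coeFn_add (j.2 i) (k.2 i), snd_φ i, snd_ψ i] with x add_x φ_x ψ_x
      rw [Prod.snd_add, Pi.add_apply, add_x, Pi.add_apply, φ_x, ψ_x]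
      exact (partialDeriv_add hφ hψ i x).symm
  | smul c j _ hj =>
    obtain ⟨φ, hφ, hφc, hφΩ, fst_φ, snd_φ⟩ := hj
    have smul := IsTestFunction.const_mul ⟨hφ, hφc, hφΩ⟩ c
    refine ⟨_, smul.contDiff, smul.hasCompactSupport, smul.tsupport_subset, ?_, fun i => ?_⟩
    · filter_upwards [Lp.coeFn_smul c j.1, fst_φ] with x smul_x φ_x
      rw [Prod.smul_fst, smul_x, Pi.smul_apply, φ_x, smul_eq_mul]
    · filter_upwards [Lp.coeFn_smul c (j.2 i), snd_φ i] with x smul_x φ_x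
      rw [Prod.smul_snd, Pi.smul_apply, smul_x, Pi.smul_apply, φ_x]
      exact (partialDeriv_const_mul hφ c i x).symm

end Sobolev

section Poincare

variable {ι : Type*} [DecidableEq ι] [Fintype ι] {φ : EuclideanSpace ℝ ι → ℝ}

lemma partialDeriv_coord_mul_sq (hφ : ContDiff ℝ ∞ φ) (i : ι) (x : EuclideanSpace ℝ ι) :
    partialDeriv i (fun y => y i * (φ y * φ y)) x =
      2 * (x i * (φ x * partialDeriv i φ x)) + φ x ^ 2 := by
  have coord_deriv : partialDeriv i (fun y => y i) x = 1 := by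
    change fderiv ℝ (EuclideanSpace.proj i : EuclideanSpace ℝ ι →L[ℝ] ℝ) x _ = 1
    rw [ContinuousLinearMap.fderiv]
    simp
  rw [partialDeriv_mul (by fun_prop) (hφ.mul hφ), partialDeriv_mul hφ hφ, coord_deriv]
  ring

lemma IsTestFunction.integral_sq_le {U : Set (EuclideanSpace ℝ ι)} (hφ : IsTestFunction U φ)
    {i : ι} {R : ℝ} (hR : ∀ x ∈ U, |x i| ≤ R) :
    ∫ x, φ x ^ 2 ≤ (2 * R) ^ 2 * ∫ x, StokesLPS.partialDeriv i φ x ^ 2 := by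
  have mul_test : IsTestFunction U (fun x => x i * (φ x * φ x)) :=
    (hφ.mul_right hφ.contDiff).mul_left (by fun_prop)
  have sq_integrable := hφ.memLp.integrable_sq
  have deriv_sq_integrable := (hφ.partialDeriv i).memLp.integrable_sq
  have integral_le : ∫ x, (1 / 2 * φ x ^ 2 - 2 * R ^ 2 * StokesLPS.partialDeriv i φ x ^ 2) ≤
      ∫ x, StokesLPS.partialDeriv i (fun x => x i * (φ x * φ x)) x := by
    refine integral_mono ((sq_integrable.const_mul _).sub (deriv_sq_integrable.const_mul _))
      (mul_test.partialDeriv i).integrable fun x => ?_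
    simp only [partialDeriv_coord_mul_sq hφ.contDiff]
    by_cases hx : x ∈ U
    · have coord_sq_le : x i ^ 2 ≤ R ^ 2 := sq_le_sq' (abs_le.1 (hR x hx)).1 (abs_le.1 (hR x hx)).2
      nlinarith [sq_nonneg (φ x + 2 * x i * StokesLPS.partialDeriv i φ x),
        mul_le_mul_of_nonneg_right coord_sq_le (sq_nonneg (StokesLPS.partialDeriv i φ x))]
    · rw [hφ.eq_zero_of_notMem hx, (hφ.partialDeriv i).eq_zero_of_notMem hx]
      simp
  rw [mul_test.integral_partialDeriv_eq_zero, integral_sub (sq_integrable.const_mul _)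
    (deriv_sq_integrable.const_mul _), integral_const_mul, integral_const_mul] at integral_le
  linarith

lemma exists_poincare {Ω : Set Plane} (hb : Bornology.IsBounded Ω) :
    ∃ C : ℝ, ∀ v : H10 Ω, ‖v.1.1‖ ≤ C * ‖v.1.2 0‖ := by
  obtain ⟨R, hR, hΩ⟩ := hb.subset_ball_lt 0 (0 : Plane)
  refine ⟨2 * R, fun v => ?_⟩
  have closed : IsClosed {j : Jet Ω | ‖j.1‖ ≤ 2 * R * ‖j.2 0‖} :=
    isClosed_le (by fun_prop) (by fun_prop)
  refine closure_minimal (fun j hj => ?_) closed v.2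
  obtain ⟨φ, hφ, hφc, hφΩ, fst_φ, snd_φ⟩ := mem_testJets_of_mem_span hj
  have test : IsTestFunction Ω φ := ⟨hφ, hφc, hφΩ⟩
  have coord_le (x : Plane) (hx : x ∈ Ω) : |x 0| ≤ R :=
    (PiLp.norm_apply_le x 0).trans (mem_ball_zero_iff.1 (hΩ hx)).le
  have poincare := test.integral_sq_le coord_le
  have snd_test := test.partialDeriv 0
  have snd_ae_eq : j.2 0 =ᵐ[volume.restrict Ω] partialDeriv 0 φ := snd_φ 0
  have sq_eq {f : Plane → ℝ} (hf : IsTestFunction Ω f) : ∫ x, f x ^ 2 = ∫ x in Ω, f x ^ 2 := by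
    simpa only [pow_two] using (hf.setIntegral_mul_eq f).symm
  rw [sq_eq test, sq_eq snd_test, ← sq_norm_eq_integral_of_ae_eq fst_φ,
    ← sq_norm_eq_integral_of_ae_eq snd_ae_eq, ← mul_pow] at poincare
  exact le_of_sq_le_sq poincare (by positivity)

end Poincare

/-! ### The forms as inner products -/

section Forms

variable {Ω : Set Plane}

/-- The underlying field of a velocity, as an element of the Hilbert space `L²(Ω)²`. -/
def valL2 : Velocity Ω →ₗ[ℝ] PiLp 2 (fun _ : Fin 2 => L2 Ω) where
  toFun v := WithLp.toLp 2 v.val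
  map_add' _ _ := rfl
  map_smul' _ _ := rfl

/-- The gradient of a velocity, as an element of the Hilbert space `L²(Ω)²ˣ²`. -/
def gradL2 : Velocity Ω →ₗ[ℝ] PiLp 2 (fun _ : Fin 2 × Fin 2 => L2 Ω) where
  toFun v := WithLp.toLp 2 fun k => v.grad k.1 k.2
  map_add' _ _ := rfl
  map_smul' _ _ := rfl

/-- A velocity together with its gradient; `‖·‖₁` is the norm of this element. -/
def jetL2 : Velocity Ω →ₗ[ℝ]
    WithLp 2 (PiLp 2 (fun _ : Fin 2 => L2 Ω) × PiLp 2 (fun _ : Fin 2 × Fin 2 => L2 Ω)) where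
  toFun v := WithLp.toLp 2 (valL2 v, gradL2 v)
  map_add' _ _ := rfl
  map_smul' _ _ := rfl

lemma rForm_eq_inner (f g : Fin 2 → L2 Ω) :
    rForm f g = inner ℝ (WithLp.toLp 2 f) (WithLp.toLp 2 g) :=
  (PiLp.inner_apply _ _).symm

lemma rForm_val_eq_inner (u v : Velocity Ω) : rForm u.val v.val = inner ℝ (valL2 u) (valL2 v) :=
  rForm_eq_inner _ _

lemma aForm_eq_inner (u v : Velocity Ω) : aForm u v = inner ℝ (gradL2 u) (gradL2 v) := by
  rw [PiLp.inner_apply, Fintype.sum_prod_type]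
  rfl

lemma norm1_sq (v : Velocity Ω) : norm1 v ^ 2 = ‖valL2 v‖ ^ 2 + ‖gradL2 v‖ ^ 2 := by
  rw [norm1, rForm_val_eq_inner, aForm_eq_inner, real_inner_self_eq_norm_sq,
    real_inner_self_eq_norm_sq, Real.sq_sqrt (by positivity)]

lemma norm1_nonneg (v : Velocity Ω) : 0 ≤ norm1 v := Real.sqrt_nonneg _

lemma norm1_eq_norm (v : Velocity Ω) : norm1 v = ‖jetL2 v‖ := by
  rw [← sq_eq_sq₀ (norm1_nonneg v) (norm_nonneg _), WithLp.prod_norm_sq_eq_of_L2]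
  exact norm1_sq v

lemma norm_valL2_le (v : Velocity Ω) : ‖valL2 v‖ ≤ norm1 v :=
  le_of_sq_le_sq (by linarith [norm1_sq v, sq_nonneg ‖gradL2 v‖]) (norm1_nonneg v)

lemma norm_gradL2_le (v : Velocity Ω) : ‖gradL2 v‖ ≤ norm1 v :=
  le_of_sq_le_sq (by linarith [norm1_sq v, sq_nonneg ‖valL2 v‖]) (norm1_nonneg v)

lemma norm1_smul (c : ℝ) (v : Velocity Ω) : norm1 (c • v) = |c| * norm1 v := by
  rw [norm1_eq_norm, norm1_eq_norm, map_smul, norm_smul, Real.norm_eq_abs]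

lemma norm1_neg (v : Velocity Ω) : norm1 (-v) = norm1 v := by
  rw [norm1_eq_norm, norm1_eq_norm, map_neg, norm_neg]

lemma norm1_sub_le (u v w : Velocity Ω) : norm1 (u - w) ≤ norm1 (v - u) + norm1 (v - w) := by
  simp only [norm1_eq_norm, map_sub]
  rw [norm_sub_rev (jetL2 v) (jetL2 u)]
  exact norm_sub_le_norm_sub_add_norm_sub _ _ _

lemma abs_rForm_le (f : Fin 2 → L2 Ω) (v : Velocity Ω) :
    |rForm f v.val| ≤ √(rForm f f) * norm1 v := by
  rw [rForm_eq_inner f f, real_inner_self_eq_norm_sq, Real.sqrt_sq (norm_nonneg _),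
    rForm_eq_inner]
  exact (abs_real_inner_le_norm _ _).trans
    (mul_le_mul_of_nonneg_left (norm_valL2_le v) (norm_nonneg _))

lemma abs_aForm_le (u v : Velocity Ω) : |aForm u v| ≤ norm1 u * norm1 v := by
  rw [aForm_eq_inner]
  exact (abs_real_inner_le_norm _ _).trans (mul_le_mul (norm_gradL2_le u) (norm_gradL2_le v)
    (norm_nonneg _) (norm1_nonneg u))

lemma abs_bForm_le (v : Velocity Ω) (p : L2 Ω) : |bForm v p| ≤ 2 * norm1 v * ‖p‖ := by
  have grad_le (i : Fin 2) : ‖v.grad i i‖ ≤ norm1 v :=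
    (PiLp.norm_apply_le (gradL2 v) (i, i)).trans (norm_gradL2_le v)
  have div_le : ‖v.div‖ ≤ 2 * norm1 v := by
    rw [Velocity.div, Fin.sum_univ_two]
    linarith [norm_add_le (v.grad 0 0) (v.grad 1 1), grad_le 0, grad_le 1]
  exact (abs_real_inner_le_norm _ _).trans (mul_le_mul_of_nonneg_right div_le (norm_nonneg p))

lemma bForm_sub_left (u v : Velocity Ω) (p : L2 Ω) : bForm (u - v) p = bForm u p - bForm v p := by
  have div_sub : (u - v).div = u.div - v.div :=
    Finset.sum_sub_distrib (fun i => u.grad i i) fun i => v.grad i i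
  rw [bForm, div_sub, inner_sub_left]
  rfl

lemma bForm_sub_right (u : Velocity Ω) (p q : L2 Ω) : bForm u (p - q) = bForm u p - bForm u q :=
  inner_sub_right _ _ _

lemma MeanZero.sub (hb : Bornology.IsBounded Ω) {p q : L2 Ω} (hp : MeanZero p) (hq : MeanZero q) :
    MeanZero (p - q) := by
  have : IsFiniteMeasure (volume.restrict Ω) := ⟨by simpa using hb.measure_lt_top⟩
  have integrable (f : L2 Ω) : Integrable f (volume.restrict Ω) :=
    (Lp.memLp f).integrable one_le_two
  calc ∫ x in Ω, (p - q : L2 Ω) x = ∫ x in Ω, (p x - q x) := integral_congr_ae (Lp.coeFn_sub p q)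
    _ = (∫ x in Ω, p x) - ∫ x in Ω, q x := integral_sub (integrable p) (integrable q)
    _ = 0 := by rw [show ∫ x in Ω, p x = 0 from hp, show ∫ x in Ω, q x = 0 from hq, sub_zero]

lemma Stabilization.form_self_nonneg (S : Stabilization Ω) (p : H1 Ω) : 0 ≤ S.form p p :=
  Finset.sum_nonneg fun K _ => mul_nonneg (S.α_nonneg K)
    (Finset.sum_nonneg fun _ _ => real_inner_self_nonneg)

lemma bddAbove_normNeg1 (f : Fin 2 → L2 Ω) :
    BddAbove {t | ∃ v : Velocity Ω, norm1 v ≤ 1 ∧ t = rForm f v.val} := by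
  refine ⟨√(rForm f f), ?_⟩
  rintro _ ⟨v, hv, rfl⟩
  exact (le_abs_self _).trans ((abs_rForm_le f v).trans
    (mul_le_of_le_one_right (Real.sqrt_nonneg _) hv))

lemma normNeg1_nonneg (f : Fin 2 → L2 Ω) : 0 ≤ normNeg1 f := by
  refine le_csSup (bddAbove_normNeg1 f) ⟨0, ?_, ?_⟩
  · simp [norm1_eq_norm]
  · rw [rForm_eq_inner]
    exact (inner_zero_right _).symm

lemma rForm_le_normNeg1_mul (f : Fin 2 → L2 Ω) (v : Velocity Ω) :
    rForm f v.val ≤ normNeg1 f * norm1 v := by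
  obtain zero | pos := (norm1_nonneg v).eq_or_lt
  · have := (le_abs_self _).trans (abs_rForm_le f v)
    rwa [← zero, mul_zero] at this ⊢
  · rw [← div_le_iff₀ pos]
    refine le_csSup (bddAbove_normNeg1 f) ⟨(norm1 v)⁻¹ • v, ?_, ?_⟩
    · rw [norm1_smul, abs_of_pos (inv_pos.2 pos), inv_mul_cancel₀ pos.ne']
    · rw [rForm_eq_inner, rForm_eq_inner, div_eq_inv_mul]
      exact (real_inner_smul_right _ _ _).symm

lemma abs_rForm_le_normNeg1_mul (f : Fin 2 → L2 Ω) (v : Velocity Ω) :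
    |rForm f v.val| ≤ normNeg1 f * norm1 v := by
  refine abs_le'.2 ⟨rForm_le_normNeg1_mul f v, ?_⟩
  have neg_eq : rForm f (-v).val = -rForm f v.val := by
    rw [rForm_eq_inner, rForm_eq_inner]
    exact inner_neg_right (𝕜 := ℝ) _ (valL2 v)
  rw [← neg_eq, ← norm1_neg]
  exact rForm_le_normNeg1_mul f (-v)

lemma exists_norm1_sq_le (hb : Bornology.IsBounded Ω) :
    ∃ K : ℝ, 0 ≤ K ∧ ∀ v : Velocity Ω, norm1 v ^ 2 ≤ K * aForm v v := by
  obtain ⟨C, poincare⟩ := exists_poincare hb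
  refine ⟨C ^ 2 + 1, by positivity, fun v => ?_⟩
  have val_le : ‖valL2 v‖ ^ 2 ≤ C ^ 2 * ‖gradL2 v‖ ^ 2 := by
    rw [PiLp.norm_sq_eq_of_L2, PiLp.norm_sq_eq_of_L2, Fintype.sum_prod_type, Finset.mul_sum]
    refine Finset.sum_le_sum fun i _ => ?_
    calc ‖v.val i‖ ^ 2
        ≤ (C * ‖v.grad i 0‖) ^ 2 := pow_le_pow_left₀ (norm_nonneg _) (poincare (v i)) 2
      _ = C ^ 2 * ‖v.grad i 0‖ ^ 2 := mul_pow _ _ _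
      _ ≤ C ^ 2 * ∑ j, ‖v.grad i j‖ ^ 2 := by
        gcongr
        exact Finset.single_le_sum (f := fun j => ‖v.grad i j‖ ^ 2) (fun _ _ => by positivity)
          (Finset.mem_univ 0)
  rw [norm1_sq, aForm_eq_inner, real_inner_self_eq_norm_sq]
  linarith

end Forms

/-! ### Stability of the Stokes problem -/

section Stokes

variable {Ω : Set Plane} {u w : Velocity Ω} {p q : L2 Ω} {lam : ℝ}

theorem exists_infSup (hΩ : IsBoundedLipschitzDomain Ω) : ∃ C : ℝ, 0 ≤ C ∧ ∀ (p : L2 Ω) (M : ℝ),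
    MeanZero p → 0 ≤ M → (∀ v : Velocity Ω, |bForm v p| ≤ M * norm1 v) → ‖p‖ ≤ C * M := by
  obtain ⟨K, hK, coercive⟩ := exists_norm1_sq_le hΩ.isBounded
  obtain ⟨C, hC, osc⟩ := oscControlled_of_lipschitz hΩ
  refine ⟨√C * √K, by positivity, fun p M hp hM bounded => ?_⟩
  have gradBound : GradBound Ω p (M * √K) := fun w hw => by
    rw [← bForm_testVelocity hw, ← aForm_testVelocity hw, mul_assoc, ← Real.sqrt_mul hK]
    exact (bounded _).trans
      (mul_le_mul_of_nonneg_left (Real.le_sqrt_of_sq_le (coercive _)) hM)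
  obtain ⟨c, hc⟩ := osc p (M * √K) (Lp.memLp p) gradBound
  refine le_of_sq_le_sq ?_ (by positivity)
  calc ‖p‖ ^ 2 ≤ C * (M * √K) ^ 2 := (hp.sq_norm_le_integral_sq_sub hΩ.isBounded c).trans hc
    _ = (√C * √K * M) ^ 2 := by
      rw [mul_pow, mul_pow, mul_pow, Real.sq_sqrt hC]
      ring

theorem exists_stability (hΩ : IsBoundedLipschitzDomain Ω) :
    ∃ C : ℝ, 0 ≤ C ∧ ∀ (w : Velocity Ω) (q : L2 Ω) (F : ℝ), MeanZero q → bForm w q = 0 → 0 ≤ F →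
      (∀ v : Velocity Ω, |aForm w v - bForm v q| ≤ F * norm1 v) → norm1 w + ‖q‖ ≤ C * F := by
  obtain ⟨K, hK, coercive⟩ := exists_norm1_sq_le hΩ.isBounded
  obtain ⟨B, hB, infSup⟩ := exists_infSup hΩ
  refine ⟨K + B * (K + 1), by positivity, fun w q F hq incompressible hF residual => ?_⟩
  have velocity_le : norm1 w ≤ K * F := by
    have energy_le : aForm w w ≤ F * norm1 w := by
      simpa only [incompressible, sub_zero] using (le_abs_self _).trans (residual w)
    obtain zero | pos := (norm1_nonneg w).eq_or_lt
    · rw [← zero]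
      positivity
    · refine le_of_mul_le_mul_right ?_ pos
      linarith [coercive w, mul_le_mul_of_nonneg_left energy_le hK]
  have pressure_le : ‖q‖ ≤ B * ((K + 1) * F) := by
    refine infSup q _ hq (by positivity) fun v => ?_
    have aForm_le : |aForm w v| ≤ K * F * norm1 v :=
      (abs_aForm_le w v).trans (mul_le_mul_of_nonneg_right velocity_le (norm1_nonneg v))
    calc |bForm v q| = |aForm w v - (aForm w v - bForm v q)| := by rw [sub_sub_cancel]
      _ ≤ |aForm w v| + |aForm w v - bForm v q| := abs_sub _ _
      _ ≤ (K + 1) * F * norm1 v := by linarith [residual v]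
  linarith

lemma IsStokesEigen.abs_residual_le (hu : IsStokesEigen u p lam) {f : Fin 2 → L2 Ω} {lamh : ℝ}
    (hf : rForm f f ≤ 1) {ut : Velocity Ω} {pt : L2 Ω} (hut : IsStokesSource (lamh • f) ut pt)
    (v : Velocity Ω) : |aForm (ut - u) v - bForm v (pt - p)| ≤
      (|lam| + 1) * (normNeg1 (u.val - f) + |lam - lamh|) * norm1 v := by
  have load_le : |rForm f v.val| ≤ norm1 v :=
    (abs_rForm_le f v).trans (mul_le_of_le_one_left (norm1_nonneg v) (Real.sqrt_le_one.2 hf))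
  have residual_eq : aForm (ut - u) v - bForm v (pt - p) =
      -(lam * rForm (u.val - f) v.val) - (lam - lamh) * rForm f v.val := by
    have source := hut.momentum v
    have eigen := hu.momentum v
    simp only [rForm_eq_inner, aForm_eq_inner, bForm_sub_right, map_sub, WithLp.toLp_sub,
      WithLp.toLp_smul, inner_sub_left, real_inner_smul_left] at source eigen ⊢
    linarith
  have normNeg1_nonneg := normNeg1_nonneg (u.val - f)
  calc |aForm (ut - u) v - bForm v (pt - p)|
      ≤ |lam| * |rForm (u.val - f) v.val| + |lam - lamh| * |rForm f v.val| := by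
        rw [residual_eq, ← abs_mul, ← abs_mul, ← abs_neg (lam * _)]
        exact abs_sub _ _
    _ ≤ |lam| * (normNeg1 (u.val - f) * norm1 v) + |lam - lamh| * norm1 v := by
        gcongr
        exact abs_rForm_le_normNeg1_mul _ _
    _ = (|lam| * normNeg1 (u.val - f) + 1 * |lam - lamh|) * norm1 v := by ring
    _ ≤ ((|lam| + 1) * normNeg1 (u.val - f) + (|lam| + 1) * |lam - lamh|) * norm1 v := by
        gcongr
        · exact norm1_nonneg v
        · linarith
        · linarith [abs_nonneg lam]
    _ = _ := by ring

theorem exists_error_le (hΩ : IsBoundedLipschitzDomain Ω) (lam : ℝ) : ∃ C : ℝ, 0 < C ∧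
    ∀ (u : Velocity Ω) (p : L2 Ω), IsStokesEigen u p lam →
    ∀ (f : Fin 2 → L2 Ω) (lamh : ℝ), rForm f f ≤ 1 →
    ∀ (ut : Velocity Ω) (pt : L2 Ω), IsStokesSource (lamh • f) ut pt →
    ∀ (w : Velocity Ω) (q : L2 Ω), norm1 (w - u) + ‖q - p‖ ≤
      C * (normNeg1 (u.val - f) + |lam - lamh| + norm1 (ut - w) + ‖pt - q‖) := by
  obtain ⟨C, hC, stability⟩ := exists_stability hΩ
  refine ⟨C * (|lam| + 1) + 1, by positivity, fun u p hu f lamh hf ut pt hut w q => ?_⟩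
  have normNeg1_nonneg := normNeg1_nonneg (u.val - f)
  have meanZero : MeanZero (pt - p) := hut.meanZero.sub hΩ.isBounded hu.meanZero
  have incompressible : bForm (ut - u) (pt - p) = 0 := by
    rw [bForm_sub_left, hut.incompressible _ meanZero, hu.incompressible _ meanZero, sub_zero]
  have source_error := stability (ut - u) (pt - p) _ meanZero incompressible (by positivity)
    (hu.abs_residual_le hf hut)
  have pressure_triangle : ‖q - p‖ ≤ ‖pt - q‖ + ‖pt - p‖ := by
    rw [norm_sub_rev pt q]
    exact norm_sub_le_norm_sub_add_norm_sub q pt p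
  have source_error_nonneg : 0 ≤ C * (|lam| + 1) * (norm1 (ut - w) + ‖pt - q‖) :=
    mul_nonneg (by positivity) (add_nonneg (norm1_nonneg _) (norm_nonneg _))
  linarith [norm1_sub_le w ut u, abs_nonneg (lam - lamh)]

/-! ### The Rayleigh quotient -/

lemma IsStokesEigen.defect_eq (hb : Bornology.IsBounded Ω) (hu : IsStokesEigen u p lam)
    (hq : MeanZero q) (w : Velocity Ω) : aForm w w - lam * rForm w.val w.val =
      ‖gradL2 (w - u)‖ ^ 2 - lam * ‖valL2 (w - u)‖ ^ 2 - 2 * bForm (w - u) (q - p) +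
        2 * bForm w q := by
  have pressure_zero : bForm u p = 0 := hu.incompressible p hu.meanZero
  have pressure_sub_zero : bForm u (q - p) = 0 := hu.incompressible _ (hq.sub hb hu.meanZero)
  have momentum := hu.momentum w
  have momentum_self := hu.momentum u
  rw [bForm_sub_left, pressure_sub_zero, bForm_sub_right, map_sub, map_sub]
  rw [pressure_zero] at momentum_self
  simp only [rForm_val_eq_inner, aForm_eq_inner, norm_sub_sq_real, real_inner_self_eq_norm_sq,
    real_inner_comm (gradL2 w), real_inner_comm (valL2 w)] at momentum momentum_self ⊢
  linarith

lemma IsStokesEigen.abs_defect_le (hb : Bornology.IsBounded Ω) (hu : IsStokesEigen u p lam)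
    (hq : MeanZero q) (w : Velocity Ω) : |aForm w w - lam * rForm w.val w.val| ≤
      (2 + |lam|) * (norm1 (w - u) + ‖q - p‖) ^ 2 + 2 * |bForm w q| := by
  have velocity_nonneg := norm1_nonneg (w - u)
  have grad_sq_le : ‖gradL2 (w - u)‖ ^ 2 ≤ norm1 (w - u) ^ 2 := by
    gcongr
    exact norm_gradL2_le _
  have val_sq_le : ‖valL2 (w - u)‖ ^ 2 ≤ norm1 (w - u) ^ 2 := by
    gcongr
    exact norm_valL2_le _
  have triangle (a b c d : ℝ) : |a - b - c + d| ≤ |a| + |b| + |c| + |d| :=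
    (abs_add_le _ _).trans (by linarith [abs_sub (a - b) c, abs_sub a b])
  rw [hu.defect_eq hb hq]
  calc _ ≤ _ := triangle _ _ _ _
    _ = ‖gradL2 (w - u)‖ ^ 2 + |lam| * ‖valL2 (w - u)‖ ^ 2 + 2 * |bForm (w - u) (q - p)| +
        2 * |bForm w q| := by
      simp only [abs_mul, abs_pow, abs_norm, abs_two]
    _ ≤ norm1 (w - u) ^ 2 + |lam| * norm1 (w - u) ^ 2 + 2 * (2 * norm1 (w - u) * ‖q - p‖) +
        2 * |bForm w q| := by
      gcongr
      exact abs_bForm_le _ _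
    _ ≤ _ := by
      nlinarith [sq_nonneg (norm1 (w - u)), sq_nonneg ‖q - p‖, abs_nonneg lam,
        mul_nonneg velocity_nonneg (norm_nonneg (q - p)),
        mul_nonneg (abs_nonneg lam) (mul_nonneg velocity_nonneg (norm_nonneg (q - p))),
        mul_nonneg (abs_nonneg lam) (sq_nonneg ‖q - p‖)]

lemma quarter_le_rForm (hu : rForm u.val u.val = 1) (h : norm1 (w - u) ≤ 1 / 2) :
    1 / 4 ≤ rForm w.val w.val := by
  have norm_eq : ‖valL2 u‖ = 1 := by
    rwa [rForm_val_eq_inner, real_inner_self_eq_norm_sq,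
      pow_eq_one_iff_of_nonneg (norm_nonneg _) two_ne_zero] at hu
  have half_le : 1 / 2 ≤ ‖valL2 w‖ := by
    have sub_le := (norm_valL2_le (w - u)).trans h
    rw [map_sub] at sub_le
    linarith [norm_sub_norm_le (valL2 u) (valL2 w), norm_sub_rev (valL2 u) (valL2 w)]
  rw [rForm_val_eq_inner, real_inner_self_eq_norm_sq]
  nlinarith

lemma IsStokesEigen.abs_rayleigh_sub_le (hb : Bornology.IsBounded Ω) (hu : IsStokesEigen u p lam)
    (hq : MeanZero q) {m : ℝ} (hm : 0 < m) (hw : m ≤ rForm w.val w.val) :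
    |rayleigh w - lam| ≤
      ((2 + |lam|) * (norm1 (w - u) + ‖q - p‖) ^ 2 + 2 * |bForm w q|) / m := by
  have pos := hm.trans_le hw
  have sub_eq : rayleigh w - lam =
      (aForm w w - lam * rForm w.val w.val) / rForm w.val w.val := by
    rw [rayleigh]
    field_simp
  rw [sub_eq, abs_div, abs_of_pos pos]
  exact div_le_div₀ (by positivity) (hu.abs_defect_le hb hq w) hm hw

lemma IsDiscreteSource.abs_bForm_eq {V : Set (Velocity Ω)} {Q : Set (H1 Ω)} {S : Stabilization Ω}
    {f : Fin 2 → L2 Ω} {p : H1 Ω} (hu : IsDiscreteSource V Q S f u p) :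
    |bForm u p.1.1| = S.form p p := by
  rw [eq_neg_of_add_eq_zero_left (hu.stabilized p hu.mem_pressure), abs_neg,
    abs_of_nonneg (S.form_self_nonneg p)]

end Stokes

end StokesLPS

end

theorem theorem5p1_general (Ω : Set Plane) (hΩ : IsBoundedLipschitzDomain Ω) (lam : ℝ) :
    ∃ δ : ℝ, 0 < δ ∧ ∀ c₀ : ℝ, 0 < c₀ → ∃ C : ℝ, 0 < C ∧
      ∀ (u : Velocity Ω) (p : L2 Ω), IsStokesEigen u p lam →
      ∀ (f : Fin 2 → L2 Ω) (lamh : ℝ), rForm f f ≤ 1 →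
      ∀ (ut : Velocity Ω) (pt : L2 Ω), IsStokesSource (lamh • f) ut pt →
      ∀ (w : Velocity Ω) (q : L2 Ω), MeanZero q → ∀ ε : ℝ,
        ε = normNeg1 (u.val - f) + |lam - lamh| + norm1 (ut - w) + ‖pt - q‖ →
        ((ε ≤ δ ∨ c₀ ≤ rForm w.val w.val) →
          |rayleigh w - lam| ≤ C * ε ^ 2 + C * |bForm w q|) ∧
        norm1 (w - u) + ‖q - p‖ ≤ C * ε := by
  obtain ⟨C₁, hC₁, error_le⟩ := exists_error_le hΩ lam
  refine ⟨1 / (2 * C₁), by positivity, fun c₀ hc₀ => ?_⟩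
  obtain ⟨m, hm, m_le_c₀, m_le_quarter⟩ : ∃ m : ℝ, 0 < m ∧ m ≤ c₀ ∧ m ≤ 1 / 4 :=
    ⟨min c₀ (1 / 4), by positivity, min_le_left _ _, min_le_right _ _⟩
  refine ⟨C₁ + ((2 + |lam|) * C₁ ^ 2 + 2) / m, by positivity, ?_⟩
  intro u p hu f lamh hf ut pt hut w q hq ε hε
  have error_le_ε : norm1 (w - u) + ‖q - p‖ ≤ C₁ * ε := hε ▸ error_le u p hu f lamh hf ut pt hut w q
  have error_nonneg : 0 ≤ norm1 (w - u) + ‖q - p‖ := add_nonneg (norm1_nonneg _) (norm_nonneg _)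
  have ε_nonneg : 0 ≤ ε := nonneg_of_mul_nonneg_right (error_nonneg.trans error_le_ε) hC₁
  refine ⟨fun small_or_large => ?_, error_le_ε.trans
    (mul_le_mul_of_nonneg_right (le_add_of_nonneg_right (by positivity)) ε_nonneg)⟩
  have m_le_rForm : m ≤ rForm w.val w.val := by
    refine small_or_large.elim (fun small => ?_) m_le_c₀.trans
    have error_le_half : C₁ * ε ≤ 1 / 2 := by linarith [(le_div_iff₀ (by positivity)).1 small]
    exact m_le_quarter.trans
      (quarter_le_rForm hu.normalized (by linarith [norm_nonneg (q - p)]))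
  calc |rayleigh w - lam|
      ≤ ((2 + |lam|) * (norm1 (w - u) + ‖q - p‖) ^ 2 + 2 * |bForm w q|) / m :=
        hu.abs_rayleigh_sub_le hΩ.isBounded hq hm m_le_rForm
    _ ≤ ((2 + |lam|) * (C₁ * ε) ^ 2 + 2 * |bForm w q|) / m := by gcongr
    _ ≤ ((2 + |lam|) * (C₁ * ε) ^ 2 + 2 * |bForm w q|) / m + (C₁ * (ε ^ 2 + |bForm w q|) +
        (2 * ε ^ 2 + (2 + |lam|) * C₁ ^ 2 * |bForm w q|) / m) :=
      le_add_of_nonneg_right (by positivity)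
    _ = _ := by ring

theorem theorem5p1 (Ω : Set Plane) (hΩ : IsBoundedLipschitzDomain Ω) (lam : ℝ) :
    ∃ δ : ℝ, 0 < δ ∧ ∀ c₀ : ℝ, 0 < c₀ → ∃ C : ℝ, 0 < C ∧
      -- the exact eigenpair
      ∀ (u : Velocity Ω) (p : L2 Ω), IsStokesEigen u p lam →
      -- the discrete eigenpair
      ∀ (S : Stabilization Ω) (W : ScalarFE S.mesh)
        (uh : Velocity Ω) (ph : H1 Ω) (lamh : ℝ),
        IsDiscreteEigen W.velocities W.pressures S uh ph lamh →
      -- the exact solution of the auxiliary source problem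
      ∀ (ut : Velocity Ω) (pt : L2 Ω), IsStokesSource (lamh • uh.val) ut pt →
      -- the enriched spaces, with their stabilization, and the discrete source problem
      ∀ (Vt : Submodule ℝ (Velocity Ω)) (Qt : Submodule ℝ (H1 Ω)) (St : Stabilization Ω),
        (∀ q ∈ Qt, MeanZero q.1.1) →
        W.velocities ⊆ (Vt : Set (Velocity Ω)) → W.pressures ⊆ (Qt : Set (H1 Ω)) →
      ∀ (uth : Velocity Ω) (pth : H1 Ω),
        IsDiscreteSource (Vt : Set (Velocity Ω)) (Qt : Set (H1 Ω)) St (lamh • uh.val) uth pth →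
      ∀ ε : ℝ,
        ε = normNeg1 (u.val - uh.val) + |lam - lamh| + norm1 (ut - uth) + ‖pt - pth.1.1‖ →
        ((ε ≤ δ ∨ c₀ ≤ rForm uth.val uth.val) →
          |rayleigh uth - lam| ≤ C * ε ^ 2 + C * St.form pth pth) ∧
        norm1 (uth - u) + ‖pth.1.1 - p‖ ≤ C * ε := by
  obtain ⟨δ, hδ, estimate⟩ := theorem5p1_general Ω hΩ lam
  refine ⟨δ, hδ, fun c₀ hc₀ => (estimate c₀ hc₀).imp fun C hC => ⟨hC.1, ?_⟩⟩
  intro u p hu S W uh ph lamh huh ut pt hut Vt Qt St meanZero _ _ uth pth huth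
  rw [← huth.abs_bForm_eq]
  exact hC.2 u p hu uh.val lamh huh.normalized.le ut pt hut uth pth.1.1
    (meanZero pth huth.mem_pressure)
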